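/- Let $m,n,p$ be integers with $1\le m\le p\le n$. In a system of $m+n$ fermionic modes, split into subsystems of dimensions $m$ and $n$, consider the ensemble of fermionic Gaussian states with fixed particle number $p$, described by its eigenvalues $x_1,\dots,x_m\in[-1,1]$, whose joint probability density is proportional to $$\prod_{1\le i<j\le m}(x_i-x_j)^2\prod_{i=1}^m(1+x_i)^{p-m}(1-x_i)^{n-p},\qquad x\in[-1,1]^m .$$ Let $$S=-\sum_{i=1}^m v(x_i),\qquad v(x)=\frac{1-x}{2}\ln\frac{1-x}{2}+\frac{1+x}{2}\ln\frac{1+x}{2}\quad(0\ln 0=0)$$ be the von Neumann entropy. Then $S$ has a finite second moment and its variance is $$\begin{aligned}\mathbb V[S]={}&c_0\,\psi_1(m+n-p)-(m+n)\,\psi_1(m+n)+n\,\psi_1(n)+c_1\,\psi_1(p)\\&+c_2\,\bigl(\psi_0(m+n-p)-\psi_0(p)\bigr)^2+c_3\,\bigl(\psi_0(m+n-p)-\psi_0(p)\bigr)-\psi_0(m+n)+\psi_0(n)+c_4,\end{aligned}$$ where $\psi_0(x)=\frac{d}{dx}\ln\Gamma(x)$, $\psi_1(x)=\frac{d^2}{dx^2}\ln\Gamma(x)$,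 $(a)_k=\Gamma(a+k)/\Gamma(a)$ and $$c_0=\frac{m(m+n-p)(m^2+2mn+n^2-np-1)}{(m+n-1)_3},\qquad c_1=\frac{mp(m^2+mn+np-1)}{(m+n-1)_3},$$ $$c_2=\frac{mnp(m+n-p)}{(m+n)(m+n-1)_3},\qquad c_3=-\frac{m(m+1)(m+n-2p)}{(m+n)(m+n)_2},\qquad c_4=-\frac{m(2m+n+2)}{(m+n)(m+n)_2}.$$ -/

import Mathlib

open MeasureTheory ProbabilityTheory

namespace FermionicGaussian

noncomputable section

/-- The digamma function `ψ₀(x) = d ln Γ(x) / dx` (used at positive reals only). -/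
def psi0 (x : ℝ) : ℝ := deriv (fun t : ℝ => Real.log (Real.Gamma t)) x

/-- The trigamma function `ψ₁(x) = d² ln Γ(x) / dx²` (used at positive reals only). -/
def psi1 (x : ℝ) : ℝ := iteratedDeriv 2 (fun t : ℝ => Real.log (Real.Gamma t)) x

/-- The Pochhammer symbol `(a)_k = Γ(a + k) / Γ(a)` (used at `a > 0` only). -/
def poch (a : ℝ) (k : ℕ) : ℝ := Real.Gamma (a + k) / Real.Gamma a

/-- `v(x) = (1-x)/2 ln((1-x)/2) + (1+x)/2 ln((1+x)/2)`; at `x = ±1` the convention `0 ln 0 = 0`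
is in force because `Real.log 0 = 0`. -/
def v (x : ℝ) : ℝ :=
  (1 - x) / 2 * Real.log ((1 - x) / 2) + (1 + x) / 2 * Real.log ((1 + x) / 2)

/-- The von Neumann entropy `S = -∑ v(xᵢ)` as a function of the eigenvalues `x₁, …, x_m`. -/
def entropy (m : ℕ) (x : Fin m → ℝ) : ℝ := -∑ i, v (x i)

/-- The unnormalized joint density of the eigenvalues,
`∏_{i<j} (xᵢ - xⱼ)² ∏ᵢ (1 + xᵢ)^(p-m) (1 - xᵢ)^(n-p)`, meant for `m ≤ p ≤ n`. -/
def weight (m n p : ℕ) (x : Fin m → ℝ) : ℝ :=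
  (∏ i, ∏ j ∈ Finset.Ioi i, (x i - x j) ^ 2) *
    ∏ i, (1 + x i) ^ (p - m) * (1 - x i) ^ (n - p)

/-- The measure on `ℝ^m` with density `weight m n p` on the cube `[-1,1]^m`. -/
def unnormalized (m n p : ℕ) : Measure (Fin m → ℝ) :=
  (volume.restrict (Set.Icc (fun _ => (-1 : ℝ)) (fun _ => (1 : ℝ)))).withDensity
    (fun x => ENNReal.ofReal (weight m n p x))

/-- The joint law of the eigenvalues: the probability measure on `[-1,1]^m` whose density is
proportional to `weight m n p`. -/
def ensemble (m n p : ℕ) : Measure (Fin m → ℝ) :=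
  (unnormalized m n p Set.univ)⁻¹ • unnormalized m n p

/-- The coefficient `c₀`. -/
def c0 (m n p : ℝ) : ℝ :=
  m * (m + n - p) * (m ^ 2 + 2 * m * n + n ^ 2 - n * p - 1) / poch (m + n - 1) 3

/-- The coefficient `c₁`. -/
def c1 (m n p : ℝ) : ℝ :=
  m * p * (m ^ 2 + m * n + n * p - 1) / poch (m + n - 1) 3

/-- The coefficient `c₂`. -/
def c2 (m n p : ℝ) : ℝ :=
  m * n * p * (m + n - p) / ((m + n) * poch (m + n - 1) 3)

/-- The coefficient `c₃`. -/
def c3 (m n p : ℝ) : ℝ :=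
  -(m * (m + 1) * (m + n - 2 * p) / ((m + n) * poch (m + n) 2))

/-- The coefficient `c₄`. -/
def c4 (m n : ℝ) : ℝ :=
  -(m * (2 * m + n + 2) / ((m + n) * poch (m + n) 2))

end

end FermionicGaussian

/-! With `t = (1 + x) / 2` the eigenvalues form a Jacobi ensemble on `[0, 1]` with weight `t ^ a *
(1 - t) ^ b`, where `a = p - m` and `b = n - p`, and the entropy is minus the linear statistic of
`s(t) = t log t + (1 - t) log (1 - t)`. Andréief's identity turns its variance into `detCov` of `s`
with itself (`variance_entropy`), a single sum minus a double sum over matrix elements between monic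
Jacobi polynomials `P_j`. The double sum is never evaluated directly; three facts replace it.

Differentiating the weight in `a` or `b` multiplies it by `log t` or `log (1 - t)`. Hence the
covariance of any statistic with one of these logarithms is a parameter derivative of its mean
(`IsJacobiFamily.hasDerivAt_detMean`), and closed forms of means suffice.

Put `ℓ = log t - log (1 - t)`, so that `s = t ℓ + log (1 - t)`. If `K` is the Christoffel–Darboux
kernel, `(t - u) K(t, u)` has only two terms; squaring it and integrating against `g(t) g(u)` gives
`Cov(t g, t g) = Cov(g, t² g)` plus an explicit boundary term (`detCov_mul_mul`). For `g = ℓ` one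
has `t² ℓ = s - log (1 - t) - t (1 - t) ℓ`, the variance of `log (1 - t)` cancels, and `Cov(s, s)`
is expressed through covariances with a logarithm (`detCov_entropy_decomposition`).

The means that remain are explicit. Matrix elements of the logarithms come from differentiating the
orthogonality relations and the norms of the `P_j` in `a` and `b`. The mean of `s` then follows from
the three-term recurrence (`detMean_entropy`), and that of `t (1 - t) ℓ` telescopes after an
integration by parts based on `s' = ℓ` (`detMean_flow`). Everything ends in a rational identity with
polygamma values as free variables (`detCov_entropy`). -/

/-! ### Monic Jacobi polynomials, treated algebraically through a moment functional. -/

open Polynomial in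
/-- The coefficient of `X ^ i` in the monic Jacobi polynomial of degree `j` on `[0, 1]` for the
weight `t ^ a * (1 - t) ^ b`. -/
noncomputable def jacobiCoeff (a b : ℝ) (j i : ℕ) : ℝ :=
  ∏ l ∈ Finset.Ico i j, (-((l + 1) * (l + a + 1)) / ((j - l) * (l + j + a + b + 1)))

open Polynomial in
/-- The monic Jacobi polynomial of degree `j` on `[0, 1]`. -/
noncomputable def jacobi (a b : ℝ) (j : ℕ) : ℝ[X] :=
  ∑ i ∈ Finset.range (j + 1), C (jacobiCoeff a b j i) * X ^ i

open Polynomial in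
/-- The Jacobi differential operator. -/
noncomputable def jacobiOp (a b : ℝ) (p : ℝ[X]) : ℝ[X] :=
  X * (X - 1) * derivative (derivative p) + (C (a + b + 2) * X - C (a + 1)) * derivative p

open Polynomial in
/-- A linear functional on polynomials whose moments are proportional to those of the weight
`t ^ a * (1 - t) ^ b` on `[0, 1]`. -/
structure IsJacobi (a b : ℝ) (L : ℝ[X] →ₗ[ℝ] ℝ) : Prop where
  -- Bounds at `-1/2` instead of `-1` force `a + b > -1`, so that `Γ(a + b + 1)` in the norm formula
  -- is positive, while integers `a, b ≥ 0` stay interior points at which one may differentiate in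
  -- the parameters.
  ha : -1 / 2 < a
  hb : -1 / 2 < b
  moment : ∀ k : ℕ, (k + a + b + 2) * L (X ^ (k + 1)) = (k + a + 1) * L (X ^ k)
  one_ne : L 1 ≠ 0

section Jacobi

open Polynomial

variable {a b : ℝ}

lemma jacobiCoeff_self (j : ℕ) : jacobiCoeff a b j j = 1 := by simp [jacobiCoeff]

lemma jacobiCoeff_of_lt {j i : ℕ} (h : i < j) : jacobiCoeff a b j i =
    (-((i + 1) * (i + a + 1)) / ((j - i) * (i + j + a + b + 1))) * jacobiCoeff a b j (i + 1) := by
  rw [jacobiCoeff, Finset.prod_eq_prod_Ico_succ_bot h]; rfl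

lemma coeff_jacobi (j i : ℕ) :
    (jacobi a b j).coeff i = if i ≤ j then jacobiCoeff a b j i else 0 := by
  simp [jacobi, coeff_C_mul, coeff_X_pow]

lemma degree_jacobi_le (j : ℕ) : (jacobi a b j).degree ≤ j := by
  rw [degree_le_iff_coeff_zero]
  intro i hi
  rw [coeff_jacobi, if_neg]
  exact_mod_cast not_le.2 hi

lemma jacobi_zero : jacobi a b 0 = 1 := by simp [jacobi, jacobiCoeff_self]

/-- The operator sends coefficients `c_i` to `i (i + a + b + 1) c_i - (i + 1) (i + a + 1) c_{i+1}`.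
The ratios in `jacobiCoeff` solve the eigenvalue equation, since the eigenvalues of indices `j` and
`i` differ by `(j - i) (i + j + a + b + 1)`. -/
lemma jacobiOp_jacobi (ha : -1 / 2 < a) (hb : -1 / 2 < b) (j : ℕ) :
    jacobiOp a b (jacobi a b j) = C ((j : ℝ) * (j + a + b + 1)) * jacobi a b j := by
  ext i
  have key : (jacobiOp a b (jacobi a b j)).coeff i =
      i * (i + a + b + 1) * (jacobi a b j).coeff i -
        (i + 1) * (i + a + 1) * (jacobi a b j).coeff (i + 1) := by
    have e : jacobiOp a b (jacobi a b j) = X * (X * derivative (derivative (jacobi a b j)))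
        - X * derivative (derivative (jacobi a b j)) +
        C (a + b + 2) * (X * derivative (jacobi a b j)) - C (a + 1) * derivative (jacobi a b j) := by
      rw [jacobiOp]; ring
    rw [e]
    rcases i with _ | _ | i
    · simp [coeff_derivative]
    · simp only [coeff_sub, coeff_add, coeff_C_mul, coeff_X_mul, coeff_derivative,
        mul_coeff_zero, coeff_X_zero]
      push_cast; ring
    · simp only [coeff_sub, coeff_add, coeff_C_mul, coeff_X_mul, coeff_derivative]
      push_cast; ring
  rw [key, coeff_C_mul, coeff_jacobi, coeff_jacobi]
  rcases lt_trichotomy i j with h | rfl | h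
  · rw [if_pos h.le, if_pos (Nat.succ_le_of_lt h), jacobiCoeff_of_lt h]
    have h1 : (i : ℝ) < j := by exact_mod_cast h
    have h1' : (i : ℝ) + 1 ≤ j := by exact_mod_cast h
    have h2 : (0 : ℝ) ≤ i := by positivity
    have h3 : (j : ℝ) - i ≠ 0 := by linarith
    have h4 : (i : ℝ) + j + a + b + 1 ≠ 0 := by
      have : 0 < (i : ℝ) + j + a + b + 1 := by linarith
      exact this.ne'
    field_simp
    ring
  · simp
  · rw [if_neg (by omega), if_neg (by omega)]; simp

variable {L : ℝ[X] →ₗ[ℝ] ℝ} (hL : IsJacobi a b L)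
include hL

/-- This is the vanishing of the integral of the derivative of `t ^ (a + 1) * (1 - t) ^ (b + 1) *
p`; on monomials it is exactly the moment recursion. -/
lemma IsJacobi.pearson (p : ℝ[X]) :
    L (X * (1 - X) * derivative p + (C (a + 1) - C (a + b + 2) * X) * p) = 0 := by
  induction p using Polynomial.induction_on' with
  | add p q hp hq =>
    rw [← add_zero (0 : ℝ)]
    nth_rewrite 1 [← hp]
    rw [← hq, ← map_add]
    congr 1
    rw [derivative_add]
    ring
  | monomial n c =>
    have e : X * (1 - X) * derivative (monomial n c) +
        (C (a + 1) - C (a + b + 2) * X) * monomial n c =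
        (c * (n + a + 1)) • X ^ n - (c * (n + a + b + 2)) • (X ^ (n + 1) : ℝ[X]) := by
      rw [derivative_monomial]
      simp only [← C_mul_X_pow_eq_monomial, smul_eq_C_mul]
      rcases n with _ | n
      · simp; ring
      · simp; ring
    rw [e, map_sub, map_smul, map_smul, smul_eq_mul, smul_eq_mul]
    linear_combination -c * hL.moment n

/-- The Pearson identity for `p' q`. The right side is symmetric in `p` and `q`, which makes the
operator self-adjoint. -/
lemma IsJacobi.jacobiOp_mul (p q : ℝ[X]) :
    L (jacobiOp a b p * q) = L (X * (1 - X) * derivative p * derivative q) := by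
  rw [← sub_eq_zero, ← map_sub, ← neg_eq_zero, ← map_neg, ← hL.pearson (derivative p * q)]
  congr 1
  rw [jacobiOp, derivative_mul]
  ring

lemma IsJacobi.jacobiOp_mul_comm (p q : ℝ[X]) :
    L (jacobiOp a b p * q) = L (p * jacobiOp a b q) := by
  rw [hL.jacobiOp_mul, mul_comm p, hL.jacobiOp_mul]
  congr 1
  ring

lemma IsJacobi.orthogonal {i j : ℕ} (hij : i ≠ j) : L (jacobi a b i * jacobi a b j) = 0 := by
  have h := hL.jacobiOp_mul_comm (jacobi a b i) (jacobi a b j)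
  rw [jacobiOp_jacobi hL.ha hL.hb, jacobiOp_jacobi hL.ha hL.hb, ← smul_eq_C_mul, ← smul_eq_C_mul,
    smul_mul_assoc, mul_smul_comm, map_smul, map_smul, smul_eq_mul, smul_eq_mul, ← sub_eq_zero,
    ← sub_mul] at h
  refine (mul_eq_zero.1 h).resolve_left ?_
  have e : (i : ℝ) * (i + a + b + 1) - j * (j + a + b + 1) =
      ((i : ℝ) - j) * (i + j + a + b + 1) := by ring
  rw [e]
  have h1 := hL.ha
  have h2 := hL.hb
  refine mul_ne_zero (sub_ne_zero.2 (by exact_mod_cast hij)) ?_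
  have h3 : (1 : ℝ) ≤ (i : ℝ) + j := by
    have : 1 ≤ i + j := by omega
    exact_mod_cast this
  have : 0 < (i : ℝ) + j + a + b + 1 := by linarith
  exact this.ne'

omit hL in
lemma degree_sub_C_mul_jacobi_lt {q : ℝ[X]} {n : ℕ} (hq : q.degree < (n + 1 : ℕ)) :
    (q - C (q.coeff n) * jacobi a b n).degree < n := by
  rw [degree_lt_iff_coeff_zero] at hq ⊢
  intro i hi
  rw [coeff_sub, coeff_C_mul, coeff_jacobi]
  rcases eq_or_lt_of_le hi with rfl | hi
  · simp [jacobiCoeff_self]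
  · rw [hq i hi, if_neg (by omega)]; simp

lemma IsJacobi.orthogonal_of_degree_lt {j : ℕ} {q : ℝ[X]} (hq : q.degree < j) :
    L (jacobi a b j * q) = 0 := by
  have main : ∀ n ≤ j, ∀ q : ℝ[X], q.degree < n → L (jacobi a b j * q) = 0 := by
    intro n
    induction n with
    | zero =>
      intro _ q hq
      have : q = 0 := by simpa [degree_lt_iff_coeff_zero, Polynomial.ext_iff] using hq
      simp [this]
    | succ n ih =>
      intro hn q hq
      have h1 := ih (by omega) _ (degree_sub_C_mul_jacobi_lt (a := a) (b := b) hq)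
      rw [mul_sub, map_sub, mul_left_comm, ← smul_eq_C_mul, map_smul,
        hL.orthogonal (by omega : j ≠ n)] at h1
      simpa using h1
  exact main j le_rfl q hq

/-- Nonvanishing of the norms is a hypothesis here because its proof, `IsJacobi.norm_ne`, is an
induction that itself relies on this expansion. -/
lemma IsJacobi.expand {n : ℕ} (hh : ∀ i < n, L (jacobi a b i ^ 2) ≠ 0) {q : ℝ[X]}
    (hq : q.degree < n) :
    q = ∑ i ∈ Finset.range n, C (L (q * jacobi a b i) / L (jacobi a b i ^ 2)) * jacobi a b i := by
  induction n generalizing q with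
  | zero => simpa [degree_lt_iff_coeff_zero, Polynomial.ext_iff] using hq
  | succ n ih =>
    have h1 := ih (fun i hi => hh i (by omega)) (degree_sub_C_mul_jacobi_lt (a := a) (b := b) hq)
    have hlt := degree_sub_C_mul_jacobi_lt (a := a) (b := b) hq
    have h2 : L (q * jacobi a b n) = q.coeff n * L (jacobi a b n ^ 2) := by
      have := hL.orthogonal_of_degree_lt hlt
      rw [mul_sub, map_sub, mul_left_comm, ← smul_eq_C_mul, map_smul, smul_eq_mul, ← sq,
        sub_eq_zero, mul_comm] at this
      exact this
    have h3 : ∀ i ∈ Finset.range n, C (L ((q - C (q.coeff n) * jacobi a b n) * jacobi a b i) /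
        L (jacobi a b i ^ 2)) * jacobi a b i =
        C (L (q * jacobi a b i) / L (jacobi a b i ^ 2)) * jacobi a b i := by
      intro i hi
      rw [Finset.mem_range] at hi
      rw [sub_mul, map_sub, mul_assoc, ← smul_eq_C_mul (a := q.coeff n), map_smul,
        hL.orthogonal (by omega : n ≠ i)]
      simp
    rw [Finset.sum_congr rfl h3] at h1
    rw [Finset.sum_range_succ, ← h1, h2, mul_div_assoc, div_self (hh n (by omega))]
    simp

end Jacobi

/-- The coefficient of `X ^ (j - 1)` in the monic Jacobi polynomial of degree `j`. -/
noncomputable def jacobiSub (a b j : ℝ) : ℝ := -(j * (j + a)) / (2 * j + a + b)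

/-- The coefficient of `X ^ (j - 2)` in the monic Jacobi polynomial of degree `j`. -/
noncomputable def jacobiSubSub (a b j : ℝ) : ℝ :=
  j * (j - 1) * (j + a) * (j + a - 1) / (2 * (2 * j + a + b) * (2 * j + a + b - 1))

/-- The diagonal coefficient of the three-term recurrence. -/
noncomputable def jacobiDiag (a b j : ℝ) : ℝ := jacobiSub a b j - jacobiSub a b (j + 1)

/-- The off-diagonal coefficient of the three-term recurrence. -/
noncomputable def jacobiOff (a b j : ℝ) : ℝ :=
  j * (j + a) * (j + b) * (j + a + b) / ((2 * j + a + b) ^ 2 * ((2 * j + a + b) ^ 2 - 1))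

/-- The squared norm of the monic Jacobi polynomial of degree `j`. -/
noncomputable def jacobiNorm (a b : ℝ) (j : ℕ) : ℝ :=
  j.factorial * Real.Gamma (j + a + 1) * Real.Gamma (j + b + 1) * Real.Gamma (j + a + b + 1) /
    (Real.Gamma (2 * j + a + b + 1) * Real.Gamma (2 * j + a + b + 2))

section Jacobi

open Polynomial

variable {a b : ℝ}

lemma jacobiCoeff_sub_one (j : ℕ) :
    jacobiCoeff a b (j + 1) j = jacobiSub a b ((j : ℝ) + 1) := by
  rw [jacobiCoeff_of_lt (Nat.lt_succ_self j), jacobiCoeff_self, jacobiSub]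
  push_cast
  rw [add_sub_cancel_left, one_mul, mul_one,
    show (j : ℝ) + (j + 1) + a + b + 1 = 2 * (j + 1) + a + b by ring,
    show (j : ℝ) + a + 1 = j + 1 + a by ring]

lemma jacobiCoeff_sub_two (j : ℕ) :
    jacobiCoeff a b (j + 2) j = jacobiSubSub a b ((j : ℝ) + 2) := by
  rw [jacobiCoeff_of_lt (by omega), jacobiCoeff_of_lt (i := j + 1) (by omega), jacobiCoeff_self,
    jacobiSubSub, mul_one, div_mul_div_comm]
  push_cast
  congr 1 <;> ring

lemma jacobi_one_coeff_zero : (jacobi a b 1).coeff 0 = jacobiSub a b 1 := by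
  rw [coeff_jacobi, if_pos (by omega)]
  simpa using jacobiCoeff_sub_one (a := a) (b := b) 0

lemma jacobiNorm_zero (hab : -1 < a + b) :
    jacobiNorm a b 0 = Real.Gamma (a + 1) * Real.Gamma (b + 1) / Real.Gamma (a + b + 2) := by
  have : Real.Gamma (a + b + 1) ≠ 0 := (Real.Gamma_pos_of_pos (by linarith)).ne'
  rw [jacobiNorm]
  simp only [Nat.factorial_zero, Nat.cast_one, Nat.cast_zero, zero_add, mul_zero, one_mul]
  field_simp

lemma jacobiNorm_succ (ha : -1 / 2 < a) (hb : -1 / 2 < b) (j : ℕ) :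
    jacobiNorm a b (j + 1) = jacobiOff a b ((j : ℝ) + 1) * jacobiNorm a b j := by
  have hj : (0 : ℝ) ≤ j := Nat.cast_nonneg j
  rw [jacobiNorm, jacobiNorm, jacobiOff, Nat.factorial_succ]
  push_cast
  rw [show (j : ℝ) + 1 + a + 1 = (j + a + 1) + 1 by ring,
    show (j : ℝ) + 1 + b + 1 = (j + b + 1) + 1 by ring,
    show (j : ℝ) + 1 + a + b + 1 = (j + a + b + 1) + 1 by ring,
    show 2 * ((j : ℝ) + 1) + a + b + 1 = (2 * j + a + b + 2) + 1 by ring,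
    show 2 * ((j : ℝ) + 1) + a + b + 2 = ((2 * j + a + b + 2) + 1) + 1 by ring,
    Real.Gamma_add_one (s := (j : ℝ) + a + 1) (by linarith),
    Real.Gamma_add_one (s := (j : ℝ) + b + 1) (by linarith),
    Real.Gamma_add_one (s := (j : ℝ) + a + b + 1) (by linarith),
    Real.Gamma_add_one (s := 2 * (j : ℝ) + a + b + 2 + 1) (by linarith),
    Real.Gamma_add_one (s := 2 * (j : ℝ) + a + b + 2) (by linarith)]
  have e : Real.Gamma (2 * (j : ℝ) + a + b + 2) =
      (2 * j + a + b + 1) * Real.Gamma (2 * j + a + b + 1) := by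
    rw [← Real.Gamma_add_one (by linarith)]
    congr 1; ring
  have h1 : Real.Gamma (2 * (j : ℝ) + a + b + 1) ≠ 0 := (Real.Gamma_pos_of_pos (by linarith)).ne'
  have h2 : 2 * (j : ℝ) + a + b + 1 ≠ 0 := by linarith
  have h3 : 2 * (j : ℝ) + a + b + 2 ≠ 0 := by linarith
  have h4 : 2 * (j : ℝ) + a + b + 3 ≠ 0 := by linarith
  have h5 : 2 * (j : ℝ) + a + b + 2 + 1 ≠ 0 := by linarith
  have h6 : 2 * ((j : ℝ) + 1) + a + b ≠ 0 := by linarith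
  have h7 : (2 * ((j : ℝ) + 1) + a + b) ^ 2 - 1 ≠ 0 := by
    rw [show (2 * ((j : ℝ) + 1) + a + b) ^ 2 - 1 =
      (2 * (j : ℝ) + a + b + 1) * (2 * (j : ℝ) + a + b + 3) by ring]
    exact mul_ne_zero h2 h4
  rw [e]
  field_simp
  ring

lemma jacobiNorm_pos (ha : -1 / 2 < a) (hb : -1 / 2 < b) (j : ℕ) : 0 < jacobiNorm a b j := by
  have hj : (0 : ℝ) ≤ j := Nat.cast_nonneg j
  have h1 := Real.Gamma_pos_of_pos (show 0 < (j : ℝ) + a + 1 by linarith)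
  have h2 := Real.Gamma_pos_of_pos (show 0 < (j : ℝ) + b + 1 by linarith)
  have h3 := Real.Gamma_pos_of_pos (show 0 < (j : ℝ) + a + b + 1 by linarith)
  have h4 := Real.Gamma_pos_of_pos (show 0 < 2 * (j : ℝ) + a + b + 1 by linarith)
  have h5 := Real.Gamma_pos_of_pos (show 0 < 2 * (j : ℝ) + a + b + 2 by linarith)
  have h6 : (0 : ℝ) < j.factorial := by exact_mod_cast j.factorial_pos
  rw [jacobiNorm]
  positivity

/-- The third coefficient from the top in the three-term recurrence. -/
lemma jacobiSubSub_recurrence (ha : -1 / 2 < a) (hb : -1 / 2 < b) {x : ℝ} (hx : 1 ≤ x) :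
    jacobiSubSub a b x - jacobiSubSub a b (x + 1) - jacobiDiag a b x * jacobiSub a b x =
      jacobiOff a b x := by
  -- Eliminating `b` in favour of `y = 2 x + a + b` makes every denominator a polynomial in `y`
  -- alone.
  obtain ⟨y, rfl⟩ : ∃ y, b = y - 2 * x - a := ⟨2 * x + a + b, by ring⟩
  have h1 : y ≠ 0 := by linarith
  have h2 : y - 1 ≠ 0 := by linarith
  have h3 : y + 1 ≠ 0 := by linarith
  have h4 : y + 2 ≠ 0 := by linarith
  rw [jacobiDiag, jacobiSubSub, jacobiSubSub, jacobiSub, jacobiSub, jacobiOff,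
    show 2 * (x + 1) + a + (y - 2 * x - a) - 1 = y + 1 by ring,
    show 2 * (x + 1) + a + (y - 2 * x - a) = y + 2 by ring,
    show 2 * x + a + (y - 2 * x - a) = y by ring,
    show y ^ 2 - 1 = (y - 1) * (y + 1) by ring]
  field_simp
  ring

lemma degree_recurrence_remainder_lt (ha : -1 / 2 < a) (hb : -1 / 2 < b) (j : ℕ) :
    (X * jacobi a b (j + 1) - jacobi a b (j + 2) -
      C (jacobiDiag a b ((j : ℝ) + 1)) * jacobi a b (j + 1) -
      C (jacobiOff a b ((j : ℝ) + 1)) * jacobi a b j).degree < (j : WithBot ℕ) := by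
  have hj : (0 : ℝ) ≤ j := Nat.cast_nonneg j
  have hrec := jacobiSubSub_recurrence ha hb (x := (j : ℝ) + 1) (by linarith)
  rw [degree_lt_iff_coeff_zero]
  intro i hi
  simp only [coeff_sub, coeff_C_mul]
  obtain rfl | rfl | rfl | hi : i = j ∨ i = j + 1 ∨ i = j + 2 ∨ j + 2 < i := by omega
  · have e : (X * jacobi a b (i + 1)).coeff i = jacobiSubSub a b ((i : ℝ) + 1) := by
      rcases i with _ | i
      · simp [jacobiSubSub]
      · rw [coeff_X_mul, coeff_jacobi, if_pos (by omega), jacobiCoeff_sub_two]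
        push_cast; congr 1; ring
    rw [e, coeff_jacobi, coeff_jacobi, coeff_jacobi, if_pos (by omega), if_pos (by omega),
      if_pos le_rfl, jacobiCoeff_self, jacobiCoeff_sub_one, jacobiCoeff_sub_two,
      show (i : ℝ) + 2 = i + 1 + 1 by ring]
    linarith
  · rw [coeff_X_mul, coeff_jacobi, coeff_jacobi, coeff_jacobi, coeff_jacobi, if_pos (by omega),
      if_pos (by omega), if_pos le_rfl, if_neg (by omega), jacobiCoeff_self, jacobiCoeff_sub_one,
      jacobiCoeff_sub_one (j + 1), jacobiDiag]
    push_cast; ring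
  · rw [coeff_X_mul, coeff_jacobi, coeff_jacobi, coeff_jacobi, coeff_jacobi, if_pos le_rfl,
      if_pos le_rfl, if_neg (by omega), if_neg (by omega), jacobiCoeff_self, jacobiCoeff_self]
    ring
  · obtain ⟨i, rfl⟩ : ∃ k, i = k + 1 := ⟨i - 1, by omega⟩
    rw [coeff_X_mul, coeff_jacobi, coeff_jacobi, coeff_jacobi, coeff_jacobi, if_neg (by omega),
      if_neg (by omega), if_neg (by omega), if_neg (by omega)]
    ring

variable {L : ℝ[X] →ₗ[ℝ] ℝ}

/-- The defect of the recurrence has degree below `j` because its top coefficients match, and it is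
orthogonal to every `P_i` with `i < j`; hence its expansion is zero. -/
lemma IsJacobi.recurrence_of_norm_ne (hL : IsJacobi a b L) {j : ℕ}
    (hh : ∀ i < j, L (jacobi a b i ^ 2) ≠ 0) :
    X * jacobi a b (j + 1) = jacobi a b (j + 2) +
      C (jacobiDiag a b ((j : ℝ) + 1)) * jacobi a b (j + 1) +
      C (jacobiOff a b ((j : ℝ) + 1)) * jacobi a b j := by
  have hlt := degree_recurrence_remainder_lt hL.ha hL.hb j
  have hexp := hL.expand hh hlt
  rw [Finset.sum_eq_zero] at hexp
  · linear_combination hexp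
  intro i hi
  rw [Finset.mem_range] at hi
  have h0 : L (jacobi a b (j + 1) * (X * jacobi a b i)) = 0 := by
    apply hL.orthogonal_of_degree_lt
    rw [degree_lt_iff_coeff_zero]
    intro k hk
    obtain ⟨k, rfl⟩ : ∃ l, k = l + 1 := ⟨k - 1, by omega⟩
    rw [coeff_X_mul, coeff_jacobi, if_neg (by omega)]
  have e : (X * jacobi a b (j + 1) - jacobi a b (j + 2) -
      C (jacobiDiag a b ((j : ℝ) + 1)) * jacobi a b (j + 1) -
      C (jacobiOff a b ((j : ℝ) + 1)) * jacobi a b j) * jacobi a b i =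
      jacobi a b (j + 1) * (X * jacobi a b i) - jacobi a b (j + 2) * jacobi a b i -
      jacobiDiag a b ((j : ℝ) + 1) • (jacobi a b (j + 1) * jacobi a b i) -
      jacobiOff a b ((j : ℝ) + 1) • (jacobi a b j * jacobi a b i) := by
    simp only [smul_eq_C_mul]; ring
  rw [e, map_sub, map_sub, map_sub, map_smul, map_smul, h0, hL.orthogonal (by omega),
    hL.orthogonal (by omega), hL.orthogonal (by omega)]
  simp

/-- `P_{j+1} - X P_j` has degree at most `j` and is orthogonal to `P_{j+1}`; applying the recurrence
to `X P_{j+1}` leaves the two norms. -/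
lemma IsJacobi.norm_succ_of_norm_ne (hL : IsJacobi a b L) {j : ℕ}
    (hh : ∀ i < j, L (jacobi a b i ^ 2) ≠ 0) :
    L (jacobi a b (j + 1) ^ 2) = jacobiOff a b ((j : ℝ) + 1) * L (jacobi a b j ^ 2) := by
  have h0 : L (jacobi a b (j + 1) * (jacobi a b (j + 1) - X * jacobi a b j)) = 0 := by
    apply hL.orthogonal_of_degree_lt
    rw [degree_lt_iff_coeff_zero]
    intro k hk
    obtain ⟨k, rfl⟩ : ∃ l, k = l + 1 := ⟨k - 1, by omega⟩
    rw [coeff_sub, coeff_X_mul, coeff_jacobi, coeff_jacobi]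
    obtain rfl | hk : k = j ∨ j < k := by omega
    · rw [if_pos le_rfl, if_pos le_rfl, jacobiCoeff_self, jacobiCoeff_self, sub_self]
    · rw [if_neg (by omega), if_neg (by omega), sub_self]
  have e : jacobi a b (j + 1) * (jacobi a b (j + 1) - X * jacobi a b j) =
      jacobi a b (j + 1) ^ 2 - jacobi a b (j + 2) * jacobi a b j -
      jacobiDiag a b ((j : ℝ) + 1) • (jacobi a b (j + 1) * jacobi a b j) -
      jacobiOff a b ((j : ℝ) + 1) • jacobi a b j ^ 2 := by
    simp only [smul_eq_C_mul]
    linear_combination (-jacobi a b j) * hL.recurrence_of_norm_ne hh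
  rw [e, map_sub, map_sub, map_sub, map_smul, map_smul, hL.orthogonal (by omega),
    hL.orthogonal (by omega)] at h0
  simp only [smul_eq_mul] at h0
  linarith

/-- The recurrence at level `j` uses only norms of index below `j`, so strong induction closes the
loop; the ratio `jacobiOff` is positive. -/
lemma IsJacobi.norm_ne (hL : IsJacobi a b L) (j : ℕ) : L (jacobi a b j ^ 2) ≠ 0 := by
  induction j using Nat.strong_induction_on with
  | _ j ih =>
    rcases j with _ | j
    · simpa [jacobi_zero] using hL.one_ne
    · have hj : (0 : ℝ) ≤ j := Nat.cast_nonneg j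
      have ha := hL.ha
      have hb := hL.hb
      rw [hL.norm_succ_of_norm_ne (fun i hi => ih i (by omega))]
      refine mul_ne_zero ?_ (ih j (by omega))
      rw [jacobiOff]
      have h1 : 0 < (2 * ((j : ℝ) + 1) + a + b) ^ 2 - 1 := by nlinarith
      have h2 : 0 < (j : ℝ) + 1 + a := by linarith
      have h3 : 0 < (j : ℝ) + 1 + b := by linarith
      have h4 : 0 < (j : ℝ) + 1 + a + b := by linarith
      have h5 : 0 < 2 * ((j : ℝ) + 1) + a + b := by linarith
      positivity

lemma IsJacobi.norm_succ (hL : IsJacobi a b L) (j : ℕ) :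
    L (jacobi a b (j + 1) ^ 2) = jacobiOff a b ((j : ℝ) + 1) * L (jacobi a b j ^ 2) :=
  hL.norm_succ_of_norm_ne fun i _ => hL.norm_ne i

/-- At `j = 0` the truncated index `j - 1` is harmless because `jacobiOff a b 0 = 0`. -/
lemma IsJacobi.recurrence (hL : IsJacobi a b L) (j : ℕ) :
    X * jacobi a b j = jacobi a b (j + 1) + C (jacobiDiag a b j) * jacobi a b j +
      C (jacobiOff a b j) * jacobi a b (j - 1) := by
  rcases j with _ | j
  · have h1 : jacobi a b 1 = X + C (jacobiSub a b 1) := by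
      have := coeff_jacobi (a := a) (b := b) 1
      rw [jacobi, Finset.sum_range_succ, Finset.sum_range_one, jacobiCoeff_self]
      have h := jacobi_one_coeff_zero (a := a) (b := b)
      rw [coeff_jacobi, if_pos (by omega)] at h
      rw [h]
      simp [add_comm]
    simp [jacobi_zero, h1, jacobiDiag, jacobiOff, jacobiSub]
  · have := hL.recurrence_of_norm_ne (j := j) fun i _ => hL.norm_ne i
    simpa using this

lemma IsJacobi.norm_eq (hL : IsJacobi a b L)
    (h1 : L 1 = Real.Gamma (a + 1) * Real.Gamma (b + 1) / Real.Gamma (a + b + 2)) (j : ℕ) :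
    L (jacobi a b j ^ 2) = jacobiNorm a b j := by
  induction j with
  | zero =>
    have ha := hL.ha
    have hb := hL.hb
    rw [jacobi_zero, one_pow, h1, jacobiNorm_zero (by linarith)]
  | succ j ih => rw [hL.norm_succ, ih, jacobiNorm_succ hL.ha hL.hb]

end Jacobi

/-! ### Covariances of linear statistics and the Christoffel–Darboux kernel. -/

section LinearStatistics

variable {A : Type*} [CommRing A] [Algebra ℝ A]

/-- The mean of the linear statistic `g` in the determinantal ensemble of `m` particles built from
the orthogonal family `π` for the functional `Λ`. -/
noncomputable def detMean (Λ : A →ₗ[ℝ] ℝ) (π : ℕ → A) (m : ℕ) (g : A) : ℝ :=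
  ∑ j ∈ Finset.range m, Λ (g * π j ^ 2) / Λ (π j ^ 2)

/-- The covariance of the linear statistics `g` and `h` in the determinantal ensemble of `m`
particles built from the orthogonal family `π` for the functional `Λ`. -/
noncomputable def detCov (Λ : A →ₗ[ℝ] ℝ) (π : ℕ → A) (m : ℕ) (g h : A) : ℝ :=
  ∑ j ∈ Finset.range m, Λ (g * h * π j ^ 2) / Λ (π j ^ 2) -
    ∑ i ∈ Finset.range m, ∑ j ∈ Finset.range m,
      Λ (g * (π i * π j)) * Λ (h * (π i * π j)) / (Λ (π i ^ 2) * Λ (π j ^ 2))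

variable (Λ : A →ₗ[ℝ] ℝ) (π : ℕ → A) (m : ℕ)

lemma detCov_comm (g h : A) : detCov Λ π m g h = detCov Λ π m h g := by
  simp only [detCov, mul_comm g h]
  congr 1
  refine Finset.sum_congr rfl fun i _ => Finset.sum_congr rfl fun j _ => ?_
  ring

lemma detCov_add_left (g g' h : A) :
    detCov Λ π m (g + g') h = detCov Λ π m g h + detCov Λ π m g' h := by
  simp only [detCov, add_mul, map_add, add_div, Finset.sum_add_distrib]
  ring

lemma detCov_neg_left (g h : A) : detCov Λ π m (-g) h = -detCov Λ π m g h := by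
  simp only [detCov, neg_mul, map_neg, neg_div, Finset.sum_neg_distrib]
  ring

lemma detCov_sub_left (g g' h : A) :
    detCov Λ π m (g - g') h = detCov Λ π m g h - detCov Λ π m g' h := by
  rw [sub_eq_add_neg, detCov_add_left, detCov_neg_left, sub_eq_add_neg]

lemma detCov_sub_right (g h h' : A) :
    detCov Λ π m g (h - h') = detCov Λ π m g h - detCov Λ π m g h' := by
  rw [detCov_comm, detCov_sub_left, detCov_comm, detCov_comm Λ π m h']

open TensorProduct in
/-- The functional `Λ` applied in both tensor factors. -/
noncomputable def prodFunctional (Λ : A →ₗ[ℝ] ℝ) : A ⊗[ℝ] A →ₗ[ℝ] ℝ :=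
  LinearMap.mul' ℝ ℝ ∘ₗ TensorProduct.map Λ Λ

open TensorProduct in
lemma prodFunctional_tmul (u v : A) : prodFunctional Λ (u ⊗ₜ[ℝ] v) = Λ u * Λ v := by
  simp [prodFunctional]

open TensorProduct in
lemma prodFunctional_swap (z : A ⊗[ℝ] A) :
    prodFunctional Λ (Algebra.TensorProduct.comm ℝ A A z) = prodFunctional Λ z := by
  induction z with
  | zero => simp
  | tmul u v => simp [prodFunctional_tmul, mul_comm]
  | add u v hu hv => rw [map_add, map_add, map_add, hu, hv]

open TensorProduct in
/-- The Christoffel–Darboux kernel as an element of the tensor square. -/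
noncomputable def cdKernel (Λ : A →ₗ[ℝ] ℝ) (π : ℕ → A) (m : ℕ) : A ⊗[ℝ] A :=
  ∑ i ∈ Finset.range m, (Λ (π i ^ 2))⁻¹ • (π i ⊗ₜ[ℝ] π i)

open TensorProduct in
-- The double sum in the covariance is the integral of `g(t) h(u) K(t, u)²`. In the tensor square of
-- the algebra, `T ⊗ 1 - 1 ⊗ T` plays the role of `t - u`.
lemma prodFunctional_cdKernel_sq (g h : A) :
    prodFunctional Λ ((g ⊗ₜ[ℝ] h) * cdKernel Λ π m ^ 2) =
      ∑ i ∈ Finset.range m, ∑ j ∈ Finset.range m,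
        Λ (g * (π i * π j)) * Λ (h * (π i * π j)) / (Λ (π i ^ 2) * Λ (π j ^ 2)) := by
  rw [cdKernel, sq, Finset.sum_mul_sum, Finset.mul_sum, map_sum]
  refine Finset.sum_congr rfl fun i _ => ?_
  rw [Finset.mul_sum, map_sum]
  refine Finset.sum_congr rfl fun j _ => ?_
  rw [smul_mul_smul_comm, mul_smul_comm, map_smul, Algebra.TensorProduct.tmul_mul_tmul,
    Algebra.TensorProduct.tmul_mul_tmul, prodFunctional_tmul, smul_eq_mul]
  field_simp

open TensorProduct in
lemma comm_cdKernel :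
    Algebra.TensorProduct.comm ℝ A A (cdKernel Λ π m) = cdKernel Λ π m := by
  simp [cdKernel, map_sum]

open TensorProduct in
lemma detCov_eq (g h : A) :
    detCov Λ π m g h = detMean Λ π m (g * h) -
      prodFunctional Λ ((g ⊗ₜ[ℝ] h) * cdKernel Λ π m ^ 2) := by
  rw [prodFunctional_cdKernel_sq]; rfl

variable {Λ π}

open TensorProduct in
/-- The Christoffel–Darboux formula. -/
lemma christoffel_darboux {T : A} {α β : ℕ → ℝ} (hβ : β 0 = 0)
    (hrec : ∀ j, T * π j = π (j + 1) + α j • π j + β j • π (j - 1))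
    (hnorm : ∀ j, Λ (π (j + 1) ^ 2) = β (j + 1) * Λ (π j ^ 2)) (hne : ∀ j, Λ (π j ^ 2) ≠ 0) :
    (T ⊗ₜ[ℝ] (1 : A) - (1 : A) ⊗ₜ[ℝ] T) * cdKernel Λ π (m + 1) =
      (Λ (π m ^ 2))⁻¹ • (π (m + 1) ⊗ₜ[ℝ] π m - π m ⊗ₜ[ℝ] π (m + 1)) := by
  induction m with
  | zero =>
    rw [cdKernel, Finset.sum_range_one, mul_smul_comm, sub_mul,
      Algebra.TensorProduct.tmul_mul_tmul, Algebra.TensorProduct.tmul_mul_tmul, hrec 0, hβ]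
    simp only [zero_smul, add_zero, one_mul, add_tmul, tmul_add, smul_tmul', tmul_smul]
    congr 1
    abel
  | succ m ih =>
    rw [cdKernel, Finset.sum_range_succ, mul_add, ← cdKernel, ih, mul_smul_comm, sub_mul,
      Algebra.TensorProduct.tmul_mul_tmul, Algebra.TensorProduct.tmul_mul_tmul, hrec (m + 1),
      Nat.add_sub_cancel]
    simp only [one_mul, add_tmul, tmul_add, ← smul_tmul', tmul_smul]
    -- With `h_j` the norms, `β_{m+1} / h_{m+1} = 1 / h_m`, so the boundary term of the previous
    -- step cancels the new `β` terms; the `α` terms cancel by symmetry.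
    have h1 : (Λ (π m ^ 2))⁻¹ = (Λ (π (m + 1) ^ 2))⁻¹ * β (m + 1) := by
      have h2 := hne m
      have h3 : β (m + 1) ≠ 0 := by
        intro h0
        exact hne (m + 1) (by rw [hnorm, h0, zero_mul])
      rw [hnorm]
      field_simp
    rw [h1]
    module

open TensorProduct in
/-- Multiplying both statistics by the coordinate changes the covariance, up to a boundary term,
as multiplying one of them by its square. -/
lemma detCov_mul_mul {T : A} {α β : ℕ → ℝ} (hβ : β 0 = 0)
    (hrec : ∀ j, T * π j = π (j + 1) + α j • π j + β j • π (j - 1))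
    (hnorm : ∀ j, Λ (π (j + 1) ^ 2) = β (j + 1) * Λ (π j ^ 2)) (hne : ∀ j, Λ (π j ^ 2) ≠ 0)
    (g : A) :
    detCov Λ π (m + 1) (T * g) (T * g) = detCov Λ π (m + 1) g (T ^ 2 * g) +
      (Λ (g * π (m + 1) ^ 2) * Λ (g * π m ^ 2) - Λ (g * (π (m + 1) * π m)) ^ 2) /
        Λ (π m ^ 2) ^ 2 := by
  set K := cdKernel Λ π (m + 1) with hK
  have hCD := christoffel_darboux m hβ hrec hnorm hne
  -- Symmetry of the kernel makes the `t²` and `u²` terms of `(t - u)²` contribute equally.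
  have hsw : prodFunctional Λ ((g ⊗ₜ[ℝ] (T ^ 2 * g)) * K ^ 2) =
      prodFunctional Λ (((T ^ 2 * g) ⊗ₜ[ℝ] g) * K ^ 2) := by
    rw [← prodFunctional_swap, map_mul, map_pow, hK, comm_cdKernel]
    simp
  have hsq : prodFunctional Λ ((g ⊗ₜ[ℝ] g) *
        ((T ⊗ₜ[ℝ] (1 : A) - (1 : A) ⊗ₜ[ℝ] T) * K) ^ 2) =
      prodFunctional Λ ((g ⊗ₜ[ℝ] (T ^ 2 * g)) * K ^ 2) +
        prodFunctional Λ (((T ^ 2 * g) ⊗ₜ[ℝ] g) * K ^ 2) -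
        2 * prodFunctional Λ (((T * g) ⊗ₜ[ℝ] (T * g)) * K ^ 2) := by
    have e1 : g ⊗ₜ[ℝ] (T ^ 2 * g) = (g ⊗ₜ[ℝ] g) * ((1 : A) ⊗ₜ[ℝ] T) ^ 2 := by
      rw [sq ((1 : A) ⊗ₜ[ℝ] T), Algebra.TensorProduct.tmul_mul_tmul, Algebra.TensorProduct.tmul_mul_tmul]
      congr 1 <;> ring
    have e2 : (T ^ 2 * g) ⊗ₜ[ℝ] g = (g ⊗ₜ[ℝ] g) * (T ⊗ₜ[ℝ] (1 : A)) ^ 2 := by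
      rw [sq (T ⊗ₜ[ℝ] (1 : A)), Algebra.TensorProduct.tmul_mul_tmul, Algebra.TensorProduct.tmul_mul_tmul]
      congr 1 <;> ring
    have e3 : (T * g) ⊗ₜ[ℝ] (T * g) =
        (g ⊗ₜ[ℝ] g) * ((T ⊗ₜ[ℝ] (1 : A)) * ((1 : A) ⊗ₜ[ℝ] T)) := by
      rw [Algebra.TensorProduct.tmul_mul_tmul, Algebra.TensorProduct.tmul_mul_tmul]
      congr 1 <;> ring
    rw [e1, e2, e3, two_mul, ← map_add, ← map_add, ← map_sub]
    congr 1
    ring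
  -- The same integral, with Christoffel–Darboux applied before squaring: only products of
  -- one-variable integrals are left.
  have hbd : prodFunctional Λ ((g ⊗ₜ[ℝ] g) *
        ((T ⊗ₜ[ℝ] (1 : A) - (1 : A) ⊗ₜ[ℝ] T) * K) ^ 2) =
      2 * ((Λ (g * π (m + 1) ^ 2) * Λ (g * π m ^ 2) - Λ (g * (π (m + 1) * π m)) ^ 2) /
        Λ (π m ^ 2) ^ 2) := by
    rw [hCD, smul_pow, mul_smul_comm, map_smul]
    have e : (g ⊗ₜ[ℝ] g) * (π (m + 1) ⊗ₜ[ℝ] π m - π m ⊗ₜ[ℝ] π (m + 1)) ^ 2 =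
        (g * π (m + 1) ^ 2) ⊗ₜ[ℝ] (g * π m ^ 2) + (g * π m ^ 2) ⊗ₜ[ℝ] (g * π (m + 1) ^ 2) -
        2 • ((g * (π (m + 1) * π m)) ⊗ₜ[ℝ] (g * (π (m + 1) * π m))) := by
      have h1 : (g * π (m + 1) ^ 2) ⊗ₜ[ℝ] (g * π m ^ 2) =
          (g ⊗ₜ[ℝ] g) * (π (m + 1) ⊗ₜ[ℝ] π m) ^ 2 := by
        rw [sq (π (m + 1) ⊗ₜ[ℝ] π m)]
        simp only [Algebra.TensorProduct.tmul_mul_tmul, sq]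
      have h2 : (g * π m ^ 2) ⊗ₜ[ℝ] (g * π (m + 1) ^ 2) =
          (g ⊗ₜ[ℝ] g) * (π m ⊗ₜ[ℝ] π (m + 1)) ^ 2 := by
        rw [sq (π m ⊗ₜ[ℝ] π (m + 1))]
        simp only [Algebra.TensorProduct.tmul_mul_tmul, sq]
      have h3 : (g * (π (m + 1) * π m)) ⊗ₜ[ℝ] (g * (π (m + 1) * π m)) =
          (g ⊗ₜ[ℝ] g) * ((π (m + 1) ⊗ₜ[ℝ] π m) * (π m ⊗ₜ[ℝ] π (m + 1))) := by
        simp only [Algebra.TensorProduct.tmul_mul_tmul, mul_comm (π m)]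
      rw [h1, h2, h3]
      ring
    rw [e, map_sub, map_add, map_nsmul, prodFunctional_tmul, prodFunctional_tmul,
      prodFunctional_tmul, smul_eq_mul, nsmul_eq_mul]
    push_cast
    ring
  rw [detCov_eq, detCov_eq, show T * g * (T * g) = g * (T ^ 2 * g) by ring]
  linarith

end LinearStatistics

/-! ### Differentiation of means in the parameters of the weight. -/

section ParameterDerivative

open Polynomial Filter Topology

/-- The polynomials `P s` have uniformly bounded degree, and their coefficients have at `s₀` the
coefficients of `P'` as derivatives. -/
def HasPolyDerivAt (P : ℝ → ℝ[X]) (P' : ℝ[X]) (s₀ : ℝ) : Prop :=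
  ∃ N : ℕ, (∀ s, (P s).degree < N) ∧
    ∀ i, HasDerivAt (fun s => (P s).coeff i) (P'.coeff i) s₀

lemma HasPolyDerivAt.mul {P Q : ℝ → ℝ[X]} {P' Q' : ℝ[X]} {s₀ : ℝ} (hP : HasPolyDerivAt P P' s₀)
    (hQ : HasPolyDerivAt Q Q' s₀) :
    HasPolyDerivAt (fun s => P s * Q s) (P' * Q s₀ + P s₀ * Q') s₀ := by
  obtain ⟨N, hN, hP⟩ := hP
  obtain ⟨M, hM, hQ⟩ := hQ
  refine ⟨N + M, fun s => ?_, fun i => ?_⟩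
  · rw [degree_lt_iff_coeff_zero]
    intro i hi
    rw [coeff_mul]
    refine Finset.sum_eq_zero fun x hx => ?_
    rw [Finset.HasAntidiagonal.mem_antidiagonal] at hx
    by_cases h : N ≤ x.1
    · rw [(degree_lt_iff_coeff_zero _ _).1 (hN s) _ h, zero_mul]
    · rw [(degree_lt_iff_coeff_zero _ _).1 (hM s) _ (by omega), mul_zero]
  · simp only [coeff_mul, coeff_add, ← Finset.sum_add_distrib]
    exact HasDerivAt.fun_sum fun x _ => (hP x.1).mul (hQ x.2)

lemma HasPolyDerivAt.degree_lt {P : ℝ → ℝ[X]} {P' : ℝ[X]} {s₀ : ℝ}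
    (hP : HasPolyDerivAt P P' s₀) {N : ℕ} (hN : ∀ s, (P s).degree < N) : P'.degree < N := by
  obtain ⟨-, -, hP⟩ := hP
  rw [degree_lt_iff_coeff_zero]
  intro i hi
  have h := hP i
  simp only [fun s => (degree_lt_iff_coeff_zero _ _).1 (hN s) i hi] at h
  exact h.unique (hasDerivAt_const _ _)

variable {A : Type*} [CommRing A] [Algebra ℝ A] {Λ : ℝ → A →ₗ[ℝ] ℝ} {d T : A} {s₀ : ℝ}

lemma HasPolyDerivAt.hasDerivAt_functional
    (hΛ : ∀ u, HasDerivAt (fun s => Λ s u) (Λ s₀ (d * u)) s₀) {P : ℝ → ℝ[X]} {P' : ℝ[X]}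
    (hP : HasPolyDerivAt P P' s₀) (g : A) :
    HasDerivAt (fun s => Λ s (g * aeval T (P s)))
      (Λ s₀ (d * g * aeval T (P s₀)) + Λ s₀ (g * aeval T P')) s₀ := by
  have hP' := hP
  obtain ⟨N, hN, hd⟩ := hP'
  have hdeg := hP.degree_lt hN
  have expand : ∀ (M : A →ₗ[ℝ] ℝ) (h : A) (q : ℝ[X]), q.degree < N →
      M (h * aeval T q) = ∑ i ∈ Finset.range N, q.coeff i * M (h * T ^ i) := by
    intro M h q hq
    have : q.natDegree < N ∨ q = 0 := by
      by_cases h0 : q = 0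
      · exact Or.inr h0
      · exact Or.inl ((natDegree_lt_iff_degree_lt h0).2 hq)
    rcases this with h1 | rfl
    · rw [aeval_eq_sum_range' h1, Finset.mul_sum, map_sum]
      simp only [mul_smul_comm, map_smul, smul_eq_mul]
    · simp
  have h1 : (fun s => Λ s (g * aeval T (P s))) =
      fun s => ∑ i ∈ Finset.range N, (P s).coeff i * Λ s (g * T ^ i) := by
    funext s
    exact expand _ _ _ (hN s)
  rw [h1, expand _ _ _ (hN s₀), expand _ _ _ hdeg, ← Finset.sum_add_distrib]
  refine HasDerivAt.fun_sum fun i _ => ?_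
  have := (hd i).mul (hΛ (g * T ^ i))
  refine this.congr_deriv ?_
  rw [mul_assoc]
  ring

variable {α β : ℝ → ℝ} {P' : ℕ → ℝ[X]}

/-- The functionals `Λ s` restrict on polynomials in `T` to Jacobi functionals with parameters
`α s`, `β s`; their derivative in `s` is multiplication by `d`, and the Jacobi polynomials have
the derivatives `P'`. -/
structure IsJacobiFamily (Λ : ℝ → A →ₗ[ℝ] ℝ) (d T : A) (α β : ℝ → ℝ) (P' : ℕ → ℝ[X])
    (s₀ : ℝ) : Prop where
  deriv : ∀ u, HasDerivAt (fun s => Λ s u) (Λ s₀ (d * u)) s₀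
  isJacobi : ∀ᶠ s in 𝓝 s₀, IsJacobi (α s) (β s) (Λ s ∘ₗ (aeval T).toLinearMap)
  poly : ∀ j, HasPolyDerivAt (fun s => jacobi (α s) (β s) j) (P' j) s₀
  degree : ∀ j, (P' j).degree < j

variable (hF : IsJacobiFamily Λ d T α β P' s₀)
include hF

/-- Differentiate `Λ_s(P_j P_i) = 0`. The term with the derivative of `P_i` drops out, as that
polynomial has degree below `i < j`. -/
lemma IsJacobiFamily.lower {i j : ℕ} (hij : i < j) :
    Λ s₀ (d * (aeval T (jacobi (α s₀) (β s₀) j) * aeval T (jacobi (α s₀) (β s₀) i))) =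
      -Λ s₀ (aeval T (P' j * jacobi (α s₀) (β s₀) i)) := by
  have h1 := ((hF.poly j).mul (hF.poly i)).hasDerivAt_functional (T := T) hF.deriv 1
  have h2 : (fun s => Λ s (1 * aeval T (jacobi (α s) (β s) j * jacobi (α s) (β s) i))) =ᶠ[𝓝 s₀]
      fun _ => 0 := by
    filter_upwards [hF.isJacobi] with s hs
    simpa using hs.orthogonal hij.ne'
  have h3 := (h1.congr_of_eventuallyEq h2.symm).unique (hasDerivAt_const _ _)
  have h4 : Λ s₀ (aeval T (jacobi (α s₀) (β s₀) j * P' i)) = 0 :=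
    hF.isJacobi.self_of_nhds.orthogonal_of_degree_lt
      ((hF.degree i).trans (by exact_mod_cast hij))
  rw [map_add, mul_add, map_add, one_mul, one_mul, h4, mul_one,
    map_mul (aeval T) (jacobi _ _ j)] at h3
  linarith

/-- `P_j` is monic, so its parameter derivative has lower degree and is orthogonal to it; only the
weight contributes. -/
lemma IsJacobiFamily.hasDerivAt_norm (j : ℕ) :
    HasDerivAt (fun s => Λ s (aeval T (jacobi (α s) (β s) j) ^ 2))
      (Λ s₀ (d * aeval T (jacobi (α s₀) (β s₀) j) ^ 2)) s₀ := by
  have h1 := ((hF.poly j).mul (hF.poly j)).hasDerivAt_functional (T := T) hF.deriv 1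
  simp only [one_mul, ← sq, mul_one, map_pow] at h1
  have h4 : Λ s₀ (aeval T (jacobi (α s₀) (β s₀) j * P' j)) = 0 :=
    hF.isJacobi.self_of_nhds.orthogonal_of_degree_lt (hF.degree j)
  refine h1.congr_deriv ?_
  rw [mul_comm (P' j), map_add, map_add, h4]
  ring

omit hF in
lemma sum_sum_range_symm {G : ℕ → ℕ → ℝ} (hG : ∀ i j, G i j = G j i) (m : ℕ) :
    ∑ i ∈ Finset.range m, ∑ j ∈ Finset.range m, G i j =
      ∑ j ∈ Finset.range m, (G j j + 2 * ∑ i ∈ Finset.range j, G i j) := by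
  induction m with
  | zero => simp
  | succ m ih =>
    rw [Finset.sum_range_succ _ m, Finset.sum_range_succ (fun j => G j j + _) m, ← ih]
    simp only [Finset.sum_range_succ, Finset.sum_add_distrib, fun i => hG m i]
    ring

/-- The derivative of the mean of a linear statistic is its covariance with the logarithmic
derivative of the weight. -/
lemma IsJacobiFamily.hasDerivAt_detMean (m : ℕ) (g : A) :
    HasDerivAt (fun s => detMean (Λ s) (fun j => aeval T (jacobi (α s) (β s) j)) m g)
      (detCov (Λ s₀) (fun j => aeval T (jacobi (α s₀) (β s₀) j)) m d g) s₀ := by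
  have hJ := hF.isJacobi.self_of_nhds
  set p : ℕ → ℝ[X] := fun j => jacobi (α s₀) (β s₀) j with hp
  have hne : ∀ j, Λ s₀ (aeval T (p j) ^ 2) ≠ 0 := fun j => by
    have := hJ.norm_ne j
    simpa using this
  have h1 : ∀ j, HasDerivAt (fun s => Λ s (g * aeval T (jacobi (α s) (β s) j) ^ 2))
      (Λ s₀ (d * g * aeval T (p j) ^ 2) + 2 * Λ s₀ (g * aeval T (P' j * p j))) s₀ := by
    intro j
    have h1 := ((hF.poly j).mul (hF.poly j)).hasDerivAt_functional (T := T) hF.deriv g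
    simp only [← sq, map_pow] at h1
    refine h1.congr_deriv ?_
    rw [mul_comm (jacobi _ _ j), map_add, mul_add, map_add, two_mul]
  -- Expand the derivative of `P_j` in the `P_i` with `i < j`; by `IsJacobiFamily.lower` the
  -- coefficients are matrix elements of `d`.
  have h2 : ∀ j, Λ s₀ (g * aeval T (P' j * p j)) =
      -∑ i ∈ Finset.range j, Λ s₀ (d * (aeval T (p i) * aeval T (p j))) *
        Λ s₀ (g * (aeval T (p i) * aeval T (p j))) / Λ s₀ (aeval T (p i) ^ 2) := by
    intro j
    have hx := hJ.expand (fun i _ => hJ.norm_ne i) (hF.degree j)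
    rw [hx, Finset.sum_mul, map_sum, Finset.mul_sum, map_sum, ← Finset.sum_neg_distrib]
    refine Finset.sum_congr rfl fun i hi => ?_
    have h3 := hF.lower (Finset.mem_range.1 hi)
    rw [mul_comm (aeval T (p i)), h3, ← smul_eq_C_mul, smul_mul_assoc, map_smul, mul_smul_comm,
      map_smul, smul_eq_mul]
    simp only [LinearMap.comp_apply, AlgHom.toLinearMap_apply, map_pow, map_mul, hp]
    rw [mul_comm (aeval T (jacobi (α s₀) (β s₀) i))]
    ring
  have h3 := HasDerivAt.fun_sum (u := Finset.range m) fun j _ =>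
    (h1 j).div (hF.hasDerivAt_norm j) (hne j)
  refine h3.congr_deriv ?_
  -- In the quotient rule the derivative of the norm supplies the diagonal of the double sum, and
  -- the derivative of `P_j` supplies twice its strict triangle.
  rw [detCov, sum_sum_range_symm, ← Finset.sum_sub_distrib]
  · refine Finset.sum_congr rfl fun j _ => ?_
    rw [h2]
    have h4 : ∀ i ∈ Finset.range j, Λ s₀ (d * (aeval T (p i) * aeval T (p j))) *
        Λ s₀ (g * (aeval T (p i) * aeval T (p j))) /
          (Λ s₀ (aeval T (p i) ^ 2) * Λ s₀ (aeval T (p j) ^ 2)) =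
        Λ s₀ (d * (aeval T (p i) * aeval T (p j))) *
        Λ s₀ (g * (aeval T (p i) * aeval T (p j))) / Λ s₀ (aeval T (p i) ^ 2) /
          Λ s₀ (aeval T (p j) ^ 2) := fun i _ => by rw [div_div]
    rw [Finset.sum_congr rfl h4, ← Finset.sum_div, ← sq]
    have h5 := hne j
    have h6 : jacobi (α s₀) (β s₀) j = p j := rfl
    simp only [h6]
    field_simp
    ring
  · intro i j
    rw [mul_comm (aeval T (p i)), mul_comm (Λ s₀ (aeval T (p i) ^ 2))]

end ParameterDerivative

/-! ### Integration against the Jacobi weight on an algebra containing the logarithms. -/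

section Functional

open Set Filter Topology

/-- Measurable functions on the line that blow up slower than any power at both ends of the unit
interval. -/
def mildFunctions : Subalgebra ℝ (ℝ → ℝ) where
  carrier := {g | Measurable g ∧ ∀ ε : ℝ, 0 < ε → ∃ C : ℝ, 0 ≤ C ∧
    ∀ t ∈ Ioo (0 : ℝ) 1, |g t| ≤ C * (t ^ (-ε) * (1 - t) ^ (-ε))}
  mul_mem' := by
    rintro f g ⟨hf, hf'⟩ ⟨hg, hg'⟩
    refine ⟨hf.mul hg, fun ε hε => ?_⟩
    -- Splitting the exponent between the factors gives closure under products, so multiplication by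
    -- a logarithm never leaves the algebra.
    obtain ⟨C, hC, hCb⟩ := hf' (ε / 2) (by positivity)
    obtain ⟨D, hD, hDb⟩ := hg' (ε / 2) (by positivity)
    refine ⟨C * D, by positivity, fun t ht => ?_⟩
    have h0 : 0 < t := ht.1
    have h1 : 0 < 1 - t := sub_pos.2 ht.2
    have h := mul_le_mul (hCb t ht) (hDb t ht) (abs_nonneg _) (by positivity)
    rw [← abs_mul] at h
    refine h.trans_eq ?_
    have e1 : t ^ (-ε) = t ^ (-(ε / 2)) * t ^ (-(ε / 2)) := by
      rw [← Real.rpow_add h0]; congr 1; ring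
    have e2 : (1 - t) ^ (-ε) = (1 - t) ^ (-(ε / 2)) * (1 - t) ^ (-(ε / 2)) := by
      rw [← Real.rpow_add h1]; congr 1; ring
    rw [e1, e2]
    ring
  add_mem' := by
    rintro f g ⟨hf, hf'⟩ ⟨hg, hg'⟩
    refine ⟨hf.add hg, fun ε hε => ?_⟩
    obtain ⟨C, hC, hCb⟩ := hf' ε hε
    obtain ⟨D, hD, hDb⟩ := hg' ε hε
    refine ⟨C + D, by positivity, fun t ht => ?_⟩
    rw [add_mul]
    exact (abs_add_le _ _).trans (add_le_add (hCb t ht) (hDb t ht))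
  algebraMap_mem' := by
    intro c
    refine ⟨measurable_const, fun ε hε => ⟨|c|, abs_nonneg _, fun t ht => ?_⟩⟩
    have h0 : 0 < t := ht.1
    have h1 : 0 < 1 - t := sub_pos.2 ht.2
    have h2 : 1 ≤ t ^ (-ε) := Real.one_le_rpow_of_pos_of_le_one_of_nonpos h0 ht.2.le (by linarith)
    have h3 : 1 ≤ (1 - t) ^ (-ε) :=
      Real.one_le_rpow_of_pos_of_le_one_of_nonpos h1 (by linarith) (by linarith)
    change |c| ≤ _
    have := mul_le_mul_of_nonneg_left (one_le_mul_of_one_le_of_one_le h2 h3) (abs_nonneg c)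
    linarith

lemma abs_log_le_rpow {t ε : ℝ} (h0 : 0 < t) (h1 : t ≤ 1) (hε : 0 < ε) :
    |Real.log t| ≤ 1 / ε * t ^ (-ε) := by
  have h := (Real.abs_log_mul_self_rpow_lt t ε h0 h1 hε).le
  have h2 : 0 < t ^ ε := Real.rpow_pos_of_pos h0 _
  rw [abs_mul, abs_of_pos h2] at h
  rw [Real.rpow_neg h0.le, ← div_eq_mul_inv, le_div_iff₀ h2]
  exact h

/-- The coordinate function. -/
def mildCoord : mildFunctions := ⟨fun t => t, measurable_id, fun ε hε => ⟨1, zero_le_one, by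
  intro t ht
  have h0 : 0 < t := ht.1
  have h1 : 0 < 1 - t := sub_pos.2 ht.2
  have h2 : 1 ≤ t ^ (-ε) := Real.one_le_rpow_of_pos_of_le_one_of_nonpos h0 ht.2.le (by linarith)
  have h3 : 1 ≤ (1 - t) ^ (-ε) :=
    Real.one_le_rpow_of_pos_of_le_one_of_nonpos h1 (by linarith) (by linarith)
  rw [one_mul, abs_of_pos h0]
  exact ht.2.le.trans (one_le_mul_of_one_le_of_one_le h2 h3)⟩⟩

/-- The function `log t`. -/
noncomputable def mildLog : mildFunctions :=
  ⟨fun t => Real.log t, Real.measurable_log, fun ε hε => ⟨1 / ε, by positivity, by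
  intro t ht
  have h0 : 0 < t := ht.1
  have h1 : 0 < 1 - t := sub_pos.2 ht.2
  have h3 : 1 ≤ (1 - t) ^ (-ε) :=
    Real.one_le_rpow_of_pos_of_le_one_of_nonpos h1 (by linarith) (by linarith)
  have h4 : 0 < t ^ (-ε) := Real.rpow_pos_of_pos h0 _
  refine (abs_log_le_rpow h0 ht.2.le hε).trans ?_
  exact mul_le_mul_of_nonneg_left (le_mul_of_one_le_right h4.le h3) (by positivity)⟩⟩

/-- The function `log (1 - t)`. -/
noncomputable def mildLogSub : mildFunctions :=
  ⟨fun t => Real.log (1 - t), Real.measurable_log.comp (measurable_const.sub measurable_id),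
  fun ε hε => ⟨1 / ε, by positivity, by
  intro t ht
  have h0 : 0 < t := ht.1
  have h1 : 0 < 1 - t := sub_pos.2 ht.2
  have h2 : 1 ≤ t ^ (-ε) := Real.one_le_rpow_of_pos_of_le_one_of_nonpos h0 ht.2.le (by linarith)
  have h4 : 0 < (1 - t) ^ (-ε) := Real.rpow_pos_of_pos h1 _
  refine (abs_log_le_rpow h1 (by linarith) hε).trans ?_
  exact mul_le_mul_of_nonneg_left (le_mul_of_one_le_left h4.le h2) (by positivity)⟩⟩

lemma beta_integrand_ofReal {a b t : ℝ} (ht : t ∈ Ioo (0 : ℝ) 1) :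
    (t : ℂ) ^ (((a + 1 : ℝ) : ℂ) - 1) * (1 - (t : ℂ)) ^ (((b + 1 : ℝ) : ℂ) - 1) =
      ((t ^ a * (1 - t) ^ b : ℝ) : ℂ) := by
  have h1 : 0 < 1 - t := sub_pos.2 ht.2
  rw [Complex.ofReal_mul, Complex.ofReal_cpow ht.1.le, Complex.ofReal_cpow h1.le]
  push_cast
  rw [add_sub_cancel_right, add_sub_cancel_right]

lemma integrableOn_rpow_mul_rpow {a b : ℝ} (ha : -1 < a) (hb : -1 < b) :
    IntegrableOn (fun t : ℝ => t ^ a * (1 - t) ^ b) (Ioo 0 1) := by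
  have h := Complex.betaIntegral_convergent (u := ((a + 1 : ℝ) : ℂ)) (v := ((b + 1 : ℝ) : ℂ))
    (by rw [Complex.ofReal_re]; linarith) (by rw [Complex.ofReal_re]; linarith)
  rw [intervalIntegrable_iff_integrableOn_Ioo_of_le zero_le_one] at h
  have h2 : IntegrableOn (fun t : ℝ => ((t ^ a * (1 - t) ^ b : ℝ) : ℂ)) (Ioo 0 1) :=
    h.congr_fun (fun t ht => beta_integrand_ofReal ht) measurableSet_Ioo
  have h3 := h2.re
  simp only [Complex.ofReal_re, RCLike.re_eq_complex_re] at h3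
  exact h3

lemma integral_rpow_mul_rpow {a b : ℝ} (ha : -1 < a) (hb : -1 < b) :
    ∫ t in Ioo (0 : ℝ) 1, t ^ a * (1 - t) ^ b =
      Real.Gamma (a + 1) * Real.Gamma (b + 1) / Real.Gamma (a + b + 2) := by
  have h := beta_eq_betaIntegralReal (a + 1) (b + 1) (by linarith) (by linarith)
  rw [beta, Complex.betaIntegral, intervalIntegral.integral_of_le zero_le_one,
    integral_Ioc_eq_integral_Ioo,
    setIntegral_congr_fun measurableSet_Ioo (fun t ht => beta_integrand_ofReal ht),
    integral_complex_ofReal, Complex.ofReal_re, show a + 1 + (b + 1) = a + b + 2 by ring] at h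
  exact h.symm

lemma mild_bound (g : mildFunctions) {a b ε : ℝ} (hε : 0 < ε) :
    ∃ C : ℝ, ∀ t ∈ Ioo (0 : ℝ) 1,
      ‖g.1 t * (t ^ a * (1 - t) ^ b)‖ ≤ C * (t ^ (a - ε) * (1 - t) ^ (b - ε)) := by
  obtain ⟨C, -, hC⟩ := g.2.2 ε hε
  refine ⟨C, fun t ht => ?_⟩
  have h0 : 0 < t := ht.1
  have h1 : 0 < 1 - t := sub_pos.2 ht.2
  have h2 : 0 < t ^ a * (1 - t) ^ b := mul_pos (Real.rpow_pos_of_pos h0 _) (Real.rpow_pos_of_pos h1 _)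
  rw [norm_mul, Real.norm_eq_abs, Real.norm_of_nonneg h2.le]
  refine (mul_le_mul_of_nonneg_right (hC t ht) h2.le).trans_eq ?_
  rw [sub_eq_add_neg a, sub_eq_add_neg b, Real.rpow_add h0, Real.rpow_add h1]
  ring

lemma measurable_mild_mul_weight (g : mildFunctions) (a b : ℝ) :
    Measurable fun t : ℝ => g.1 t * (t ^ a * (1 - t) ^ b) :=
  g.2.1.mul ((measurable_id.pow_const a).mul ((measurable_const.sub measurable_id).pow_const b))

lemma exists_pos_two_mul_lt {x y : ℝ} (hx : 0 < x) (hy : 0 < y) :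
    ∃ ε > 0, 2 * ε < x ∧ 2 * ε < y := by
  have h := lt_min hx hy
  have h1 := min_le_left x y
  have h2 := min_le_right x y
  exact ⟨min x y / 3, by positivity, by linarith, by linarith⟩

lemma integrableOn_mild (g : mildFunctions) {a b : ℝ} (ha : -1 < a) (hb : -1 < b) :
    IntegrableOn (fun t => g.1 t * (t ^ a * (1 - t) ^ b)) (Ioo (0 : ℝ) 1) := by
  obtain ⟨ε, hε, h1, h2⟩ : ∃ ε > 0, -1 < a - ε ∧ -1 < b - ε := by
    obtain ⟨ε, hε, h1, h2⟩ := exists_pos_two_mul_lt (show 0 < a + 1 by linarith)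
      (show 0 < b + 1 by linarith)
    exact ⟨ε, hε, by linarith, by linarith⟩
  obtain ⟨C, hC⟩ := mild_bound g (a := a) (b := b) hε
  refine Integrable.mono' ((integrableOn_rpow_mul_rpow h1 h2).const_mul C)
    (measurable_mild_mul_weight g a b).aestronglyMeasurable ?_
  exact (ae_restrict_iff' measurableSet_Ioo).2 (Eventually.of_forall hC)

open Classical in
/-- Integration against the weight `t ^ a * (1 - t) ^ b` on the unit interval, for
`a, b > -1`. -/
noncomputable def jacobiFunctional (a b : ℝ) : mildFunctions →ₗ[ℝ] ℝ :=
  -- Outside the range of integrability the functional is set to `0`; derivatives only see a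
  -- neighbourhood of an admissible parameter.
  if h : -1 < a ∧ -1 < b then
    { toFun := fun g => ∫ t in Ioo (0 : ℝ) 1, g.1 t * (t ^ a * (1 - t) ^ b)
      map_add' := fun f g => by
        rw [← integral_add (integrableOn_mild f h.1 h.2) (integrableOn_mild g h.1 h.2)]
        refine integral_congr_ae (Eventually.of_forall fun t => ?_)
        exact add_mul _ _ _
      map_smul' := fun c g => by
        rw [RingHom.id_apply, smul_eq_mul, ← integral_const_mul]
        refine integral_congr_ae (Eventually.of_forall fun t => ?_)
        exact mul_assoc _ _ _ }
  else 0

lemma jacobiFunctional_apply {a b : ℝ} (ha : -1 < a) (hb : -1 < b) (g : mildFunctions) :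
    jacobiFunctional a b g = ∫ t in Ioo (0 : ℝ) 1, g.1 t * (t ^ a * (1 - t) ^ b) := by
  rw [jacobiFunctional, dif_pos ⟨ha, hb⟩]; rfl

lemma hasDerivAt_rpow_exponent {t : ℝ} (h0 : 0 < t) (s : ℝ) :
    HasDerivAt (fun s : ℝ => t ^ s) (Real.log t * t ^ s) s := by
  refine ((hasDerivAt_id s).const_rpow h0).congr_deriv ?_
  simp

lemma hasDerivAt_jacobiFunctional_left {a b : ℝ} (ha : -1 < a) (hb : -1 < b)
    (g : mildFunctions) :
    HasDerivAt (fun s => jacobiFunctional s b g) (jacobiFunctional a b (mildLog * g)) a := by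
  -- One `ε` pays for the exponent moving in a ball around `a`, the other for the growth of `mildLog
  -- * g`; the dominating function is still integrable.
  obtain ⟨ε, hε, h1, h2⟩ : ∃ ε > 0, -1 < a - 2 * ε ∧ -1 < b - ε := by
    obtain ⟨ε, hε, h1, h2⟩ := exists_pos_two_mul_lt (show 0 < a + 1 by linarith)
      (show 0 < b + 1 by linarith)
    exact ⟨ε, hε, by linarith, by linarith⟩
  obtain ⟨C, hC⟩ := mild_bound (mildLog * g) (a := a - ε) (b := b) hε
  have key := hasDerivAt_integral_of_dominated_loc_of_deriv_le
    (μ := volume.restrict (Ioo (0 : ℝ) 1)) (Metric.ball_mem_nhds a hε)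
    (F := fun s t => g.1 t * (t ^ s * (1 - t) ^ b))
    (F' := fun s t => (mildLog * g).1 t * (t ^ s * (1 - t) ^ b))
    (bound := fun t => C * (t ^ (a - ε - ε) * (1 - t) ^ (b - ε)))
    (Eventually.of_forall fun s => (measurable_mild_mul_weight g s b).aestronglyMeasurable)
    (integrableOn_mild g ha hb)
    (measurable_mild_mul_weight (mildLog * g) a b).aestronglyMeasurable
    ((ae_restrict_iff' measurableSet_Ioo).2 (Eventually.of_forall fun t ht s hs => ?_))
    ((integrableOn_rpow_mul_rpow (by linarith) h2).const_mul C)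
    ((ae_restrict_iff' measurableSet_Ioo).2 (Eventually.of_forall fun t ht s hs => ?_))
  · rw [jacobiFunctional_apply ha hb]
    refine key.2.congr_of_eventuallyEq ?_
    filter_upwards [lt_mem_nhds ha] with s hs
    rw [jacobiFunctional_apply hs hb]
  · refine le_trans ?_ (hC t ht)
    have h0 : 0 < t := ht.1
    have h1 : 0 < 1 - t := sub_pos.2 ht.2
    rw [norm_mul, norm_mul ((mildLog * g).1 t)]
    refine mul_le_mul_of_nonneg_left ?_ (norm_nonneg _)
    have h3 : ∀ r : ℝ, 0 < t ^ r * (1 - t) ^ b := fun r =>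
      mul_pos (Real.rpow_pos_of_pos h0 _) (Real.rpow_pos_of_pos h1 _)
    rw [Real.norm_of_nonneg (h3 _).le, Real.norm_of_nonneg (h3 _).le]
    refine mul_le_mul_of_nonneg_right ?_ (Real.rpow_pos_of_pos h1 _).le
    refine Real.rpow_le_rpow_of_exponent_ge h0 ht.2.le ?_
    rw [Metric.mem_ball, Real.dist_eq, abs_lt] at hs
    linarith
  · refine (((hasDerivAt_rpow_exponent ht.1 s).mul_const ((1 - t) ^ b)).const_mul
      (g.1 t)).congr_deriv ?_
    change _ = Real.log t * g.1 t * _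
    ring

lemma hasDerivAt_jacobiFunctional_right {a b : ℝ} (ha : -1 < a) (hb : -1 < b)
    (g : mildFunctions) :
    HasDerivAt (fun s => jacobiFunctional a s g) (jacobiFunctional a b (mildLogSub * g)) b := by
  obtain ⟨ε, hε, h1, h2⟩ : ∃ ε > 0, -1 < a - ε ∧ -1 < b - 2 * ε := by
    obtain ⟨ε, hε, h1, h2⟩ := exists_pos_two_mul_lt (show 0 < a + 1 by linarith)
      (show 0 < b + 1 by linarith)
    exact ⟨ε, hε, by linarith, by linarith⟩
  obtain ⟨C, hC⟩ := mild_bound (mildLogSub * g) (a := a) (b := b - ε) hε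
  have key := hasDerivAt_integral_of_dominated_loc_of_deriv_le
    (μ := volume.restrict (Ioo (0 : ℝ) 1)) (Metric.ball_mem_nhds b hε)
    (F := fun s t => g.1 t * (t ^ a * (1 - t) ^ s))
    (F' := fun s t => (mildLogSub * g).1 t * (t ^ a * (1 - t) ^ s))
    (bound := fun t => C * (t ^ (a - ε) * (1 - t) ^ (b - ε - ε)))
    (Eventually.of_forall fun s => (measurable_mild_mul_weight g a s).aestronglyMeasurable)
    (integrableOn_mild g ha hb)
    (measurable_mild_mul_weight (mildLogSub * g) a b).aestronglyMeasurable
    ((ae_restrict_iff' measurableSet_Ioo).2 (Eventually.of_forall fun t ht s hs => ?_))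
    ((integrableOn_rpow_mul_rpow h1 (by linarith)).const_mul C)
    ((ae_restrict_iff' measurableSet_Ioo).2 (Eventually.of_forall fun t ht s hs => ?_))
  · rw [jacobiFunctional_apply ha hb]
    refine key.2.congr_of_eventuallyEq ?_
    filter_upwards [lt_mem_nhds hb] with s hs
    rw [jacobiFunctional_apply ha hs]
  · refine le_trans ?_ (hC t ht)
    have h0 : 0 < t := ht.1
    have h1 : 0 < 1 - t := sub_pos.2 ht.2
    rw [norm_mul, norm_mul ((mildLogSub * g).1 t)]
    refine mul_le_mul_of_nonneg_left ?_ (norm_nonneg _)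
    have h3 : ∀ r : ℝ, 0 < t ^ a * (1 - t) ^ r := fun r =>
      mul_pos (Real.rpow_pos_of_pos h0 _) (Real.rpow_pos_of_pos h1 _)
    rw [Real.norm_of_nonneg (h3 _).le, Real.norm_of_nonneg (h3 _).le]
    refine mul_le_mul_of_nonneg_left ?_ (Real.rpow_pos_of_pos h0 _).le
    refine Real.rpow_le_rpow_of_exponent_ge h1 (by linarith) ?_
    rw [Metric.mem_ball, Real.dist_eq, abs_lt] at hs
    linarith
  · refine (((hasDerivAt_rpow_exponent (sub_pos.2 ht.2) s).const_mul (t ^ a)).const_mul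
      (g.1 t)).congr_deriv ?_
    change _ = Real.log (1 - t) * g.1 t * _
    ring

lemma jacobiFunctional_coord_pow {a b : ℝ} (ha : -1 < a) (hb : -1 < b) (k : ℕ) :
    jacobiFunctional a b (mildCoord ^ k) =
      Real.Gamma (k + a + 1) * Real.Gamma (b + 1) / Real.Gamma (k + a + b + 2) := by
  have hk : (0 : ℝ) ≤ k := Nat.cast_nonneg k
  rw [jacobiFunctional_apply ha hb, ← integral_rpow_mul_rpow (by linarith) hb]
  refine setIntegral_congr_fun measurableSet_Ioo fun t ht => ?_
  change t ^ k * (t ^ a * (1 - t) ^ b) = _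
  rw [Real.rpow_add ht.1, Real.rpow_natCast, mul_assoc]

end Functional

/-! ### The integral as a Jacobi functional. -/

section JacobiFunctional

open Polynomial

lemma isJacobi_jacobiFunctional {a b : ℝ} (ha : -1 / 2 < a) (hb : -1 / 2 < b) :
    IsJacobi a b (jacobiFunctional a b ∘ₗ (aeval mildCoord).toLinearMap) where
  ha := ha
  hb := hb
  moment k := by
    have hk : (0 : ℝ) ≤ k := Nat.cast_nonneg k
    simp only [LinearMap.comp_apply, AlgHom.toLinearMap_apply, map_pow, aeval_X]
    rw [jacobiFunctional_coord_pow (by linarith) (by linarith),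
      jacobiFunctional_coord_pow (by linarith) (by linarith)]
    push_cast
    rw [show (k : ℝ) + 1 + a + 1 = (k + a + 1) + 1 by ring,
      show (k : ℝ) + 1 + a + b + 2 = (k + a + b + 2) + 1 by ring,
      Real.Gamma_add_one (s := (k : ℝ) + a + 1) (by linarith),
      Real.Gamma_add_one (s := (k : ℝ) + a + b + 2) (by linarith)]
    have h1 : Real.Gamma ((k : ℝ) + a + b + 2) ≠ 0 := (Real.Gamma_pos_of_pos (by linarith)).ne'
    have h2 : (k : ℝ) + a + b + 2 ≠ 0 := by linarith
    field_simp
  one_ne := by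
    have h := jacobiFunctional_coord_pow (show -1 < a by linarith) (show -1 < b by linarith) 0
    simp only [LinearMap.comp_apply, AlgHom.toLinearMap_apply, map_one]
    rw [pow_zero] at h
    rw [h]
    have h1 := Real.Gamma_pos_of_pos (show 0 < ((0 : ℕ) : ℝ) + a + 1 by simp; linarith)
    have h2 := Real.Gamma_pos_of_pos (show 0 < b + 1 by linarith)
    have h3 := Real.Gamma_pos_of_pos (show 0 < ((0 : ℕ) : ℝ) + a + b + 2 by simp; linarith)
    positivity

/-- The Jacobi polynomial as a function in `mildFunctions`. -/
noncomputable def mildJacobi (a b : ℝ) (j : ℕ) : mildFunctions := aeval mildCoord (jacobi a b j)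

lemma jacobiFunctional_mildJacobi_sq {a b : ℝ} (ha : -1 / 2 < a) (hb : -1 / 2 < b) (j : ℕ) :
    jacobiFunctional a b (mildJacobi a b j ^ 2) = jacobiNorm a b j := by
  have h := (isJacobi_jacobiFunctional ha hb).norm_eq ?_ j
  · simpa [mildJacobi] using h
  · have h := jacobiFunctional_coord_pow (show -1 < a by linarith) (show -1 < b by linarith) 0
    simpa using h

end JacobiFunctional

/-! ### Digamma and trigamma functions. -/

section Polygamma

open Filter Topology FermionicGaussian

/-- Holomorphy of the complex Gamma function on the right half-plane gives all derivatives of `log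
Γ` at once, so that `psi0` is itself differentiable. -/
lemma analyticAt_log_Gamma {x : ℝ} (hx : 0 < x) :
    AnalyticAt ℝ (fun t : ℝ => Real.log (Real.Gamma t)) x := by
  have h1 : AnalyticAt ℂ Complex.Gamma (x : ℂ) := by
    have hU : IsOpen {z : ℂ | 0 < z.re} := isOpen_lt continuous_const Complex.continuous_re
    have hd : DifferentiableOn ℂ Complex.Gamma {z : ℂ | 0 < z.re} := by
      intro z hz
      refine (Complex.differentiableAt_Gamma z fun m hm => ?_).differentiableWithinAt
      rw [Set.mem_ofPred_eq, hm] at hz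
      simp only [Complex.neg_re, Complex.natCast_re] at hz
      have : (0 : ℝ) ≤ m := Nat.cast_nonneg m
      linarith
    exact hd.analyticAt (hU.mem_nhds (by simpa using hx))
  have h2 : AnalyticAt ℝ (fun t : ℝ => (Complex.Gamma (t : ℂ)).re) x := h1.re_ofReal
  exact AnalyticAt.log h2 (Real.Gamma_pos_of_pos hx)

lemma hasDerivAt_log_Gamma {x : ℝ} (hx : 0 < x) :
    HasDerivAt (fun t : ℝ => Real.log (Real.Gamma t)) (psi0 x) x :=
  (analyticAt_log_Gamma hx).differentiableAt.hasDerivAt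

lemma hasDerivAt_psi0 {x : ℝ} (hx : 0 < x) : HasDerivAt psi0 (psi1 x) x := by
  have h := (analyticAt_log_Gamma hx).deriv.differentiableAt.hasDerivAt
  have e : psi1 x = deriv (deriv fun t : ℝ => Real.log (Real.Gamma t)) x := by
    rw [psi1, iteratedDeriv_succ, iteratedDeriv_one]
  rw [e]
  exact h

lemma psi0_add_one {x : ℝ} (hx : 0 < x) : psi0 (x + 1) = psi0 x + 1 / x := by
  have h1 : HasDerivAt (fun t : ℝ => Real.log (Real.Gamma (t + 1))) (psi0 (x + 1)) x :=
    (hasDerivAt_log_Gamma (x := x + 1) (by linarith)).comp_add_const x 1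
  have h2 := (Real.hasDerivAt_log hx.ne').add (hasDerivAt_log_Gamma hx)
  have h3 := h2.congr_of_eventuallyEq
    (f₁ := fun t : ℝ => Real.log (Real.Gamma (t + 1))) (by
      filter_upwards [lt_mem_nhds hx] with t ht
      rw [Real.Gamma_add_one ht.ne', Real.log_mul ht.ne' (Real.Gamma_pos_of_pos ht).ne']
      rfl)
  rw [h1.unique h3]
  ring

lemma psi1_add_one {x : ℝ} (hx : 0 < x) : psi1 (x + 1) = psi1 x - 1 / x ^ 2 := by
  have h1 : HasDerivAt (fun t : ℝ => psi0 (t + 1)) (psi1 (x + 1)) x :=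
    (hasDerivAt_psi0 (x := x + 1) (by linarith)).comp_add_const x 1
  have h2 := (hasDerivAt_psi0 hx).add (hasDerivAt_inv hx.ne')
  have h3 := h2.congr_of_eventuallyEq (f₁ := fun t : ℝ => psi0 (t + 1)) (by
      filter_upwards [lt_mem_nhds hx] with t ht
      rw [psi0_add_one ht, one_div]
      rfl)
  rw [h1.unique h3]
  ring

lemma hasDerivAt_Gamma_comp {u : ℝ → ℝ} {u' s : ℝ} (hu : HasDerivAt u u' s) (hpos : 0 < u s) :
    HasDerivAt (fun t => Real.Gamma (u t)) (Real.Gamma (u s) * psi0 (u s) * u') s := by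
  have h0 := Real.Gamma_pos_of_pos hpos
  have h1 := (hasDerivAt_log_Gamma hpos).comp s hu
  have h2 := h1.exp
  simp only [Function.comp, Real.exp_log h0] at h2
  refine (h2.congr_of_eventuallyEq ?_).congr_deriv (by ring)
  filter_upwards [hu.continuousAt.eventually (lt_mem_nhds hpos)] with t ht
  exact (Real.exp_log (Real.Gamma_pos_of_pos ht)).symm

lemma hasDerivAt_psi0_comp {u : ℝ → ℝ} {u' s : ℝ} (hu : HasDerivAt u u' s) (hpos : 0 < u s) :
    HasDerivAt (fun t => psi0 (u t)) (psi1 (u s) * u') s :=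
  (hasDerivAt_psi0 hpos).comp s hu

end Polygamma

/-! ### The Jacobi weights as families in `a` and in `b`. -/

section Family

open Polynomial Filter Topology

lemma IsJacobi.apply_mul_jacobi {a b : ℝ} {L : ℝ[X] →ₗ[ℝ] ℝ} (hL : IsJacobi a b L) {q : ℝ[X]}
    {n : ℕ} (hq : q.degree < (n + 1 : ℕ)) :
    L (q * jacobi a b n) = q.coeff n * L (jacobi a b n ^ 2) := by
  have := hL.orthogonal_of_degree_lt (degree_sub_C_mul_jacobi_lt (a := a) (b := b) hq)
  rw [mul_sub, map_sub, mul_left_comm, ← smul_eq_C_mul, map_smul, smul_eq_mul, ← sq,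
    sub_eq_zero, mul_comm] at this
  exact this

/-- Removing `q.coeff (n + 1)` times `P_{n+1}` costs nothing by orthogonality and leaves a
polynomial of degree at most `n` with the corrected coefficient. -/
lemma IsJacobi.apply_mul_jacobi' {a b : ℝ} {L : ℝ[X] →ₗ[ℝ] ℝ} (hL : IsJacobi a b L) {q : ℝ[X]}
    {n : ℕ} (hq : q.degree < (n + 2 : ℕ)) :
    L (q * jacobi a b n) =
      (q.coeff n - q.coeff (n + 1) * jacobiSub a b ((n : ℝ) + 1)) * L (jacobi a b n ^ 2) := by
  have h := hL.apply_mul_jacobi (degree_sub_C_mul_jacobi_lt (a := a) (b := b) (n := n + 1) hq)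
  rw [sub_mul, map_sub, mul_assoc, ← smul_eq_C_mul, map_smul, hL.orthogonal (by omega), coeff_sub,
    coeff_C_mul, coeff_jacobi, if_pos (by omega), jacobiCoeff_sub_one] at h
  simpa using h

lemma differentiableAt_jacobiCoeff {α β : ℝ → ℝ} {s₀ : ℝ} (hα : DifferentiableAt ℝ α s₀)
    (hβ : DifferentiableAt ℝ β s₀) (h : -1 < α s₀ + β s₀) (j i : ℕ) :
    DifferentiableAt ℝ (fun s => jacobiCoeff (α s) (β s) j i) s₀ := by
  simp only [jacobiCoeff]
  refine DifferentiableAt.fun_finsetProd fun l hl => ?_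
  have hlj := (Finset.mem_Ico.1 hl).2
  have h1 : (l : ℝ) + 1 ≤ j := by exact_mod_cast hlj
  have h2 : (0 : ℝ) ≤ l := Nat.cast_nonneg l
  refine DifferentiableAt.div (by fun_prop) (by fun_prop) ?_
  exact (mul_pos (by linarith) (by linarith)).ne'

/-- The derivative of the Jacobi polynomials along a curve of parameters. -/
noncomputable def jacobiDeriv (α β : ℝ → ℝ) (s₀ : ℝ) (j : ℕ) : ℝ[X] :=
  ∑ i ∈ Finset.range j, C (deriv (fun s => jacobiCoeff (α s) (β s) j i) s₀) * X ^ i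

lemma coeff_jacobiDeriv (α β : ℝ → ℝ) (s₀ : ℝ) (j i : ℕ) : (jacobiDeriv α β s₀ j).coeff i =
    if i < j then deriv (fun s => jacobiCoeff (α s) (β s) j i) s₀ else 0 := by
  simp [jacobiDeriv, coeff_C_mul, coeff_X_pow]

lemma degree_jacobiDeriv_lt (α β : ℝ → ℝ) (s₀ : ℝ) (j : ℕ) :
    (jacobiDeriv α β s₀ j).degree < j := by
  rw [degree_lt_iff_coeff_zero]
  intro i hi
  rw [coeff_jacobiDeriv, if_neg (by omega)]

lemma hasPolyDerivAt_jacobi {α β : ℝ → ℝ} {s₀ : ℝ} (hα : DifferentiableAt ℝ α s₀)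
    (hβ : DifferentiableAt ℝ β s₀) (h : -1 < α s₀ + β s₀) (j : ℕ) :
    HasPolyDerivAt (fun s => jacobi (α s) (β s) j) (jacobiDeriv α β s₀ j) s₀ := by
  refine ⟨j + 1, fun s => ?_, fun i => ?_⟩
  · exact (degree_jacobi_le j).trans_lt (by exact_mod_cast Nat.lt_succ_self j)
  · simp only [coeff_jacobi, coeff_jacobiDeriv]
    rcases lt_trichotomy i j with hij | rfl | hij
    · simp only [if_pos hij.le, if_pos hij]
      exact (differentiableAt_jacobiCoeff hα hβ h j i).hasDerivAt
    · simp only [le_refl, if_true, jacobiCoeff_self, lt_irrefl, if_false]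
      exact hasDerivAt_const _ _
    · simp only [if_neg (not_le.2 hij), if_neg hij.le.not_gt]
      exact hasDerivAt_const _ _

variable {a b : ℝ}

lemma isJacobiFamily_left (ha : -1 / 2 < a) (hb : -1 / 2 < b) :
    IsJacobiFamily (fun s => jacobiFunctional s b) mildLog mildCoord (fun s => s) (fun _ => b)
      (jacobiDeriv (fun s => s) (fun _ => b) a) a where
  deriv u := hasDerivAt_jacobiFunctional_left (by linarith) (by linarith) u
  isJacobi := by
    filter_upwards [lt_mem_nhds ha] with s hs
    exact isJacobi_jacobiFunctional hs hb
  poly j := hasPolyDerivAt_jacobi differentiableAt_id (differentiableAt_const _)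
    (by change -1 < a + b; linarith) j
  degree j := degree_jacobiDeriv_lt _ _ _ j

lemma isJacobiFamily_right (ha : -1 / 2 < a) (hb : -1 / 2 < b) :
    IsJacobiFamily (fun s => jacobiFunctional a s) mildLogSub mildCoord (fun _ => a) (fun s => s)
      (jacobiDeriv (fun _ => a) (fun s => s) b) b where
  deriv u := hasDerivAt_jacobiFunctional_right (by linarith) (by linarith) u
  isJacobi := by
    filter_upwards [lt_mem_nhds hb] with s hs
    exact isJacobi_jacobiFunctional ha hs
  poly j := hasPolyDerivAt_jacobi (differentiableAt_const _) differentiableAt_id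
    (by change -1 < a + b; linarith) j
  degree j := degree_jacobiDeriv_lt _ _ _ j

variable {A : Type*} [CommRing A] [Algebra ℝ A] {Λ : ℝ → A →ₗ[ℝ] ℝ} {d T : A} {s₀ : ℝ}
  {α β : ℝ → ℝ} {P' : ℕ → ℝ[X]}

/-- In `IsJacobiFamily.lower` only the coefficient of degree `j` in the derivative of `P_{j+1}`
survives, and it is the derivative of the subleading coefficient. -/
lemma IsJacobiFamily.apply_succ (hF : IsJacobiFamily Λ d T α β P' s₀) (j : ℕ) {k : ℝ}
    (hk : HasDerivAt (fun s => jacobiSub (α s) (β s) ((j : ℝ) + 1)) k s₀) :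
    Λ s₀ (d * (aeval T (jacobi (α s₀) (β s₀) (j + 1)) * aeval T (jacobi (α s₀) (β s₀) j))) =
      -k * Λ s₀ (aeval T (jacobi (α s₀) (β s₀) j) ^ 2) := by
  rw [hF.lower (Nat.lt_succ_self j)]
  have h := hF.isJacobi.self_of_nhds.apply_mul_jacobi (hF.degree (j + 1))
  obtain ⟨-, -, hc⟩ := hF.poly (j + 1)
  have h2 := hc j
  simp only [coeff_jacobi, Nat.le_succ, if_true, jacobiCoeff_sub_one] at h2
  rw [h2.unique hk] at h
  simp only [LinearMap.comp_apply, AlgHom.toLinearMap_apply, map_pow] at h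
  rw [h]
  ring

lemma IsJacobiFamily.apply_succ_succ (hF : IsJacobiFamily Λ d T α β P' s₀) (j : ℕ) {k l : ℝ}
    (hk : HasDerivAt (fun s => jacobiSub (α s) (β s) ((j : ℝ) + 2)) k s₀)
    (hl : HasDerivAt (fun s => jacobiSubSub (α s) (β s) ((j : ℝ) + 2)) l s₀) :
    Λ s₀ (d * (aeval T (jacobi (α s₀) (β s₀) (j + 2)) * aeval T (jacobi (α s₀) (β s₀) j))) =
      -(l - k * jacobiSub (α s₀) (β s₀) ((j : ℝ) + 1)) *
        Λ s₀ (aeval T (jacobi (α s₀) (β s₀) j) ^ 2) := by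
  rw [hF.lower (by omega)]
  have h := hF.isJacobi.self_of_nhds.apply_mul_jacobi' (hF.degree (j + 2))
  obtain ⟨-, -, hc⟩ := hF.poly (j + 2)
  have h1 := hc (j + 1)
  have h2 := hc j
  simp only [coeff_jacobi, show j ≤ j + 2 by omega, if_true, jacobiCoeff_sub_two] at h2
  simp only [coeff_jacobi, show j + 1 ≤ j + 2 by omega, if_true,
    jacobiCoeff_sub_one (j + 1)] at h1
  push_cast at h1
  rw [show (j : ℝ) + 1 + 1 = j + 2 by ring] at h1
  rw [h2.unique hl, h1.unique hk] at h
  simp only [LinearMap.comp_apply, AlgHom.toLinearMap_apply, map_pow] at h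
  rw [h]
  ring

end Family

/-! ### Matrix elements of the logarithms between Jacobi polynomials. -/

section MatrixElements

open Polynomial Filter Topology FermionicGaussian

variable {a b : ℝ}

lemma hasDerivAt_jacobiSub_left {x : ℝ} (h : 2 * x + a + b ≠ 0) :
    HasDerivAt (fun s => jacobiSub s b x) (-(x * (x + b) / (2 * x + a + b) ^ 2)) a := by
  have h1 : HasDerivAt (fun s : ℝ => -(x * (x + s))) (-(x * 1)) a :=
    (((hasDerivAt_id a).const_add x).const_mul x).neg
  have h2 : HasDerivAt (fun s : ℝ => 2 * x + s + b) 1 a :=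
    ((hasDerivAt_id a).const_add (2 * x)).add_const b
  refine (h1.div h2 h).congr_deriv ?_
  field_simp
  ring

lemma hasDerivAt_jacobiSub_right {x : ℝ} (h : 2 * x + a + b ≠ 0) :
    HasDerivAt (fun s => jacobiSub a s x) (x * (x + a) / (2 * x + a + b) ^ 2) b := by
  have h1 : HasDerivAt (fun _ : ℝ => -(x * (x + a))) 0 b := hasDerivAt_const _ _
  have h2 : HasDerivAt (fun s : ℝ => 2 * x + a + s) 1 b := (hasDerivAt_id b).const_add _
  refine (h1.div h2 h).congr_deriv ?_
  field_simp
  ring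

lemma hasDerivAt_jacobiSubSub {α β : ℝ → ℝ} {s₀ α' β' x y : ℝ} (hα : HasDerivAt α α' s₀)
    (hβ : HasDerivAt β β' s₀) (hy : y = 2 * x + α s₀ + β s₀) (h0 : y ≠ 0) (h1 : y - 1 ≠ 0) :
    HasDerivAt (fun s => jacobiSubSub (α s) (β s) x)
      (x * (x - 1) * (2 * x + 2 * α s₀ - 1) / (2 * y * (y - 1)) * α' -
        x * (x - 1) * (x + α s₀) * (x + α s₀ - 1) * (2 * y - 1) / (2 * y ^ 2 * (y - 1) ^ 2) *
          (α' + β')) s₀ := by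
  have h2 : HasDerivAt (fun s => x * (x - 1) * (x + α s) * (x + α s - 1))
      (x * (x - 1) * α' * (x + α s₀ - 1) + x * (x - 1) * (x + α s₀) * α') s₀ :=
    ((hα.const_add x).const_mul (x * (x - 1))).mul ((hα.const_add x).sub_const 1)
  have h3 : HasDerivAt (fun s => 2 * x + α s + β s) (α' + β') s₀ :=
    (hα.const_add (2 * x)).add hβ
  have h4 : HasDerivAt (fun s => 2 * (2 * x + α s + β s) * (2 * x + α s + β s - 1))
      (2 * (α' + β') * (2 * x + α s₀ + β s₀ - 1) + 2 * (2 * x + α s₀ + β s₀) * (α' + β')) s₀ :=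
    (h3.const_mul 2).mul (h3.sub_const 1)
  rw [← hy] at h4
  refine (h2.div h4 ?_).congr_deriv ?_
  · rw [← hy]; exact mul_ne_zero (mul_ne_zero two_ne_zero h0) h1
  · rw [← hy]
    field_simp
    ring

lemma mildJacobi_recurrence (ha : -1 / 2 < a) (hb : -1 / 2 < b) (j : ℕ) :
    mildCoord * mildJacobi a b j = mildJacobi a b (j + 1) + jacobiDiag a b j • mildJacobi a b j +
      jacobiOff a b j • mildJacobi a b (j - 1) := by
  have h := congrArg (aeval mildCoord) ((isJacobi_jacobiFunctional ha hb).recurrence j)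
  simp only [map_mul, map_add, aeval_X, aeval_C, ← Algebra.smul_def] at h
  exact h

/-- The logit function `log t - log (1 - t)`. -/
noncomputable def mildLogit : mildFunctions := mildLog - mildLogSub

lemma jacobiFunctional_log_succ (ha : -1 / 2 < a) (hb : -1 / 2 < b) (j : ℕ) :
    jacobiFunctional a b (mildLog * (mildJacobi a b (j + 1) * mildJacobi a b j)) =
      ((j + 1) * (j + 1 + b) / (2 * (j + 1) + a + b) ^ 2) * jacobiNorm a b j := by
  have hj : (0 : ℝ) ≤ j := Nat.cast_nonneg j
  have h := (isJacobiFamily_left ha hb).apply_succ j (hasDerivAt_jacobiSub_left (by linarith))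
  rw [neg_neg] at h
  rw [← jacobiFunctional_mildJacobi_sq ha hb]
  exact h

lemma jacobiFunctional_logSub_succ (ha : -1 / 2 < a) (hb : -1 / 2 < b) (j : ℕ) :
    jacobiFunctional a b (mildLogSub * (mildJacobi a b (j + 1) * mildJacobi a b j)) =
      -((j + 1) * (j + 1 + a) / (2 * (j + 1) + a + b) ^ 2) * jacobiNorm a b j := by
  have hj : (0 : ℝ) ≤ j := Nat.cast_nonneg j
  have h := (isJacobiFamily_right ha hb).apply_succ j (hasDerivAt_jacobiSub_right (by linarith))
  rw [← jacobiFunctional_mildJacobi_sq ha hb]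
  exact h

lemma jacobiFunctional_logit_succ (ha : -1 / 2 < a) (hb : -1 / 2 < b) (j : ℕ) :
    jacobiFunctional a b (mildLogit * (mildJacobi a b (j + 1) * mildJacobi a b j)) =
      (j + 1) / (2 * (j + 1) + a + b) * jacobiNorm a b j := by
  have hj : (0 : ℝ) ≤ j := Nat.cast_nonneg j
  have h : 2 * ((j : ℝ) + 1) + a + b ≠ 0 := by linarith
  rw [mildLogit, sub_mul, map_sub, jacobiFunctional_log_succ ha hb,
    jacobiFunctional_logSub_succ ha hb,
    show (j : ℝ) + 1 + b = 2 * (j + 1) + a + b - (j + 1 + a) by ring]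
  generalize 2 * ((j : ℝ) + 1) + a + b = y at h ⊢
  field_simp
  ring

lemma jacobiFunctional_logit_succ_succ (ha : -1 / 2 < a) (hb : -1 / 2 < b) (j : ℕ) {x y : ℝ}
    (hx : x = j + 1) (hy : y = 2 * x + a + b) :
    jacobiFunctional a b (mildLogit * (mildJacobi a b (j + 2) * mildJacobi a b j)) =
      x * (x + 1) / (y + 2) * ((x + a) / y - (2 * x + 2 * a + 1) / (2 * (y + 1))) *
        jacobiNorm a b j := by
  have hj : (0 : ℝ) ≤ j := Nat.cast_nonneg j
  have h0 : y ≠ 0 := by linarith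
  have h1 : y + 1 ≠ 0 := by linarith
  have h2 : y + 2 ≠ 0 := by linarith
  have e1 := (isJacobiFamily_left ha hb).apply_succ_succ j
    (hasDerivAt_jacobiSub_left (by linarith))
    (hasDerivAt_jacobiSubSub (y := y + 2) (hasDerivAt_id a) (hasDerivAt_const a b)
      (by rw [hy, hx]; ring) h2 (by linarith))
  have e2 := (isJacobiFamily_right ha hb).apply_succ_succ j
    (hasDerivAt_jacobiSub_right (by linarith))
    (hasDerivAt_jacobiSubSub (y := y + 2) (hasDerivAt_const b a) (hasDerivAt_id b)
      (by rw [hy, hx]; ring) h2 (by linarith))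
  rw [mildLogit, sub_mul, map_sub, ← jacobiFunctional_mildJacobi_sq ha hb]
  refine (congrArg₂ (· - ·) e1 e2).trans ?_
  rw [← mildJacobi, ← sub_mul]
  congr 1
  rw [jacobiSub, show 2 * ((j : ℝ) + 1) + a + b = y by rw [hy, hx],
    show 2 * ((j : ℝ) + 2) + a + b = y + 2 by rw [hy, hx]; ring,
    show (j : ℝ) + 2 = x + 1 by rw [hx]; ring, ← hx,
    show x + 1 + b = y + 2 - (x + 1 + a) by rw [hy]; ring,
    show y + 2 - 1 = y + 1 by ring]
  field_simp
  ring

/-- The `a`-derivative of the norm, computed from its closed form: each Gamma factor containing `a`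
contributes a digamma value. -/
lemma jacobiFunctional_log_sq (ha : -1 / 2 < a) (hb : -1 / 2 < b) (j : ℕ) :
    jacobiFunctional a b (mildLog * mildJacobi a b j ^ 2) =
      (psi0 (j + a + 1) + psi0 (j + a + b + 1) - psi0 (2 * j + a + b + 1) -
        psi0 (2 * j + a + b + 2)) * jacobiNorm a b j := by
  have hj : (0 : ℝ) ≤ j := Nat.cast_nonneg j
  have h1 := (isJacobiFamily_left ha hb).hasDerivAt_norm j
  have h2 : HasDerivAt (fun s => jacobiNorm s b j)
      (jacobiFunctional a b (mildLog * mildJacobi a b j ^ 2)) a := by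
    refine h1.congr_of_eventuallyEq ?_
    filter_upwards [lt_mem_nhds ha] with s hs
    exact (jacobiFunctional_mildJacobi_sq hs hb j).symm
  have g1 : HasDerivAt (fun s : ℝ => Real.Gamma (j + s + 1)) _ a :=
    hasDerivAt_Gamma_comp (((hasDerivAt_id a).const_add (j : ℝ)).add_const 1)
      (show 0 < (j : ℝ) + a + 1 by linarith)
  have g2 : HasDerivAt (fun s : ℝ => Real.Gamma (j + s + b + 1)) _ a :=
    hasDerivAt_Gamma_comp ((((hasDerivAt_id a).const_add (j : ℝ)).add_const b).add_const 1)
      (show 0 < (j : ℝ) + a + b + 1 by linarith)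
  have g3 : HasDerivAt (fun s : ℝ => Real.Gamma (2 * j + s + b + 1)) _ a :=
    hasDerivAt_Gamma_comp ((((hasDerivAt_id a).const_add (2 * (j : ℝ))).add_const b).add_const 1)
      (show 0 < 2 * (j : ℝ) + a + b + 1 by linarith)
  have g4 : HasDerivAt (fun s : ℝ => Real.Gamma (2 * j + s + b + 2)) _ a :=
    hasDerivAt_Gamma_comp ((((hasDerivAt_id a).const_add (2 * (j : ℝ))).add_const b).add_const 2)
      (show 0 < 2 * (j : ℝ) + a + b + 2 by linarith)
  have n3 := (Real.Gamma_pos_of_pos (show 0 < 2 * (j : ℝ) + a + b + 1 by linarith)).ne'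
  have n4 := (Real.Gamma_pos_of_pos (show 0 < 2 * (j : ℝ) + a + b + 2 by linarith)).ne'
  have h3 := (((g1.const_mul (j.factorial : ℝ)).mul_const (Real.Gamma (j + b + 1))).mul g2).div
    (g3.mul g4) (mul_ne_zero n3 n4)
  rw [h2.unique h3, jacobiNorm]
  simp only [Pi.mul_apply, mul_one]
  field_simp
  ring

lemma jacobiFunctional_logSub_sq (ha : -1 / 2 < a) (hb : -1 / 2 < b) (j : ℕ) :
    jacobiFunctional a b (mildLogSub * mildJacobi a b j ^ 2) =
      (psi0 (j + b + 1) + psi0 (j + a + b + 1) - psi0 (2 * j + a + b + 1) -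
        psi0 (2 * j + a + b + 2)) * jacobiNorm a b j := by
  have hj : (0 : ℝ) ≤ j := Nat.cast_nonneg j
  have h1 := (isJacobiFamily_right ha hb).hasDerivAt_norm j
  have h2 : HasDerivAt (fun s => jacobiNorm a s j)
      (jacobiFunctional a b (mildLogSub * mildJacobi a b j ^ 2)) b := by
    refine h1.congr_of_eventuallyEq ?_
    filter_upwards [lt_mem_nhds hb] with s hs
    exact (jacobiFunctional_mildJacobi_sq ha hs j).symm
  have g1 : HasDerivAt (fun s : ℝ => Real.Gamma (j + s + 1)) _ b :=
    hasDerivAt_Gamma_comp (((hasDerivAt_id b).const_add (j : ℝ)).add_const 1)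
      (show 0 < (j : ℝ) + b + 1 by linarith)
  have g2 : HasDerivAt (fun s : ℝ => Real.Gamma (j + a + s + 1)) _ b :=
    hasDerivAt_Gamma_comp (((hasDerivAt_id b).const_add ((j : ℝ) + a)).add_const 1)
      (show 0 < (j : ℝ) + a + b + 1 by linarith)
  have g3 : HasDerivAt (fun s : ℝ => Real.Gamma (2 * j + a + s + 1)) _ b :=
    hasDerivAt_Gamma_comp (((hasDerivAt_id b).const_add (2 * (j : ℝ) + a)).add_const 1)
      (show 0 < 2 * (j : ℝ) + a + b + 1 by linarith)
  have g4 : HasDerivAt (fun s : ℝ => Real.Gamma (2 * j + a + s + 2)) _ b :=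
    hasDerivAt_Gamma_comp (((hasDerivAt_id b).const_add (2 * (j : ℝ) + a)).add_const 2)
      (show 0 < 2 * (j : ℝ) + a + b + 2 by linarith)
  have n3 := (Real.Gamma_pos_of_pos (show 0 < 2 * (j : ℝ) + a + b + 1 by linarith)).ne'
  have n4 := (Real.Gamma_pos_of_pos (show 0 < 2 * (j : ℝ) + a + b + 2 by linarith)).ne'
  have h3 := ((g1.const_mul ((j.factorial : ℝ) * Real.Gamma (j + a + 1))).mul g2).div
    (g3.mul g4) (mul_ne_zero n3 n4)
  rw [h2.unique h3, jacobiNorm]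
  simp only [Pi.mul_apply, mul_one]
  field_simp
  ring

lemma jacobiFunctional_logit_sq (ha : -1 / 2 < a) (hb : -1 / 2 < b) (j : ℕ) :
    jacobiFunctional a b (mildLogit * mildJacobi a b j ^ 2) =
      (psi0 (j + a + 1) - psi0 (j + b + 1)) * jacobiNorm a b j := by
  rw [mildLogit, sub_mul, map_sub, jacobiFunctional_log_sq ha hb,
    jacobiFunctional_logSub_sq ha hb]
  ring

end MatrixElements

/-! ### Closed forms for the mean of the entropy and for the covariance of the logarithms. -/

section ClosedForms

open Polynomial Filter Topology FermionicGaussian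

variable {a b : ℝ}

/-- The function `t log t + (1 - t) log (1 - t)`. -/
noncomputable def mildEntropy : mildFunctions := mildCoord * mildLogit + mildLogSub

lemma jacobiOff_zero : jacobiOff a b 0 = 0 := by simp [jacobiOff]

lemma jacobiOff_succ_pos (ha : -1 / 2 < a) (hb : -1 / 2 < b) (j : ℕ) :
    0 < jacobiOff a b ((j : ℝ) + 1) := by
  have h1 := jacobiNorm_succ ha hb j
  have h2 := jacobiNorm_pos ha hb (j + 1)
  rw [h1] at h2
  exact pos_of_mul_pos_left h2 (jacobiNorm_pos ha hb j).le

/-- Writing the entropy as `t ℓ + log (1 - t)` and expanding `t P_j` by the recurrence leaves only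
known matrix elements. -/
lemma jacobiFunctional_entropy_sq (ha : -1 / 2 < a) (hb : -1 / 2 < b) (j : ℕ) :
    jacobiFunctional a b (mildEntropy * mildJacobi a b j ^ 2) =
      ((j + 1) / (2 * (j + 1) + a + b) + jacobiDiag a b j * (psi0 (j + a + 1) - psi0 (j + b + 1)) +
        j / (2 * j + a + b) + (psi0 (j + b + 1) + psi0 (j + a + b + 1) -
          psi0 (2 * j + a + b + 1) - psi0 (2 * j + a + b + 2))) * jacobiNorm a b j := by
  have e : mildEntropy * mildJacobi a b j ^ 2 =
      mildLogit * (mildJacobi a b (j + 1) * mildJacobi a b j) +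
        jacobiDiag a b j • (mildLogit * mildJacobi a b j ^ 2) +
        jacobiOff a b j • (mildLogit * (mildJacobi a b j * mildJacobi a b (j - 1))) +
        mildLogSub * mildJacobi a b j ^ 2 := by
    rw [mildEntropy, show (mildCoord * mildLogit + mildLogSub) * mildJacobi a b j ^ 2 =
      mildLogit * ((mildCoord * mildJacobi a b j) * mildJacobi a b j) +
        mildLogSub * mildJacobi a b j ^ 2 by ring, mildJacobi_recurrence ha hb]
    simp only [Algebra.smul_def]
    ring
  have h : jacobiOff a b j * jacobiFunctional a b
      (mildLogit * (mildJacobi a b j * mildJacobi a b (j - 1))) =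
      j / (2 * j + a + b) * jacobiNorm a b j := by
    rcases j with _ | j
    · simp [jacobiOff_zero]
    · rw [Nat.add_sub_cancel, jacobiFunctional_logit_succ ha hb, jacobiNorm_succ ha hb]
      push_cast
      ring
  rw [e, map_add, map_add, map_add, map_smul, map_smul, smul_eq_mul, smul_eq_mul, h,
    jacobiFunctional_logit_succ ha hb, jacobiFunctional_logit_sq ha hb,
    jacobiFunctional_logSub_sq ha hb]
  ring

/-- Closed form of the mean of `t log t + (1 - t) log (1 - t)`. -/
noncomputable def entropyMean (a b x : ℝ) : ℝ :=
  x * (x + a) / (2 * x + a + b) * psi0 (x + a + 1) +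
    x * (x + b) / (2 * x + a + b) * psi0 (x + b + 1) - x / (2 * x + a + b) + x +
    (x + a + b) * psi0 (x + a + b + 1) - (2 * x + a + b) * psi0 (2 * x + a + b + 1)

lemma entropyMean_succ (ha : -1 / 2 < a) (hb : -1 / 2 < b) (j : ℕ) :
    entropyMean a b ((j : ℝ) + 1) = entropyMean a b j +
      ((j + 1) / (2 * (j + 1) + a + b) + jacobiDiag a b j * (psi0 (j + a + 1) - psi0 (j + b + 1)) +
        j / (2 * j + a + b) + (psi0 (j + b + 1) + psi0 (j + a + b + 1) -
          psi0 (2 * j + a + b + 1) - psi0 (2 * j + a + b + 2))) := by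
  have hj : (0 : ℝ) ≤ j := Nat.cast_nonneg j
  have e1 : psi0 ((j : ℝ) + 1 + a + 1) = psi0 (j + a + 1) + 1 / (j + a + 1) := by
    rw [← psi0_add_one (by linarith)]; congr 1; ring
  have e2 : psi0 ((j : ℝ) + 1 + b + 1) = psi0 (j + b + 1) + 1 / (j + b + 1) := by
    rw [← psi0_add_one (by linarith)]; congr 1; ring
  have e3 : psi0 ((j : ℝ) + 1 + a + b + 1) = psi0 (j + a + b + 1) + 1 / (j + a + b + 1) := by
    rw [← psi0_add_one (by linarith)]; congr 1; ring
  have e4 : psi0 (2 * (j : ℝ) + a + b + 2) =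
      psi0 (2 * j + a + b + 1) + 1 / (2 * j + a + b + 1) := by
    rw [← psi0_add_one (by linarith)]; congr 1; ring
  have e5 : psi0 (2 * ((j : ℝ) + 1) + a + b + 1) =
      psi0 (2 * j + a + b + 1) + 1 / (2 * j + a + b + 1) + 1 / (2 * j + a + b + 2) := by
    rw [← e4, ← psi0_add_one (by linarith)]; congr 1; ring
  -- For `j = 0` the denominator `2 j + a + b` may vanish. The quotient is kept as an atom `u`; the
  -- relation `j = u (2 j + a + b)` holds in all cases.
  obtain ⟨u, hu⟩ : ∃ u : ℝ, u = j / (2 * j + a + b) := ⟨_, rfl⟩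
  have hu' : (j : ℝ) = u * (2 * j + a + b) := by
    rw [hu]
    rcases Nat.eq_zero_or_pos j with rfl | h
    · simp
    · have : (1 : ℝ) ≤ j := by exact_mod_cast h
      rw [div_mul_cancel₀]
      linarith
  have d1 : (j : ℝ) * (j + a) / (2 * j + a + b) = u * (j + a) := by rw [hu]; ring
  have d2 : (j : ℝ) * (j + b) / (2 * j + a + b) = u * (j + b) := by rw [hu]; ring
  rw [entropyMean, entropyMean, jacobiDiag, jacobiSub, jacobiSub, e1, e2, e3, e4, e5, neg_div, d1,
    d2, ← hu]
  generalize psi0 ((j : ℝ) + a + 1) = A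
  generalize psi0 ((j : ℝ) + b + 1) = B
  generalize psi0 ((j : ℝ) + a + b + 1) = D
  generalize psi0 (2 * (j : ℝ) + a + b + 1) = E
  obtain ⟨y, hy⟩ : ∃ y : ℝ, y = 2 * j + a + b := ⟨_, rfl⟩
  have hb' : b = y - 2 * j - a := by linarith
  rw [← hy] at hu'
  have n1 : (j : ℝ) + a + 1 ≠ 0 := by linarith
  have n2 : (j : ℝ) + b + 1 ≠ 0 := by linarith
  have n3 : (j : ℝ) + a + b + 1 ≠ 0 := by linarith
  have n4 : y + 1 ≠ 0 := by linarith
  have n5 : y + 2 ≠ 0 := by linarith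
  rw [show 2 * ((j : ℝ) + 1) + a + b = y + 2 by rw [hy]; ring, ← hy]
  have k1 : ((j : ℝ) + 1) * (j + 1 + a) / (y + 2) * (1 / (j + a + 1)) = (j + 1) / (y + 2) := by
    field_simp
    ring
  have k2 : ((j : ℝ) + 1) * (j + 1 + b) / (y + 2) * (1 / (j + b + 1)) = (j + 1) / (y + 2) := by
    field_simp
    ring
  have k3 : ((j : ℝ) + 1 + a + b) * (1 / (j + a + b + 1)) = 1 := by
    field_simp
    ring
  have k4 : (y + 2) * (1 / (y + 1) + 1 / (y + 2)) = 2 + 1 / (y + 1) := by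
    field_simp
    ring
  have k5 : ((j : ℝ) + 1) * (j + 1 + b) / (y + 2) = (j + 1) - (j + 1) * (j + 1 + a) / (y + 2) := by
    rw [hb']
    field_simp
    ring
  have k6 : u * ((j : ℝ) + b) = j - u * (j + a) := by
    rw [hb']
    linear_combination -hu'
  rw [k6]
  linear_combination k1 + k2 + k3 - k4 + B * k5

lemma detMean_entropy (ha : -1 / 2 < a) (hb : -1 / 2 < b) (m : ℕ) :
    detMean (jacobiFunctional a b) (mildJacobi a b) m mildEntropy = entropyMean a b m := by
  induction m with
  | zero =>
    simp [detMean, entropyMean]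
  | succ m ih =>
    rw [detMean, Finset.sum_range_succ, ← detMean, ih, jacobiFunctional_entropy_sq ha hb,
      jacobiFunctional_mildJacobi_sq ha hb, mul_div_cancel_right₀ _ (jacobiNorm_pos ha hb m).ne']
    push_cast
    rw [entropyMean_succ ha hb]

/-- Closed form of the covariance of `log t` and `log (1 - t)`. -/
noncomputable def logCov (a b x : ℝ) : ℝ :=
  (x + a + b) * psi1 (x + a + b + 1) - (2 * x + a + b) * psi1 (2 * x + a + b + 1) +
    psi0 (x + a + b + 1) - psi0 (2 * x + a + b + 1)

/-- The mean of `log (1 - t)` is a sum of digamma values; its `a`-derivative is the covariance with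
`log t`, and the resulting trigamma sum is found by induction. -/
lemma detCov_log_logSub (ha : -1 / 2 < a) (hb : -1 / 2 < b) (m : ℕ) :
    detCov (jacobiFunctional a b) (mildJacobi a b) m mildLog mildLogSub = logCov a b m := by
  have h1 : HasDerivAt (fun s => ∑ j ∈ Finset.range m, (psi0 ((j : ℝ) + b + 1) +
      psi0 (j + s + b + 1) - psi0 (2 * j + s + b + 1) - psi0 (2 * j + s + b + 2)))
      (∑ j ∈ Finset.range m, (psi1 ((j : ℝ) + a + b + 1) - psi1 (2 * j + a + b + 1) -
        psi1 (2 * j + a + b + 2))) a := by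
    refine HasDerivAt.fun_sum fun j _ => ?_
    have hj : (0 : ℝ) ≤ j := Nat.cast_nonneg j
    have g2 := hasDerivAt_psi0_comp
      ((((hasDerivAt_id' a).const_add (j : ℝ)).add_const b).add_const 1)
      (show 0 < (j : ℝ) + a + b + 1 by linarith)
    have g3 := hasDerivAt_psi0_comp
      ((((hasDerivAt_id' a).const_add (2 * (j : ℝ))).add_const b).add_const 1)
      (show 0 < 2 * (j : ℝ) + a + b + 1 by linarith)
    have g4 := hasDerivAt_psi0_comp
      ((((hasDerivAt_id' a).const_add (2 * (j : ℝ))).add_const b).add_const 2)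
      (show 0 < 2 * (j : ℝ) + a + b + 2 by linarith)
    exact (((g2.const_add (psi0 ((j : ℝ) + b + 1))).sub g3).sub g4).congr_deriv (by ring)
  have h2 := (isJacobiFamily_left ha hb).hasDerivAt_detMean m mildLogSub
  have h3 : (fun s => detMean (jacobiFunctional s b) (mildJacobi s b) m mildLogSub) =ᶠ[𝓝 a]
      fun s => ∑ j ∈ Finset.range m, (psi0 ((j : ℝ) + b + 1) +
      psi0 (j + s + b + 1) - psi0 (2 * j + s + b + 1) - psi0 (2 * j + s + b + 2)) := by
    filter_upwards [lt_mem_nhds ha] with s hs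
    refine Finset.sum_congr rfl fun j _ => ?_
    rw [jacobiFunctional_logSub_sq hs hb, jacobiFunctional_mildJacobi_sq hs hb,
      mul_div_cancel_right₀ _ (jacobiNorm_pos hs hb j).ne']
  have h4 := (h1.congr_of_eventuallyEq h3).unique h2
  refine h4.symm.trans ?_
  clear h1 h2 h3 h4
  induction m with
  | zero => simp [logCov]
  | succ m ih =>
    have hj : (0 : ℝ) ≤ m := Nat.cast_nonneg m
    rw [Finset.sum_range_succ, ih, logCov, logCov]
    push_cast
    have e3 : psi0 ((m : ℝ) + 1 + a + b + 1) = psi0 (m + a + b + 1) + 1 / (m + a + b + 1) := by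
      rw [← psi0_add_one (by linarith)]; congr 1; ring
    have e4 : psi0 (2 * ((m : ℝ) + 1) + a + b + 1) =
        psi0 (2 * m + a + b + 1) + 1 / (2 * m + a + b + 1) + 1 / (2 * m + a + b + 2) := by
      rw [← psi0_add_one (by linarith),
        show 2 * (m : ℝ) + a + b + 1 + 1 = 2 * m + a + b + 2 by ring,
        ← psi0_add_one (by linarith)]
      congr 1; ring
    have f3 : psi1 ((m : ℝ) + 1 + a + b + 1) = psi1 (m + a + b + 1) - 1 / (m + a + b + 1) ^ 2 := by
      rw [← psi1_add_one (by linarith)]; congr 1; ring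
    have f4 : psi1 (2 * (m : ℝ) + a + b + 2) =
        psi1 (2 * m + a + b + 1) - 1 / (2 * m + a + b + 1) ^ 2 := by
      rw [← psi1_add_one (by linarith)]; congr 1; ring
    have f5 : psi1 (2 * ((m : ℝ) + 1) + a + b + 1) =
        psi1 (2 * m + a + b + 1) - 1 / (2 * m + a + b + 1) ^ 2 - 1 / (2 * m + a + b + 2) ^ 2 := by
      rw [← f4, ← psi1_add_one (by linarith)]; congr 1; ring
    rw [e3, e4, f3, f5, f4, show 2 * ((m : ℝ) + 1) + a + b = (2 * m + a + b + 1) + 1 by ring,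
      show (m : ℝ) + 1 + a + b = m + a + b + 1 by ring,
      show 2 * (m : ℝ) + a + b + 2 = (2 * m + a + b + 1) + 1 by ring]
    have n1 : (m : ℝ) + a + b + 1 ≠ 0 := by linarith
    have n2 : 2 * (m : ℝ) + a + b + 1 ≠ 0 := by linarith
    have n3 : 2 * (m : ℝ) + a + b + 1 + 1 ≠ 0 := by linarith
    have k1 : ((m : ℝ) + a + b + 1) * (1 / (m + a + b + 1) ^ 2) = 1 / (m + a + b + 1) := by
      field_simp
    have k2 : (2 * (m : ℝ) + a + b + 1 + 1) * (1 / (2 * m + a + b + 1) ^ 2 +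
        1 / (2 * m + a + b + 1 + 1) ^ 2) = 1 / (2 * m + a + b + 1) ^ 2 + 1 / (2 * m + a + b + 1) +
        1 / (2 * m + a + b + 1 + 1) := by
      field_simp
      ring
    linear_combination k1 - k2

end ClosedForms

/-! ### Integration by parts for the entropy and the mean of `t (1 - t) ℓ`. -/

section Flow

open Polynomial Filter Topology FermionicGaussian

/-- The first-order differential expression whose Jacobi functional vanishes. -/
noncomputable def pearsonOp (a b : ℝ) (p : ℝ[X]) : ℝ[X] :=
  X * (1 - X) * derivative p + (C (a + 1) - C (a + b + 2) * X) * p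

variable {a b : ℝ}

/-- The `a`-derivative of the Pearson identity: the weight yields `log t` and the coefficients of
the operator yield `(1 - t) p`. -/
lemma pearson_log (ha : -1 / 2 < a) (hb : -1 / 2 < b) (p : ℝ[X]) :
    jacobiFunctional a b (mildLog * aeval mildCoord (pearsonOp a b p)) =
      -jacobiFunctional a b ((1 - mildCoord) * aeval mildCoord p) := by
  have e : ∀ s : ℝ, aeval mildCoord (pearsonOp s b p) =
      aeval mildCoord (pearsonOp 0 b p) + s • ((1 - mildCoord) * aeval mildCoord p) := by
    intro s
    have : pearsonOp s b p = pearsonOp 0 b p + C s * ((1 - X) * p) := by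
      simp only [pearsonOp, map_add, map_one, map_ofNat, map_zero]
      ring
    rw [this]
    simp only [map_add, map_mul, map_sub, aeval_C, aeval_X, map_one, Algebra.smul_def]
  have h1 := (hasDerivAt_jacobiFunctional_left (a := a) (b := b) (by linarith) (by linarith)
    (aeval mildCoord (pearsonOp 0 b p))).add ((hasDerivAt_id a).mul
    (hasDerivAt_jacobiFunctional_left (a := a) (b := b) (by linarith) (by linarith)
      ((1 - mildCoord) * aeval mildCoord p)))
  have h2 := h1.congr_of_eventuallyEq (f₁ := fun _ => 0) (by
    filter_upwards [lt_mem_nhds ha] with s hs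
    have h3 := (isJacobi_jacobiFunctional hs hb).pearson p
    rw [← pearsonOp, LinearMap.comp_apply, AlgHom.toLinearMap_apply, e, map_add, map_smul] at h3
    exact h3.symm)
  have h3 := h2.unique (hasDerivAt_const _ _)
  rw [e, mul_add, mul_smul_comm, map_add, map_smul, smul_eq_mul]
  simp only [id_eq] at h3
  linarith

lemma pearson_logSub (ha : -1 / 2 < a) (hb : -1 / 2 < b) (p : ℝ[X]) :
    jacobiFunctional a b (mildLogSub * aeval mildCoord (pearsonOp a b p)) =
      jacobiFunctional a b (mildCoord * aeval mildCoord p) := by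
  have e : ∀ s : ℝ, aeval mildCoord (pearsonOp a s p) =
      aeval mildCoord (pearsonOp a 0 p) - s • (mildCoord * aeval mildCoord p) := by
    intro s
    have : pearsonOp a s p = pearsonOp a 0 p - C s * (X * p) := by
      simp only [pearsonOp, map_add, map_one, map_ofNat, map_zero]
      ring
    rw [this]
    simp only [map_sub, map_mul, aeval_C, aeval_X, Algebra.smul_def]
  have h1 := (hasDerivAt_jacobiFunctional_right (a := a) (b := b) (by linarith) (by linarith)
    (aeval mildCoord (pearsonOp a 0 p))).sub ((hasDerivAt_id b).mul
    (hasDerivAt_jacobiFunctional_right (a := a) (b := b) (by linarith) (by linarith)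
      (mildCoord * aeval mildCoord p)))
  have h2 := h1.congr_of_eventuallyEq (f₁ := fun _ => 0) (by
    filter_upwards [lt_mem_nhds hb] with s hs
    have h3 := (isJacobi_jacobiFunctional ha hs).pearson p
    rw [← pearsonOp, LinearMap.comp_apply, AlgHom.toLinearMap_apply, e, map_sub, map_smul] at h3
    exact h3.symm)
  have h3 := h2.unique (hasDerivAt_const _ _)
  rw [e, mul_sub, mul_smul_comm, map_sub, map_smul, smul_eq_mul]
  simp only [id_eq] at h3
  linarith

/-- The function `t (1 - t) (log t - log (1 - t))`. -/
noncomputable def mildFlow : mildFunctions := mildCoord * (1 - mildCoord) * mildLogit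

/-- Integration by parts with `s' = ℓ`. It is obtained from `pearson_log` for `X p` and
`pearson_logSub` for `(1 - X) p`, whose right sides cancel. -/
lemma pearson_entropy (ha : -1 / 2 < a) (hb : -1 / 2 < b) (p : ℝ[X]) :
    jacobiFunctional a b (mildFlow * aeval mildCoord p) =
      -jacobiFunctional a b (mildEntropy * aeval mildCoord (pearsonOp a b p)) := by
  have h1 := pearson_log ha hb (X * p)
  have h2 := pearson_logSub ha hb ((1 - X) * p)
  have e1 : pearsonOp a b (X * p) = X * pearsonOp a b p + X * (1 - X) * p := by
    simp only [pearsonOp, derivative_mul, derivative_X]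
    ring
  have e2 : pearsonOp a b ((1 - X) * p) = (1 - X) * pearsonOp a b p - X * (1 - X) * p := by
    simp only [pearsonOp, derivative_mul, derivative_sub, derivative_X, derivative_one]
    ring
  rw [e1] at h1
  rw [e2] at h2
  simp only [map_add, map_sub, map_mul, map_one, aeval_X] at h1 h2
  rw [mul_add mildLog, map_add] at h1
  rw [mul_sub mildLogSub, map_sub] at h2
  have e3 : mildFlow * aeval mildCoord p + mildEntropy * aeval mildCoord (pearsonOp a b p) =
      (mildLog * (mildCoord * aeval mildCoord (pearsonOp a b p)) +
        mildLog * (mildCoord * (1 - mildCoord) * aeval mildCoord p)) +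
      (mildLogSub * ((1 - mildCoord) * aeval mildCoord (pearsonOp a b p)) -
        mildLogSub * (mildCoord * (1 - mildCoord) * aeval mildCoord p)) := by
    rw [mildFlow, mildEntropy, mildLogit]
    ring
  rw [eq_neg_iff_add_eq_zero, ← map_add, e3, map_add, map_add, map_sub]
  have e4 : (1 - mildCoord) * (mildCoord * aeval mildCoord p) =
    mildCoord * ((1 - mildCoord) * aeval mildCoord p) := by ring
  rw [e4] at h1
  linarith

/-- The left side is `P_j` times the commutator of the Jacobi operator with multiplication by `X`,
up to sign. By the recurrence its components along `P_{j+1}` and `P_{j-1}` are multiplied by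
differences of neighbouring eigenvalues, and the `P_j` component vanishes. -/
lemma pearsonOp_jacobi_sq (ha : -1 / 2 < a) (hb : -1 / 2 < b) (j : ℕ) :
    pearsonOp a b (jacobi a b j ^ 2) =
      C (jacobiOff a b j * (2 * j + a + b)) * (jacobi a b j * jacobi a b (j - 1)) -
        C (2 * (j + 1) + a + b) * (jacobi a b (j + 1) * jacobi a b j) := by
  have e : pearsonOp a b (jacobi a b j ^ 2) = jacobi a b j *
      (X * jacobiOp a b (jacobi a b j) - jacobiOp a b (X * jacobi a b j)) := by
    simp only [pearsonOp, jacobiOp, sq, derivative_mul, derivative_X,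
      derivative_one, map_add, map_one, map_ofNat]
    ring
  have hlin : ∀ (p q r : ℝ[X]) (c d : ℝ), jacobiOp a b (p + C c * q + C d * r) =
      jacobiOp a b p + C c * jacobiOp a b q + C d * jacobiOp a b r := by
    intro p q r c d
    simp only [jacobiOp, derivative_mul, derivative_add, derivative_C, zero_mul, zero_add]
    ring
  have hrec := (isJacobi_jacobiFunctional ha hb).recurrence j
  have hlow : C (jacobiOff a b j) * jacobiOp a b (jacobi a b (j - 1)) =
      C (jacobiOff a b j) * (C (((j : ℝ) - 1) * (j + a + b)) * jacobi a b (j - 1)) := by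
    rcases j with _ | j
    · simp [jacobiOff_zero]
    · rw [Nat.add_sub_cancel, jacobiOp_jacobi ha hb]
      push_cast
      rw [show (j : ℝ) + 1 - 1 = j by ring, show (j : ℝ) + 1 + a + b = j + a + b + 1 by ring]
  rw [e, jacobiOp_jacobi ha hb, mul_left_comm X, hrec, hlin, hlow, jacobiOp_jacobi ha hb,
    jacobiOp_jacobi ha hb]
  push_cast
  simp only [map_add, map_mul, map_sub, map_one, map_ofNat]
  ring

/-- After division by the norm, where `jacobiOff` shifts the norm by one index, this is a difference
of consecutive terms, so `detMean_flow` telescopes. -/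
lemma jacobiFunctional_flow_sq (ha : -1 / 2 < a) (hb : -1 / 2 < b) (j : ℕ) :
    jacobiFunctional a b (mildFlow * mildJacobi a b j ^ 2) =
      (2 * (j + 1) + a + b) *
        jacobiFunctional a b (mildEntropy * (mildJacobi a b (j + 1) * mildJacobi a b j)) -
      jacobiOff a b j * (2 * j + a + b) *
        jacobiFunctional a b (mildEntropy * (mildJacobi a b j * mildJacobi a b (j - 1))) := by
  have h := pearson_entropy ha hb (jacobi a b j ^ 2)
  rw [pearsonOp_jacobi_sq ha hb, ← smul_eq_C_mul, ← smul_eq_C_mul] at h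
  simp only [map_sub, map_smul, map_mul, map_pow, mul_sub, mul_smul_comm, smul_eq_mul] at h
  simp only [mildJacobi]
  linarith

/-- Closed form of the mean of `t (1 - t) (log t - log (1 - t))`. -/
noncomputable def flowMean (a b x : ℝ) : ℝ :=
  x * (x + a) * (x + b) * (x + a + b) /
      ((2 * x + a + b) * ((2 * x + a + b - 1) * (2 * x + a + b + 1))) *
    (psi0 (x + a) - psi0 (x + b)) +
  x * (x + 1) * (b - a) / (2 * (2 * x + a + b) * (2 * x + a + b + 1))

/-- The telescoping quantity in closed form, from the recurrence for `t P_{j+1}` and the matrix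
elements of the logarithms. -/
lemma jacobiFunctional_entropy_succ (ha : -1 / 2 < a) (hb : -1 / 2 < b) (j : ℕ) :
    (2 * (j + 1) + a + b) *
      jacobiFunctional a b (mildEntropy * (mildJacobi a b (j + 1) * mildJacobi a b j)) =
      flowMean a b (j + 1) * jacobiNorm a b j := by
  have hj : (0 : ℝ) ≤ j := Nat.cast_nonneg j
  have e : mildEntropy * (mildJacobi a b (j + 1) * mildJacobi a b j) =
      mildLogit * (mildJacobi a b (j + 2) * mildJacobi a b j) +
        jacobiDiag a b ((j + 1 : ℕ) : ℝ) •
          (mildLogit * (mildJacobi a b (j + 1) * mildJacobi a b j)) +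
        jacobiOff a b ((j + 1 : ℕ) : ℝ) • (mildLogit * mildJacobi a b j ^ 2) +
        mildLogSub * (mildJacobi a b (j + 1) * mildJacobi a b j) := by
    rw [mildEntropy, show (mildCoord * mildLogit + mildLogSub) *
        (mildJacobi a b (j + 1) * mildJacobi a b j) =
      mildLogit * ((mildCoord * mildJacobi a b (j + 1)) * mildJacobi a b j) +
        mildLogSub * (mildJacobi a b (j + 1) * mildJacobi a b j) by ring,
      mildJacobi_recurrence ha hb, Nat.add_sub_cancel]
    simp only [Algebra.smul_def]
    ring
  rw [e, map_add, map_add, map_add, map_smul, map_smul, smul_eq_mul, smul_eq_mul,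
    jacobiFunctional_logit_succ_succ ha hb j rfl rfl, jacobiFunctional_logit_succ ha hb,
    jacobiFunctional_logit_sq ha hb, jacobiFunctional_logSub_succ ha hb, jacobiDiag, jacobiSub,
    jacobiSub, jacobiOff, flowMean]
  push_cast
  rw [show (j : ℝ) + 1 + a = j + a + 1 by ring, show (j : ℝ) + 1 + b = j + b + 1 by ring]
  generalize psi0 ((j : ℝ) + a + 1) = A
  generalize psi0 ((j : ℝ) + b + 1) = B
  generalize jacobiNorm a b j = H
  obtain ⟨x, hx⟩ : ∃ x : ℝ, x = j + 1 := ⟨_, rfl⟩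
  obtain ⟨y, hy⟩ : ∃ y : ℝ, b = y - 2 * x - a := ⟨2 * x + a + b, by ring⟩
  have n0 : y ≠ 0 := by linarith
  have n1 : y + 1 ≠ 0 := by linarith
  have n2 : y + 2 ≠ 0 := by linarith
  have n3 : y - 1 ≠ 0 := by linarith
  rw [show (j : ℝ) + a + 1 = x + a by rw [hx]; ring, show (j : ℝ) + b + 1 = x + b by rw [hx]; ring,
    ← hx, show 2 * (x + 1) + a + b = y + 2 by rw [hy]; ring, show 2 * x + a + b = y by rw [hy]; ring,
    show x + a + b = y - x by rw [hy]; ring, show x + b = y - x - a by rw [hy]; ring,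
    show b - a = y - 2 * x - 2 * a by rw [hy]; ring,
    show y ^ 2 - 1 = (y - 1) * (y + 1) by ring]
  clear hy hx e hj
  field_simp
  ring

lemma detMean_flow (ha : -1 / 2 < a) (hb : -1 / 2 < b) (m : ℕ) :
    detMean (jacobiFunctional a b) (mildJacobi a b) m mildFlow = flowMean a b m := by
  have key : ∀ j : ℕ, jacobiOff a b j * (2 * j + a + b) *
      jacobiFunctional a b (mildEntropy * (mildJacobi a b j * mildJacobi a b (j - 1))) /
        jacobiNorm a b j = flowMean a b j := by
    rintro (_ | j)
    · simp [jacobiOff_zero, flowMean]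
    · have h := jacobiFunctional_entropy_succ ha hb j
      have h1 := jacobiNorm_succ ha hb j
      have h2 := (jacobiOff_succ_pos ha hb j).ne'
      have h3 := (jacobiNorm_pos ha hb j).ne'
      rw [Nat.add_sub_cancel, h1]
      push_cast
      rw [mul_assoc, h]
      field_simp
  induction m with
  | zero => simp [detMean, flowMean]
  | succ m ih =>
    have h := jacobiFunctional_entropy_succ ha hb m
    rw [detMean, Finset.sum_range_succ, ← detMean, ih, jacobiFunctional_flow_sq ha hb,
      jacobiFunctional_mildJacobi_sq ha hb, sub_div, key, h,
      mul_div_cancel_right₀ _ (jacobiNorm_pos ha hb m).ne']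
    push_cast
    ring

end Flow

/-! ### Assembling the covariance of the entropy with itself. -/

section Variance

open Filter Topology FermionicGaussian

variable {a b : ℝ}

lemma hasDerivAt_entropyMean {α β : ℝ → ℝ} {s₀ α' β' x y : ℝ} (hα : HasDerivAt α α' s₀)
    (hβ : HasDerivAt β β' s₀) (hx : 1 ≤ x) (ha : -1 / 2 < α s₀) (hb : -1 / 2 < β s₀)
    (hy : y = 2 * x + α s₀ + β s₀) :
    HasDerivAt (fun s => entropyMean (α s) (β s) x)
      ((x * α' / y - x * (x + α s₀) / y ^ 2 * (α' + β')) * psi0 (x + α s₀ + 1) +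
        x * (x + α s₀) / y * (psi1 (x + α s₀ + 1) * α') +
        (x * β' / y - x * (x + β s₀) / y ^ 2 * (α' + β')) * psi0 (x + β s₀ + 1) +
        x * (x + β s₀) / y * (psi1 (x + β s₀ + 1) * β') + x / y ^ 2 * (α' + β') +
        (α' + β') * (psi0 (y - x + 1) + (y - x) * psi1 (y - x + 1) - psi0 (y + 1) -
          y * psi1 (y + 1))) s₀ := by
  have hy0 : y ≠ 0 := by linarith
  have h1 : HasDerivAt (fun s => 2 * x + α s + β s) (α' + β') s₀ := (hα.const_add _).add hβ
  have h2 : HasDerivAt (fun s => x + α s + β s) (α' + β') s₀ := (hα.const_add _).add hβ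
  have h3 := hα.const_add x
  have h4 := hβ.const_add x
  have hne : 2 * x + α s₀ + β s₀ ≠ 0 := hy ▸ hy0
  have k1 := (((h3.const_mul x).div h1 hne).mul
    (hasDerivAt_psi0_comp (h3.add_const 1) (by linarith)))
  have k2 := (((h4.const_mul x).div h1 hne).mul
    (hasDerivAt_psi0_comp (h4.add_const 1) (by linarith)))
  have k3 := (hasDerivAt_const s₀ x).div h1 hne
  have k4 := h2.mul (hasDerivAt_psi0_comp (h2.add_const 1) (by linarith))
  have k5 := h1.mul (hasDerivAt_psi0_comp (h1.add_const 1) (by linarith))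
  refine (((((k1.add k2).sub k3).add_const x).add k4).sub k5).congr_deriv ?_
  simp only [Pi.div_apply]
  rw [show x + α s₀ + β s₀ = y - x by rw [hy]; ring, ← hy]
  generalize psi0 (x + α s₀ + 1) = A
  generalize psi0 (x + β s₀ + 1) = B
  field_simp
  ring

lemma hasDerivAt_flowMean {α β : ℝ → ℝ} {s₀ α' β' x y : ℝ} (hα : HasDerivAt α α' s₀)
    (hβ : HasDerivAt β β' s₀) (hx : 1 ≤ x) (ha : -1 / 2 < α s₀) (hb : -1 / 2 < β s₀)
    (hy : y = 2 * x + α s₀ + β s₀) :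
    HasDerivAt (fun s => flowMean (α s) (β s) x)
      ((x * (x + β s₀) * (y - x) * α' + x * (x + α s₀) * (y - x) * β' +
          x * (x + α s₀) * (x + β s₀) * (α' + β')) / (y * ((y - 1) * (y + 1))) *
          (psi0 (x + α s₀) - psi0 (x + β s₀)) -
        x * (x + α s₀) * (x + β s₀) * (y - x) * (3 * y ^ 2 - 1) /
          (y * ((y - 1) * (y + 1))) ^ 2 * (α' + β') * (psi0 (x + α s₀) - psi0 (x + β s₀)) +
        x * (x + α s₀) * (x + β s₀) * (y - x) / (y * ((y - 1) * (y + 1))) *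
          (psi1 (x + α s₀) * α' - psi1 (x + β s₀) * β') +
        x * (x + 1) / (2 * y * (y + 1)) * (β' - α') -
        x * (x + 1) * (β s₀ - α s₀) * (2 * y + 1) / (2 * y ^ 2 * (y + 1) ^ 2) * (α' + β')) s₀ := by
  have hy0 : y ≠ 0 := by linarith
  have hy1 : y - 1 ≠ 0 := by linarith
  have hy2 : y + 1 ≠ 0 := by linarith
  have h1 : HasDerivAt (fun s => 2 * x + α s + β s) (α' + β') s₀ := (hα.const_add _).add hβ
  have h2 : HasDerivAt (fun s => x + α s + β s) (α' + β') s₀ := (hα.const_add _).add hβ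
  have h3 := hα.const_add x
  have h4 := hβ.const_add x
  have k1 := ((h3.const_mul x).mul h4).mul h2
  have k2 := h1.mul ((h1.sub_const 1).mul (h1.add_const 1))
  have k3 := (hasDerivAt_psi0_comp h3 (by linarith)).sub (hasDerivAt_psi0_comp h4 (by linarith))
  have k4 := (hβ.sub hα).const_mul (x * (x + 1))
  have k5 := (h1.const_mul 2).mul (h1.add_const 1)
  have n2 : (2 * x + α s₀ + β s₀) * ((2 * x + α s₀ + β s₀ - 1) * (2 * x + α s₀ + β s₀ + 1)) ≠ 0 := by
    rw [← hy]; positivity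
  have n5 : 2 * (2 * x + α s₀ + β s₀) * (2 * x + α s₀ + β s₀ + 1) ≠ 0 := by
    rw [← hy]; positivity
  refine (((k1.div k2 n2).mul k3).add (k4.div k5 n5)).congr_deriv ?_
  simp only [Pi.div_apply, Pi.mul_apply, Pi.sub_apply]
  rw [show x + α s₀ + β s₀ = y - x by rw [hy]; ring, ← hy]
  generalize psi0 (x + α s₀) = A
  generalize psi0 (x + β s₀) = B
  generalize psi1 (x + α s₀) = A'
  generalize psi1 (x + β s₀) = B'
  field_simp
  ring

/-- Here and in the three analogues the covariance is identified with the parameter derivative of a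
closed-form mean by uniqueness of derivatives. -/
lemma detCov_log_entropy (ha : -1 / 2 < a) (hb : -1 / 2 < b) (m : ℕ) {k : ℝ}
    (hk : HasDerivAt (fun s => entropyMean s b m) k a) :
    detCov (jacobiFunctional a b) (mildJacobi a b) m mildLog mildEntropy = k := by
  refine ((isJacobiFamily_left ha hb).hasDerivAt_detMean m mildEntropy).unique
    (hk.congr_of_eventuallyEq ?_)
  filter_upwards [lt_mem_nhds ha] with s hs
  exact detMean_entropy hs hb m

lemma detCov_logSub_entropy (ha : -1 / 2 < a) (hb : -1 / 2 < b) (m : ℕ) {k : ℝ}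
    (hk : HasDerivAt (fun s => entropyMean a s m) k b) :
    detCov (jacobiFunctional a b) (mildJacobi a b) m mildLogSub mildEntropy = k := by
  refine ((isJacobiFamily_right ha hb).hasDerivAt_detMean m mildEntropy).unique
    (hk.congr_of_eventuallyEq ?_)
  filter_upwards [lt_mem_nhds hb] with s hs
  exact detMean_entropy ha hs m

lemma detCov_log_flow (ha : -1 / 2 < a) (hb : -1 / 2 < b) (m : ℕ) {k : ℝ}
    (hk : HasDerivAt (fun s => flowMean s b m) k a) :
    detCov (jacobiFunctional a b) (mildJacobi a b) m mildLog mildFlow = k := by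
  refine ((isJacobiFamily_left ha hb).hasDerivAt_detMean m mildFlow).unique
    (hk.congr_of_eventuallyEq ?_)
  filter_upwards [lt_mem_nhds ha] with s hs
  exact detMean_flow hs hb m

lemma detCov_logSub_flow (ha : -1 / 2 < a) (hb : -1 / 2 < b) (m : ℕ) {k : ℝ}
    (hk : HasDerivAt (fun s => flowMean a s m) k b) :
    detCov (jacobiFunctional a b) (mildJacobi a b) m mildLogSub mildFlow = k := by
  refine ((isJacobiFamily_right ha hb).hasDerivAt_detMean m mildFlow).unique
    (hk.congr_of_eventuallyEq ?_)
  filter_upwards [lt_mem_nhds hb] with s hs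
  exact detMean_flow ha hs m

/-- The variance of the entropy in terms of covariances with the logarithms. -/
lemma detCov_entropy_decomposition (ha : -1 / 2 < a) (hb : -1 / 2 < b) (k : ℕ) :
    detCov (jacobiFunctional a b) (mildJacobi a b) (k + 1) mildEntropy mildEntropy =
      detCov (jacobiFunctional a b) (mildJacobi a b) (k + 1) mildLog mildEntropy +
      detCov (jacobiFunctional a b) (mildJacobi a b) (k + 1) mildLogSub mildEntropy -
      detCov (jacobiFunctional a b) (mildJacobi a b) (k + 1) mildLog mildLogSub -
      (detCov (jacobiFunctional a b) (mildJacobi a b) (k + 1) mildLog mildFlow -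
        detCov (jacobiFunctional a b) (mildJacobi a b) (k + 1) mildLogSub mildFlow) +
      (jacobiFunctional a b (mildLogit * mildJacobi a b (k + 1) ^ 2) *
          jacobiFunctional a b (mildLogit * mildJacobi a b k ^ 2) -
        jacobiFunctional a b (mildLogit * (mildJacobi a b (k + 1) * mildJacobi a b k)) ^ 2) /
        jacobiFunctional a b (mildJacobi a b k ^ 2) ^ 2 := by
  have hb0 := detCov_mul_mul k (Λ := jacobiFunctional a b) (π := mildJacobi a b) (T := mildCoord)
    (α := fun j => jacobiDiag a b j) (β := fun j => jacobiOff a b j)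
    (by simp [jacobiOff_zero]) (fun j => mildJacobi_recurrence ha hb j)
    (fun j => by
      rw [jacobiFunctional_mildJacobi_sq ha hb, jacobiFunctional_mildJacobi_sq ha hb,
        jacobiNorm_succ ha hb]
      push_cast
      rfl)
    (fun j => by
      rw [jacobiFunctional_mildJacobi_sq ha hb]
      exact (jacobiNorm_pos ha hb j).ne') mildLogit
  -- Since `t² = t - t (1 - t)`.
  have e1 : mildCoord ^ 2 * mildLogit = mildEntropy - mildLogSub - mildFlow := by
    rw [mildEntropy, mildFlow]; ring
  have e2 : mildCoord * mildLogit = mildEntropy - mildLogSub := by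
    rw [mildEntropy]; ring
  rw [e1, e2] at hb0
  simp only [detCov_sub_left, detCov_sub_right] at hb0
  have e3 : ∀ g, detCov (jacobiFunctional a b) (mildJacobi a b) (k + 1) mildLogit g =
      detCov (jacobiFunctional a b) (mildJacobi a b) (k + 1) mildLog g -
        detCov (jacobiFunctional a b) (mildJacobi a b) (k + 1) mildLogSub g := fun g => by
    rw [mildLogit, detCov_sub_left]
  simp only [e3] at hb0
  rw [detCov_comm _ _ _ mildEntropy mildLogSub] at hb0
  -- The covariance of `log (1 - t)` with itself, which has no closed form here, occurs on both
  -- sides and cancels.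
  linarith

/-- The variance of the entropy in terms of polygamma functions. -/
theorem detCov_entropy (ha : -1 / 2 < a) (hb : -1 / 2 < b) (k : ℕ) {x y : ℝ} (hx : x = k + 1)
    (hy : y = 2 * x + a + b) (hn : 0 < y - x) :
    detCov (jacobiFunctional a b) (mildJacobi a b) (k + 1) mildEntropy mildEntropy =
      (x * (x + b) / y - x * (y - x) * (x + a) * (x + b) / (y * ((y - 1) * (y + 1)))) *
          psi1 (x + b) - y * psi1 y + (y - x) * psi1 (y - x) +
        (x * (x + a) / y - x * (y - x) * (x + a) * (x + b) / (y * ((y - 1) * (y + 1)))) *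
          psi1 (x + a) +
        x * (y - x) * (x + a) * (x + b) / (y ^ 2 * ((y - 1) * (y + 1))) *
          (psi0 (x + b) - psi0 (x + a)) ^ 2 -
        x * (x + 1) * (b - a) / (y ^ 2 * (y + 1)) * (psi0 (x + b) - psi0 (x + a)) -
        psi0 y + psi0 (y - x) - x * (x + y + 2) / (y ^ 2 * (y + 1)) := by
  have hk : (0 : ℝ) ≤ k := Nat.cast_nonneg k
  have hxk : ((k + 1 : ℕ) : ℝ) = x := by rw [hx]; push_cast; rfl
  have hx1 : 1 ≤ x := by linarith
  have c1 := detCov_log_entropy ha hb (k + 1) (hasDerivAt_entropyMean (hasDerivAt_id' a)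
    (hasDerivAt_const a b) (hxk ▸ hx1) ha hb rfl)
  have c2 := detCov_logSub_entropy ha hb (k + 1) (hasDerivAt_entropyMean (hasDerivAt_const b a)
    (hasDerivAt_id' b) (hxk ▸ hx1) ha hb rfl)
  have c3 := detCov_log_logSub ha hb (k + 1)
  have c4 := detCov_log_flow ha hb (k + 1) (hasDerivAt_flowMean (hasDerivAt_id' a)
    (hasDerivAt_const a b) (hxk ▸ hx1) ha hb rfl)
  have c5 := detCov_logSub_flow ha hb (k + 1) (hasDerivAt_flowMean (hasDerivAt_const b a)
    (hasDerivAt_id' b) (hxk ▸ hx1) ha hb rfl)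
  rw [logCov] at c3
  rw [hxk, ← hy] at c1 c2 c4 c5
  rw [hxk, ← hy, show x + a + b = y - x by rw [hy]; ring] at c3
  have c6 := jacobiNorm_succ ha hb k
  rw [detCov_entropy_decomposition ha hb, c1, c2, c3, c4, c5, jacobiFunctional_logit_sq ha hb,
    jacobiFunctional_logit_sq ha hb, jacobiFunctional_logit_succ ha hb,
    jacobiFunctional_mildJacobi_sq ha hb, c6, hxk, jacobiOff]
  have hH := (jacobiNorm_pos ha hb k).ne'
  have p1 : 0 < x + a := by linarith
  have p2 : 0 < x + b := by linarith
  have p3 : 0 < y := by linarith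
  rw [show (k : ℝ) + a + 1 = x + a by rw [hx]; ring, show (k : ℝ) + b + 1 = x + b by rw [hx]; ring,
    ← hx, ← hy, show x + a + b = y - x by rw [hy]; ring, psi0_add_one p1, psi0_add_one p2,
    psi0_add_one hn, psi0_add_one p3, psi1_add_one p1, psi1_add_one p2, psi1_add_one hn,
    psi1_add_one p3]
  -- All polygamma arguments have been shifted to `x + a`, `x + b`, `y - x` and `y`; what remains is
  -- a rational identity in which their values are independent variables.
  generalize psi0 (x + a) = A
  generalize psi0 (x + b) = B
  generalize psi0 (y - x) = D
  generalize psi0 y = E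
  generalize psi1 (x + a) = A'
  generalize psi1 (x + b) = B'
  generalize psi1 (y - x) = D'
  generalize psi1 y = E'
  generalize jacobiNorm a b k = H at hH
  have hy' : b = y - 2 * x - a := by linarith
  have hy1 : 0 < y - 1 := by linarith
  have n1 := p1.ne'
  have n2 := p2.ne'
  have n3 := p3.ne'
  have n4 := hy1.ne'
  have n5 : y + 1 ≠ 0 := by linarith
  have n6 := hn.ne'
  clear c1 c2 c3 c4 c5 c6 hx hk hxk ha hb p1 p2 p3 hn hy1
  rw [show y ^ 2 - 1 = (y - 1) * (y + 1) by ring]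
  subst hy'
  rw [show x + (y - 2 * x - a) = y - x - a by ring] at n2 ⊢
  clear hy
  field_simp
  ring

end Variance

/-! ### Andréief's identity and the first two moments of linear statistics. -/

section Andreief

variable {ι : Type*} [Fintype ι] [DecidableEq ι]

omit [Fintype ι] in
lemma Equiv.Perm.eq_one_or_swap_of_fixed {ρ : Equiv.Perm ι} {k l : ι}
    (h : ∀ i, i ≠ k → i ≠ l → ρ i = i) : ρ = 1 ∨ ρ = Equiv.swap k l := by
  have hmem : ∀ i, ρ i ≠ i → ρ i = k ∨ ρ i = l := fun i hi => by
    by_contra hcon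
    push Not at hcon
    exact hi (ρ.injective (h _ hcon.1 hcon.2))
  by_cases hk : ρ k = k
  · left
    ext i
    rw [Equiv.Perm.one_apply]
    by_contra hi
    have hik : i ≠ k := fun e => hi (e ▸ hk)
    have hil : i = l := by_contra fun hil => hi (h i hik hil)
    rcases hmem i hi with e | e
    · exact hik (ρ.injective (e.trans hk.symm))
    · exact hi (e.trans hil.symm)
  · right
    have hkl : ρ k = l := (hmem k hk).resolve_left hk
    have hlk : ρ l = k := by
      by_cases hl : ρ l = l
      · exact absurd (hkl.trans (by rw [ρ.injective (hkl.trans hl.symm)])) hk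
      · exact (hmem l hl).resolve_right hl
    ext i
    by_cases hik : i = k
    · rw [hik, hkl, Equiv.swap_apply_left]
    by_cases hil : i = l
    · rw [hil, hlk, Equiv.swap_apply_right]
    rw [h i hik hil, Equiv.swap_apply_of_ne_of_ne hik hil]

/-- The double alternating sum over permutations, with one matrix for each factor. -/
noncomputable def permPairSum (G : ι → ι → ι → ℝ) : ℝ :=
  ∑ σ : Equiv.Perm ι, ∑ τ : Equiv.Perm ι,
    ((Equiv.Perm.sign σ : ℤ) : ℝ) * ((Equiv.Perm.sign τ : ℤ) : ℝ) * ∏ i, G i (σ i) (τ i)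

/-- Substitute `τ = σ ρ`; the signs of `σ` cancel. -/
lemma permPairSum_eq (G : ι → ι → ι → ℝ) :
    permPairSum G = ∑ σ : Equiv.Perm ι, ∑ ρ : Equiv.Perm ι,
      ((Equiv.Perm.sign ρ : ℤ) : ℝ) * ∏ i, G i (σ i) (σ (ρ i)) := by
  refine Finset.sum_congr rfl fun σ _ => ?_
  rw [← Equiv.sum_comp (Equiv.mulLeft σ)]
  refine Finset.sum_congr rfl fun ρ _ => ?_
  have h : ((Equiv.Perm.sign σ : ℤ) : ℝ) * ((Equiv.Perm.sign σ : ℤ) : ℝ) = 1 := by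
    rcases Int.units_eq_one_or (Equiv.Perm.sign σ) with h | h <;> rw [h] <;> norm_num
  rw [Equiv.coe_mulLeft, Equiv.Perm.sign_mul, Units.val_mul, Int.cast_mul, ← mul_assoc, h, one_mul]
  rfl

/-- Orthogonality at every index except `k` forces `ρ` to fix all of them, and then `ρ = 1`. -/
lemma permPairSum_single {G : ι → ι → ι → ℝ} {h : ι → ℝ} {F : ι → ι → ℝ} (k : ι)
    (hh : ∀ p, h p ≠ 0) (hk : ∀ p q, G k p q = F p q)
    (hd : ∀ i, i ≠ k → ∀ p, G i p p = h p) (ho : ∀ i, i ≠ k → ∀ p q, p ≠ q → G i p q = 0) :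
    permPairSum G = (∏ p, h p) * ∑ σ : Equiv.Perm ι, F (σ k) (σ k) / h (σ k) := by
  rw [permPairSum_eq, Finset.mul_sum]
  refine Finset.sum_congr rfl fun σ _ => ?_
  rw [Finset.sum_eq_single 1]
  · have e : ∀ i, G i (σ i) (σ i) =
        h (σ i) * if i = k then F (σ i) (σ i) / h (σ i) else 1 := fun i => by
      split_ifs with hi
      · rw [hi, hk, mul_div_cancel₀ _ (hh _)]
      · rw [hd i hi, mul_one]
    simp only [Equiv.Perm.sign_one, Units.val_one, Int.cast_one, one_mul, Equiv.Perm.one_apply, e]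
    rw [Finset.prod_mul_distrib, Equiv.prod_comp σ h, Finset.prod_ite_eq' Finset.univ k,
      if_pos (Finset.mem_univ _)]
  · intro ρ _ hρ
    obtain ⟨i, hik, hi⟩ : ∃ i, i ≠ k ∧ ρ i ≠ i := by
      by_contra! hcon
      rcases Equiv.Perm.eq_one_or_swap_of_fixed (l := k) (fun i hi _ => hcon i hi) with e | e
      · exact hρ e
      · exact hρ (e.trans (Equiv.swap_self k))
    rw [Finset.prod_eq_zero (Finset.mem_univ i) (ho i hik (σ i) (σ (ρ i))
      fun e => hi (σ.injective e).symm),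
      mul_zero]
  · exact fun hcon => absurd (Finset.mem_univ _) hcon

/-- With two exceptional indices only `ρ = 1` and the transposition survive, and they give the two
terms of a 2 × 2 determinant. -/
lemma permPairSum_pair {G : ι → ι → ι → ℝ} {h : ι → ℝ} {F : ι → ι → ℝ} {k l : ι} (hkl : k ≠ l)
    (hh : ∀ p, h p ≠ 0) (hk : ∀ p q, G k p q = F p q) (hl : ∀ p q, G l p q = F p q)
    (hd : ∀ i, i ≠ k → i ≠ l → ∀ p, G i p p = h p)
    (ho : ∀ i, i ≠ k → i ≠ l → ∀ p q, p ≠ q → G i p q = 0) :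
    permPairSum G = (∏ p, h p) * ∑ σ : Equiv.Perm ι,
      (F (σ k) (σ k) * F (σ l) (σ l) - F (σ k) (σ l) * F (σ l) (σ k)) / (h (σ k) * h (σ l)) := by
  rw [permPairSum_eq, Finset.mul_sum]
  refine Finset.sum_congr rfl fun σ _ => ?_
  have hne : (1 : Equiv.Perm ι) ≠ Equiv.swap k l := fun e => hkl (by
    rw [eq_comm, Equiv.Perm.one_def, Equiv.swap_eq_refl_iff] at e; exact e)
  rw [Fintype.sum_eq_add 1 (Equiv.swap k l) hne]
  · have e1 : ∀ i, G i (σ i) (σ i) =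
        h (σ i) * (if i = k then F (σ k) (σ k) / h (σ k) else 1) *
          (if i = l then F (σ l) (σ l) / h (σ l) else 1) := fun i => by
      by_cases hik : i = k
      · rw [if_pos hik, if_neg (fun e => hkl (hik.symm.trans e)), hik, hk,
          mul_div_cancel₀ _ (hh _), mul_one]
      by_cases hil : i = l
      · rw [if_neg hik, if_pos hil, hil, hl, mul_one, mul_div_cancel₀ _ (hh _)]
      rw [if_neg hik, if_neg hil, hd i hik hil, mul_one, mul_one]
    have e2 : ∀ i, G i (σ i) (σ (Equiv.swap k l i)) =
        h (σ i) * (if i = k then F (σ k) (σ l) / h (σ k) else 1) *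
          (if i = l then F (σ l) (σ k) / h (σ l) else 1) := fun i => by
      by_cases hik : i = k
      · rw [if_pos hik, if_neg (fun e => hkl (hik.symm.trans e)), hik, hk, Equiv.swap_apply_left,
          mul_div_cancel₀ _ (hh _), mul_one]
      by_cases hil : i = l
      · rw [if_neg hik, if_pos hil, hil, hl, Equiv.swap_apply_right, mul_one,
          mul_div_cancel₀ _ (hh _)]
      rw [if_neg hik, if_neg hil, Equiv.swap_apply_of_ne_of_ne hik hil, hd i hik hil, mul_one,
        mul_one]
    simp only [Equiv.Perm.sign_one, Units.val_one, Int.cast_one, one_mul, Equiv.Perm.one_apply, e1,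
      e2, Equiv.Perm.sign_swap hkl, Units.val_neg, Int.cast_neg, Finset.prod_mul_distrib,
      Equiv.prod_comp σ h, Finset.prod_ite_eq', Finset.mem_univ, if_true]
    have := hh (σ k)
    have := hh (σ l)
    field_simp
    ring
  · rintro ρ ⟨h1, h2⟩
    obtain ⟨i, hik, hil, hi⟩ : ∃ i, i ≠ k ∧ i ≠ l ∧ ρ i ≠ i := by
      by_contra! hcon
      exact (Equiv.Perm.eq_one_or_swap_of_fixed hcon).elim h1 h2
    rw [Finset.prod_eq_zero (Finset.mem_univ i) (ho i hik hil (σ i) (σ (ρ i))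
      fun e => hi (σ.injective e).symm),
      mul_zero]

variable {α : Type*}

/-- The square of the determinant of a family of functions evaluated at the points `x`. -/
noncomputable def detSq (φ : ι → α → ℝ) (x : ι → α) : ℝ :=
  (Matrix.of fun i j => φ i (x j)).det ^ 2

lemma detSq_mul_prod (φ g : ι → α → ℝ) (x : ι → α) :
    detSq φ x * ∏ i, g i (x i) = ∑ σ : Equiv.Perm ι, ∑ τ : Equiv.Perm ι,
      ((Equiv.Perm.sign σ : ℤ) : ℝ) * ((Equiv.Perm.sign τ : ℤ) : ℝ) *
        ∏ i, (φ (σ i) (x i) * φ (τ i) (x i) * g i (x i)) := by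
  rw [detSq, sq, Matrix.det_apply', Finset.sum_mul_sum, Finset.sum_mul]
  refine Finset.sum_congr rfl fun σ _ => ?_
  rw [Finset.sum_mul]
  refine Finset.sum_congr rfl fun τ _ => ?_
  simp only [Finset.prod_mul_distrib, Matrix.of_apply]
  ring

variable {w f : α → ℝ}

lemma prod_mul_apply_eq_prod (x : ι → α) (k : ι) :
    (∏ i, w (x i)) * f (x k) = ∏ i, (fun i t => w t * if i = k then f t else 1) i (x i) := by
  simp only [Finset.prod_mul_distrib, Finset.prod_ite_eq', Finset.mem_univ, if_true]

lemma prod_mul_apply₂_eq_prod (x : ι → α) (k l : ι) :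
    (∏ i, w (x i)) * (f (x k) * f (x l)) =
      ∏ i, (fun i t => w t * ((if i = k then f t else 1) * if i = l then f t else 1)) i (x i) := by
  simp only [Finset.prod_mul_distrib, Finset.prod_ite_eq', Finset.mem_univ, if_true]

variable [MeasurableSpace α] (μ : Measure α) [SigmaFinite μ] {φ g : ι → α → ℝ}

lemma integrable_detSq_mul_prod
    (hint : ∀ i p q, Integrable (fun t => φ p t * φ q t * g i t) μ) :
    Integrable (fun x : ι → α => detSq φ x * ∏ i, g i (x i)) (Measure.pi fun _ => μ) := by
  simp only [detSq_mul_prod]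
  refine integrable_finsetSum _ fun σ _ => integrable_finsetSum _ fun τ _ => ?_
  exact (Integrable.fintype_prod (f := fun i t => φ (σ i) t * φ (τ i) t * g i t)
    (fun i => hint i _ _)).const_mul _

/-- Andréief's identity, with a separate factor for each point. -/
lemma integral_detSq_mul_prod
    (hint : ∀ i p q, Integrable (fun t => φ p t * φ q t * g i t) μ) :
    ∫ x : ι → α, detSq φ x * ∏ i, g i (x i) ∂(Measure.pi fun _ => μ) =
      permPairSum fun i p q => ∫ t, φ p t * φ q t * g i t ∂μ := by
  simp only [detSq_mul_prod]
  have hi : ∀ σ τ : Equiv.Perm ι, Integrable (fun x : ι → α =>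
      ((Equiv.Perm.sign σ : ℤ) : ℝ) * ((Equiv.Perm.sign τ : ℤ) : ℝ) *
        ∏ i, (φ (σ i) (x i) * φ (τ i) (x i) * g i (x i))) (Measure.pi fun _ => μ) := fun σ τ =>
    (Integrable.fintype_prod (f := fun i t => φ (σ i) t * φ (τ i) t * g i t)
      (fun i => hint i _ _)).const_mul _
  rw [integral_finsetSum _ fun σ _ => integrable_finsetSum _ fun τ _ => hi σ τ]
  refine Finset.sum_congr rfl fun σ _ => ?_
  rw [integral_finsetSum _ fun τ _ => hi σ τ]
  refine Finset.sum_congr rfl fun τ _ => ?_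
  rw [integral_const_mul]
  congr 1
  exact integral_fintype_prod_eq_prod (f := fun i t => φ (σ i) t * φ (τ i) t * g i t)

lemma sum_perm_sum_apply (r : ι → ℝ) :
    ∑ k, ∑ σ : Equiv.Perm ι, r (σ k) = (Fintype.card ι).factorial * ∑ p, r p := by
  rw [Finset.sum_comm]
  simp only [Equiv.sum_comp, Finset.sum_const, Finset.card_univ, Fintype.card_perm, nsmul_eq_mul]

lemma sum_perm_sum_apply₂ (r : ι → ι → ℝ) :
    ∑ k, ∑ l, ∑ σ : Equiv.Perm ι, r (σ k) (σ l) =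
      (Fintype.card ι).factorial * ∑ p, ∑ q, r p q := by
  have h : ∀ σ : Equiv.Perm ι, ∑ k, ∑ l, r (σ k) (σ l) = ∑ p, ∑ q, r p q := fun σ => by
    rw [← Equiv.sum_comp σ fun p => ∑ q, r p q]
    exact Finset.sum_congr rfl fun k _ => Equiv.sum_comp σ _
  simp only [fun k => Finset.sum_comm (s := Finset.univ) (t := Finset.univ)
    (f := fun (l : ι) (σ : Equiv.Perm ι) => r (σ k) (σ l))]
  rw [Finset.sum_comm]
  simp only [h, Finset.sum_const, Finset.card_univ, Fintype.card_perm, nsmul_eq_mul]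

variable {μ}

variable (h0 : ∀ p q, Integrable (fun t => φ p t * φ q t * w t) μ)
  (h1 : ∀ p q, Integrable (fun t => φ p t * φ q t * (w t * f t)) μ)
  (h2 : ∀ p q, Integrable (fun t => φ p t * φ q t * (w t * (f t * f t))) μ)

include h0 h1 h2

omit [Fintype ι] [SigmaFinite μ] in
lemma integrable_insertion₂ (k l i p q : ι) : Integrable (fun t => φ p t * φ q t *
    (w t * ((if i = k then f t else 1) * if i = l then f t else 1))) μ := by
  split_ifs
  · exact h2 p q
  · simpa only [mul_one] using h1 p q
  · simpa only [one_mul] using h1 p q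
  · simpa only [mul_one] using h0 p q

omit h2 [Fintype ι] [SigmaFinite μ] in
lemma integrable_insertion (k i p q : ι) : Integrable (fun t => φ p t * φ q t *
    (w t * if i = k then f t else 1)) μ := by
  split_ifs
  · exact h1 p q
  · simpa only [mul_one] using h0 p q

omit h2 in
lemma integrable_detSq_mul_weight_mul_apply (k : ι) :
    Integrable (fun x : ι → α => detSq φ x * ((∏ i, w (x i)) * f (x k)))
      (Measure.pi fun _ => μ) := by
  simp only [prod_mul_apply_eq_prod]
  exact integrable_detSq_mul_prod μ (integrable_insertion h0 h1 k)

lemma integrable_detSq_mul_weight_mul_apply₂ (k l : ι) :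
    Integrable (fun x : ι → α => detSq φ x * ((∏ i, w (x i)) * (f (x k) * f (x l))))
      (Measure.pi fun _ => μ) := by
  simp only [prod_mul_apply₂_eq_prod]
  exact integrable_detSq_mul_prod μ (integrable_insertion₂ h0 h1 h2 k l)

variable (horth : ∀ p q, p ≠ q → ∫ t, φ p t * φ q t * w t ∂μ = 0)
  (hne : ∀ p, ∫ t, φ p t * φ p t * w t ∂μ ≠ 0)

include horth hne

omit h2 in
lemma integral_detSq_mul_weight_mul_apply (k : ι) :
    ∫ x : ι → α, detSq φ x * ((∏ i, w (x i)) * f (x k)) ∂(Measure.pi fun _ => μ) =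
      (∏ p, ∫ t, φ p t * φ p t * w t ∂μ) * ∑ σ : Equiv.Perm ι,
        (fun p => (∫ t, φ p t * φ p t * (w t * f t) ∂μ) / ∫ t, φ p t * φ p t * w t ∂μ) (σ k) := by
  simp only [prod_mul_apply_eq_prod]
  rw [integral_detSq_mul_prod μ (integrable_insertion h0 h1 k)]
  refine permPairSum_single (F := fun p q => ∫ t, φ p t * φ q t * (w t * f t) ∂μ) k hne ?_ ?_ ?_
  · intro p q
    simp only [if_true]
  · intro i hi p
    simp only [if_neg hi, mul_one]
  · intro i hi p q hpq
    simp only [if_neg hi, mul_one, horth p q hpq]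

/-- One formula covers `k = l` and `k ≠ l`, because the determinant term vanishes for `k = l`.
Summing over all `k, l` then gives unrestricted sums over `p, q`. -/
lemma integral_detSq_mul_weight_mul_apply₂ (k l : ι) :
    ∫ x : ι → α, detSq φ x * ((∏ i, w (x i)) * (f (x k) * f (x l))) ∂(Measure.pi fun _ => μ) =
      (∏ p, ∫ t, φ p t * φ p t * w t ∂μ) *
        ((if k = l then ∑ σ : Equiv.Perm ι, (fun p =>
          (∫ t, φ p t * φ p t * (w t * (f t * f t)) ∂μ) / ∫ t, φ p t * φ p t * w t ∂μ) (σ k)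
          else 0) + ∑ σ : Equiv.Perm ι, (fun p q =>
          ((∫ t, φ p t * φ p t * (w t * f t) ∂μ) * (∫ t, φ q t * φ q t * (w t * f t) ∂μ) -
            (∫ t, φ p t * φ q t * (w t * f t) ∂μ) * (∫ t, φ q t * φ p t * (w t * f t) ∂μ)) /
          ((∫ t, φ p t * φ p t * w t ∂μ) * ∫ t, φ q t * φ q t * w t ∂μ)) (σ k) (σ l)) := by
  by_cases hkl : k = l
  · subst hkl
    simp only [if_true, sub_self, zero_div, Finset.sum_const_zero, add_zero]
    exact integral_detSq_mul_weight_mul_apply (f := fun t => f t * f t) h0 h2 horth hne k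
  · rw [if_neg hkl, zero_add]
    simp only [prod_mul_apply₂_eq_prod]
    rw [integral_detSq_mul_prod μ (integrable_insertion₂ h0 h1 h2 k l)]
    refine permPairSum_pair (F := fun p q => ∫ t, φ p t * φ q t * (w t * f t) ∂μ) hkl hne
      ?_ ?_ ?_ ?_
    · intro p q
      simp only [if_true, if_neg hkl, mul_one]
    · intro p q
      simp only [if_true, if_neg (Ne.symm hkl), one_mul]
    · intro i hik hil p
      simp only [if_neg hik, if_neg hil, mul_one]
    · intro i hik hil p q hpq
      simp only [if_neg hik, if_neg hil, mul_one, horth p q hpq]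

omit h1 h2 in
lemma integral_detSq_mul_weight [Nonempty ι] :
    ∫ x : ι → α, detSq φ x * ∏ i, w (x i) ∂(Measure.pi fun _ => μ) =
      (∏ p, ∫ t, φ p t * φ p t * w t ∂μ) * (Fintype.card ι).factorial := by
  have h := integral_detSq_mul_weight_mul_apply (f := fun _ => 1) h0
    (by simpa only [mul_one] using h0) horth hne (Classical.arbitrary ι)
  simp only [mul_one, div_self (hne _), Finset.sum_const, Finset.card_univ, Fintype.card_perm,
    nsmul_eq_mul] at h
  exact h

omit h2 in
lemma integral_detSq_mul_sum [Nonempty ι] :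
    ∫ x : ι → α, detSq φ x * (∏ i, w (x i)) * ∑ k, f (x k) ∂(Measure.pi fun _ => μ) =
      (∫ x : ι → α, detSq φ x * ∏ i, w (x i) ∂(Measure.pi fun _ => μ)) *
        ∑ p, (∫ t, φ p t * φ p t * (w t * f t) ∂μ) / ∫ t, φ p t * φ p t * w t ∂μ := by
  have e : ∀ x : ι → α, detSq φ x * (∏ i, w (x i)) * ∑ k, f (x k) =
      ∑ k, detSq φ x * ((∏ i, w (x i)) * f (x k)) := fun x => by
    simp only [Finset.mul_sum, mul_assoc]
  simp only [e]
  rw [integral_finsetSum _ fun k _ => integrable_detSq_mul_weight_mul_apply h0 h1 k,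
    Finset.sum_congr rfl fun k _ => integral_detSq_mul_weight_mul_apply h0 h1 horth hne k,
    ← Finset.mul_sum, integral_detSq_mul_weight h0 horth hne, mul_assoc]
  congr 1
  exact sum_perm_sum_apply fun p =>
    (∫ t, φ p t * φ p t * (w t * f t) ∂μ) / ∫ t, φ p t * φ p t * w t ∂μ

lemma integral_detSq_mul_sum_sq [Nonempty ι] :
    ∫ x : ι → α, detSq φ x * (∏ i, w (x i)) * (∑ k, f (x k)) ^ 2 ∂(Measure.pi fun _ => μ) =
      (∫ x : ι → α, detSq φ x * ∏ i, w (x i) ∂(Measure.pi fun _ => μ)) *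
        (∑ p, (∫ t, φ p t * φ p t * (w t * (f t * f t)) ∂μ) / (∫ t, φ p t * φ p t * w t ∂μ) +
          ∑ p, ∑ q,
            ((∫ t, φ p t * φ p t * (w t * f t) ∂μ) * (∫ t, φ q t * φ q t * (w t * f t) ∂μ) -
            (∫ t, φ p t * φ q t * (w t * f t) ∂μ) * (∫ t, φ q t * φ p t * (w t * f t) ∂μ)) /
            ((∫ t, φ p t * φ p t * w t ∂μ) * ∫ t, φ q t * φ q t * w t ∂μ)) := by
  have e : ∀ x : ι → α, detSq φ x * (∏ i, w (x i)) * (∑ k, f (x k)) ^ 2 =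
      ∑ k, ∑ l, detSq φ x * ((∏ i, w (x i)) * (f (x k) * f (x l))) := fun x => by
    rw [sq, Finset.sum_mul_sum]
    simp only [Finset.mul_sum, mul_assoc]
  simp only [e]
  have hi := integrable_detSq_mul_weight_mul_apply₂ h0 h1 h2
  rw [integral_finsetSum _ fun k _ => integrable_finsetSum _ fun l _ => hi k l,
    Finset.sum_congr rfl fun k _ => (integral_finsetSum _ fun l _ => hi k l),
    Finset.sum_congr rfl fun k _ => Finset.sum_congr rfl fun l _ =>
      integral_detSq_mul_weight_mul_apply₂ h0 h1 h2 horth hne k l]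
  simp only [← Finset.mul_sum, Finset.sum_add_distrib, Finset.sum_ite_eq, Finset.mem_univ, if_true]
  rw [integral_detSq_mul_weight h0 horth hne]
  have e1 := sum_perm_sum_apply fun p =>
    (∫ t, φ p t * φ p t * (w t * (f t * f t)) ∂μ) / ∫ t, φ p t * φ p t * w t ∂μ
  have e2 := sum_perm_sum_apply₂ fun p q =>
    ((∫ t, φ p t * φ p t * (w t * f t) ∂μ) * (∫ t, φ q t * φ q t * (w t * f t) ∂μ) -
      (∫ t, φ p t * φ q t * (w t * f t) ∂μ) * (∫ t, φ q t * φ p t * (w t * f t) ∂μ)) /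
    ((∫ t, φ p t * φ p t * w t ∂μ) * ∫ t, φ q t * φ q t * w t ∂μ)
  rw [e1, e2]
  ring

end Andreief

/-! ### Translation between the ensemble on `[-1, 1]` and Jacobi polynomials on `[0, 1]`. -/

section Ensemble

open Set Polynomial

lemma setIntegral_Icc_mild_mul_weight (g : mildFunctions) (A B : ℕ) :
    ∫ t in Icc (-1 : ℝ) 1, g.1 ((1 + t) / 2) * ((1 + t) ^ A * (1 - t) ^ B) =
      2 ^ (A + B + 1) * jacobiFunctional A B g := by
  have hA : (-1 : ℝ) < A := by have := Nat.cast_nonneg (α := ℝ) A; linarith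
  have hB : (-1 : ℝ) < B := by have := Nat.cast_nonneg (α := ℝ) B; linarith
  have h := intervalIntegral.integral_comp_div_add (a := -1) (b := 1)
    (fun s : ℝ => g.1 s * (s ^ A * (1 - s) ^ B)) (two_ne_zero' ℝ) (1 / 2)
  rw [show (-1 : ℝ) / 2 + 1 / 2 = 0 by norm_num, show (1 : ℝ) / 2 + 1 / 2 = 1 by norm_num,
    intervalIntegral.integral_of_le zero_le_one, integral_Ioc_eq_integral_Ioo,
    intervalIntegral.integral_of_le (by norm_num), ← integral_Icc_eq_integral_Ioc, smul_eq_mul] at h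
  rw [jacobiFunctional_apply hA hB]
  simp only [Real.rpow_natCast]
  rw [pow_succ, mul_assoc, ← h, ← integral_const_mul]
  refine integral_congr_ae (Filter.Eventually.of_forall fun t => ?_)
  dsimp only
  rw [show t / 2 + 1 / 2 = (1 + t) / 2 by ring, show 1 - (1 + t) / 2 = (1 - t) / 2 by ring, div_pow,
    div_pow, pow_add]
  field_simp

lemma mildJacobi_apply (a b : ℝ) (j : ℕ) (t : ℝ) :
    (mildJacobi a b j).1 t = (jacobi a b j).eval t := by
  have h := aeval_algHom_apply ((Pi.evalAlgHom ℝ (fun _ : ℝ => ℝ) t).comp mildFunctions.val)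
    mildCoord (jacobi a b j)
  rw [← Polynomial.coe_aeval_eq_eval]
  exact h.symm

lemma v_eq_mildEntropy (x : ℝ) : FermionicGaussian.v x = mildEntropy.1 ((1 + x) / 2) := by
  change _ = (1 + x) / 2 * (Real.log ((1 + x) / 2) - Real.log (1 - (1 + x) / 2)) +
    Real.log (1 - (1 + x) / 2)
  rw [FermionicGaussian.v, show 1 - (1 + x) / 2 = (1 - x) / 2 by ring]
  ring

lemma continuous_v : Continuous FermionicGaussian.v := by
  have h1 := Real.continuous_mul_log.comp (show Continuous fun x : ℝ => (1 - x) / 2 by fun_prop)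
  have h2 := Real.continuous_mul_log.comp (show Continuous fun x : ℝ => (1 + x) / 2 by fun_prop)
  exact h1.add h2

/-- The shifted Jacobi polynomials on `[-1, 1]`. -/
noncomputable def shiftedJacobi (a b : ℝ) (j : ℕ) (x : ℝ) : ℝ := (jacobi a b j).eval ((1 + x) / 2)

lemma continuous_shiftedJacobi (a b : ℝ) (j : ℕ) : Continuous (shiftedJacobi a b j) :=
  (jacobi a b j).continuous.comp (by fun_prop)

lemma coeff_jacobi_self (a b : ℝ) (j : ℕ) : (jacobi a b j).coeff j = 1 := by
  rw [coeff_jacobi, if_pos le_rfl, jacobiCoeff_self]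

lemma natDegree_jacobi (a b : ℝ) (j : ℕ) : (jacobi a b j).natDegree = j :=
  natDegree_eq_of_le_of_coeff_ne_zero (natDegree_le_of_degree_le (degree_jacobi_le j))
    (by rw [coeff_jacobi_self]; exact one_ne_zero)

/-- For monic polynomials the determinant is the Vandermonde determinant in `(1 + x_i) / 2`; each
difference is halved, hence a factor `4` for every pair after squaring. -/
lemma detSq_shiftedJacobi (a b : ℝ) {m : ℕ} (x : Fin m → ℝ) :
    (∏ i : Fin m, ∏ _j ∈ Finset.Ioi i, (4 : ℝ)) * detSq (fun i : Fin m => shiftedJacobi a b i) x =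
      ∏ i, ∏ j ∈ Finset.Ioi i, (x i - x j) ^ 2 := by
  have h := Matrix.det_eval_matrixOfPolynomials_eq_det_vandermonde (fun i => (1 + x i) / 2)
    (fun j : Fin m => jacobi a b j) (fun j => natDegree_jacobi a b j) (fun j => by
      rw [Monic, leadingCoeff, natDegree_jacobi, coeff_jacobi_self])
  rw [detSq, ← Matrix.det_transpose]
  change _ * (Matrix.of fun i j : Fin m => eval ((1 + x i) / 2) (jacobi a b j)).det ^ 2 = _
  rw [← h, Matrix.det_vandermonde]
  simp only [← Finset.prod_pow, ← Finset.prod_mul_distrib]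
  refine Finset.prod_congr rfl fun i _ => Finset.prod_congr rfl fun j _ => ?_
  ring

/-- The one-point weight of the ensemble. -/
def pointWeight (A B : ℕ) (t : ℝ) : ℝ := (1 + t) ^ A * (1 - t) ^ B

lemma continuous_pointWeight (A B : ℕ) : Continuous (pointWeight A B) := by
  unfold pointWeight
  fun_prop

lemma setIntegral_shiftedJacobi_mul (A B i j : ℕ) (g : mildFunctions) :
    ∫ t in Icc (-1 : ℝ) 1, shiftedJacobi A B i t * shiftedJacobi A B j t *
        (pointWeight A B t * g.1 ((1 + t) / 2)) =
      2 ^ (A + B + 1) * jacobiFunctional A B (g * (mildJacobi A B i * mildJacobi A B j)) := by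
  rw [← setIntegral_Icc_mild_mul_weight]
  refine integral_congr_ae (Filter.Eventually.of_forall fun t => ?_)
  change _ = (g.1 _ * ((mildJacobi A B i).1 _ * (mildJacobi A B j).1 _)) * _
  rw [mildJacobi_apply, mildJacobi_apply]
  unfold shiftedJacobi pointWeight
  ring

lemma weight_eq (m n p : ℕ) (x : Fin m → ℝ) :
    FermionicGaussian.weight m n p x = (∏ i : Fin m, ∏ _j ∈ Finset.Ioi i, (4 : ℝ)) *
      (detSq (fun i : Fin m => shiftedJacobi (p - m : ℕ) (n - p : ℕ) i) x *
        ∏ i, pointWeight (p - m) (n - p) (x i)) := by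
  rw [← mul_assoc, detSq_shiftedJacobi]
  rfl

lemma continuous_weight (m n p : ℕ) : Continuous (FermionicGaussian.weight m n p) := by
  unfold FermionicGaussian.weight
  fun_prop

lemma weight_nonneg {m : ℕ} (n p : ℕ) {x : Fin m → ℝ}
    (hx : x ∈ Icc (fun _ => (-1 : ℝ)) (fun _ => (1 : ℝ))) :
    0 ≤ FermionicGaussian.weight m n p x := by
  refine mul_nonneg (Finset.prod_nonneg fun i _ => Finset.prod_nonneg fun j _ => sq_nonneg _)
    (Finset.prod_nonneg fun i _ => mul_nonneg (pow_nonneg ?_ _) (pow_nonneg ?_ _))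
  · have := hx.1 i
    dsimp only at this
    linarith
  · have := hx.2 i
    dsimp only at this
    linarith

lemma volume_restrict_cube (m : ℕ) :
    volume.restrict (Icc (fun _ : Fin m => (-1 : ℝ)) (fun _ => (1 : ℝ))) =
      Measure.pi fun _ : Fin m => volume.restrict (Icc (-1 : ℝ) 1) := by
  rw [← pi_univ_Icc, volume_pi, Measure.restrict_pi_pi]

end Ensemble

/-! ### Integrals against a normalized density. -/

section NormalizedDensity

variable {X : Type*} [MeasurableSpace X] {μ : Measure X} {W : X → ℝ}

lemma withDensity_ofReal_univ (hi : Integrable W μ) (h0 : 0 ≤ᵐ[μ] W) :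
    μ.withDensity (fun x => ENNReal.ofReal (W x)) Set.univ = ENNReal.ofReal (∫ x, W x ∂μ) := by
  rw [withDensity_apply _ MeasurableSet.univ, Measure.restrict_univ,
    ofReal_integral_eq_lintegral_ofReal hi h0]

lemma integral_normalized_withDensity (hm : Measurable W) (hi : Integrable W μ)
    (h0 : 0 ≤ᵐ[μ] W) (G : X → ℝ) :
    ∫ x, G x ∂((μ.withDensity (fun x => ENNReal.ofReal (W x)) Set.univ)⁻¹ •
        μ.withDensity (fun x => ENNReal.ofReal (W x))) =
      (∫ x, W x ∂μ)⁻¹ * ∫ x, W x * G x ∂μ := by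
  rw [integral_smul_measure, withDensity_ofReal_univ hi h0, ENNReal.toReal_inv,
    ENNReal.toReal_ofReal (integral_nonneg_of_ae h0), smul_eq_mul,
    integral_withDensity_eq_integral_toReal_smul hm.ennreal_ofReal
      (Filter.Eventually.of_forall fun _ => ENNReal.ofReal_lt_top)]
  congr 1
  refine integral_congr_ae ?_
  filter_upwards [h0] with x hx
  rw [ENNReal.toReal_ofReal hx, smul_eq_mul]

lemma isProbabilityMeasure_normalized_withDensity (hi : Integrable W μ) (h0 : 0 ≤ᵐ[μ] W)
    (hpos : 0 < ∫ x, W x ∂μ) :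
    IsProbabilityMeasure ((μ.withDensity (fun x => ENNReal.ofReal (W x)) Set.univ)⁻¹ •
        μ.withDensity (fun x => ENNReal.ofReal (W x))) := by
  refine ⟨?_⟩
  rw [Measure.smul_apply, smul_eq_mul, withDensity_ofReal_univ hi h0]
  exact ENNReal.inv_mul_cancel (by simpa using hpos) ENNReal.ofReal_ne_top

end NormalizedDensity

/-! ### The variance of the entropy as a determinantal covariance. -/

section EnsembleVariance

open Set

variable {m : ℕ} (n p : ℕ)

lemma integrable_cube_of_continuous {G : (Fin m → ℝ) → ℝ} (hG : Continuous G) :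
    Integrable G (volume.restrict (Icc (fun _ => (-1 : ℝ)) (fun _ => (1 : ℝ)))) :=
  hG.continuousOn.integrableOn_compact isCompact_Icc

lemma ae_weight_nonneg : 0 ≤ᵐ[volume.restrict (Icc (fun _ : Fin m => (-1 : ℝ)) (fun _ => (1 : ℝ)))]
    FermionicGaussian.weight m n p :=
  (ae_restrict_iff' measurableSet_Icc).2 (Filter.Eventually.of_forall fun _ hx =>
    weight_nonneg n p hx)

lemma integral_shiftedJacobi_mul (A B i j : ℕ) :
    ∫ t in Icc (-1 : ℝ) 1, shiftedJacobi A B i t * shiftedJacobi A B j t * pointWeight A B t =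
      2 ^ (A + B + 1) * jacobiFunctional A B (mildJacobi A B i * mildJacobi A B j) := by
  have h := setIntegral_shiftedJacobi_mul A B i j 1
  rw [one_mul] at h
  rw [← h]
  refine integral_congr_ae (Filter.Eventually.of_forall fun t => ?_)
  change _ = _ * (_ * 1)
  rw [mul_one]

lemma integral_shiftedJacobi_mul_of_ne (A B : ℕ) {i j : ℕ} (hij : i ≠ j) :
    ∫ t in Icc (-1 : ℝ) 1, shiftedJacobi A B i t * shiftedJacobi A B j t * pointWeight A B t =
      0 := by
  have hA : (-1 / 2 : ℝ) < A := by have := Nat.cast_nonneg (α := ℝ) A; linarith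
  have hB : (-1 / 2 : ℝ) < B := by have := Nat.cast_nonneg (α := ℝ) B; linarith
  have h := (isJacobi_jacobiFunctional hA hB).orthogonal hij
  rw [integral_shiftedJacobi_mul, mildJacobi, mildJacobi, ← map_mul]
  exact mul_eq_zero_of_right _ h

lemma integral_shiftedJacobi_sq_pos (A B i : ℕ) :
    0 < ∫ t in Icc (-1 : ℝ) 1,
      shiftedJacobi A B i t * shiftedJacobi A B i t * pointWeight A B t := by
  have hA : (-1 / 2 : ℝ) < A := by have := Nat.cast_nonneg (α := ℝ) A; linarith
  have hB : (-1 / 2 : ℝ) < B := by have := Nat.cast_nonneg (α := ℝ) B; linarith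
  rw [integral_shiftedJacobi_mul, ← sq, jacobiFunctional_mildJacobi_sq hA hB]
  exact mul_pos (by positivity) (jacobiNorm_pos hA hB i)

lemma continuous_shiftedJacobi_mul (A B i j : ℕ) :
    Continuous fun t => shiftedJacobi A B i t * shiftedJacobi A B j t :=
  (continuous_shiftedJacobi _ _ _).mul (continuous_shiftedJacobi _ _ _)

lemma integral_detSq_shiftedJacobi_pos (A B : ℕ) (hm : 1 ≤ m) :
    0 < ∫ x : Fin m → ℝ, detSq (fun i : Fin m => shiftedJacobi A B i) x *
      ∏ i, pointWeight A B (x i) ∂(Measure.pi fun _ => volume.restrict (Icc (-1 : ℝ) 1)) := by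
  have : Nonempty (Fin m) := ⟨⟨0, hm⟩⟩
  rw [integral_detSq_mul_weight (ι := Fin m) (fun i j => ((continuous_shiftedJacobi_mul A B i j).mul
      (continuous_pointWeight A B)).integrableOn_Icc)
    (fun i j hij => integral_shiftedJacobi_mul_of_ne A B fun e => hij (Fin.ext e))
    fun i => (integral_shiftedJacobi_sq_pos A B i).ne']
  exact mul_pos (Finset.prod_pos fun i _ => integral_shiftedJacobi_sq_pos A B i)
    (by exact_mod_cast Nat.factorial_pos _)

lemma integral_weight_mul (G : (Fin m → ℝ) → ℝ) :
    ∫ x in Icc (fun _ => (-1 : ℝ)) (fun _ => (1 : ℝ)), FermionicGaussian.weight m n p x * G x =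
      (∏ i : Fin m, ∏ _j ∈ Finset.Ioi i, (4 : ℝ)) *
        ∫ x, detSq (fun i : Fin m => shiftedJacobi (p - m : ℕ) (n - p : ℕ) i) x *
          (∏ i, pointWeight (p - m) (n - p) (x i)) * G x
          ∂(Measure.pi fun _ => volume.restrict (Icc (-1 : ℝ) 1)) := by
  rw [volume_restrict_cube, ← integral_const_mul]
  simp only [weight_eq, mul_assoc]

lemma integral_weight_pos (hm : 1 ≤ m) :
    0 < ∫ x in Icc (fun _ => (-1 : ℝ)) (fun _ => (1 : ℝ)), FermionicGaussian.weight m n p x := by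
  have h := integral_weight_mul (m := m) n p fun _ => 1
  simp only [mul_one] at h
  rw [h]
  exact mul_pos (by positivity) (integral_detSq_shiftedJacobi_pos _ _ hm)

lemma isProbabilityMeasure_ensemble (hm : 1 ≤ m) :
    IsProbabilityMeasure (FermionicGaussian.ensemble m n p) :=
  isProbabilityMeasure_normalized_withDensity
    (integrable_cube_of_continuous (continuous_weight m n p)) (ae_weight_nonneg n p)
    (integral_weight_pos n p hm)

lemma integral_ensemble (G : (Fin m → ℝ) → ℝ) :
    ∫ x, G x ∂(FermionicGaussian.ensemble m n p) =
      (∫ x, detSq (fun i : Fin m => shiftedJacobi (p - m : ℕ) (n - p : ℕ) i) x *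
          (∏ i, pointWeight (p - m) (n - p) (x i))
          ∂(Measure.pi fun _ => volume.restrict (Icc (-1 : ℝ) 1)))⁻¹ *
        ∫ x, detSq (fun i : Fin m => shiftedJacobi (p - m : ℕ) (n - p : ℕ) i) x *
          (∏ i, pointWeight (p - m) (n - p) (x i)) * G x
          ∂(Measure.pi fun _ => volume.restrict (Icc (-1 : ℝ) 1)) := by
  have h := integral_weight_mul (m := m) n p fun _ => 1
  simp only [mul_one] at h
  rw [FermionicGaussian.ensemble, FermionicGaussian.unnormalized, integral_normalized_withDensity
    (continuous_weight m n p).measurable (integrable_cube_of_continuous (continuous_weight m n p))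
    (ae_weight_nonneg n p), integral_weight_mul, h, mul_inv]
  have hc : (∏ i : Fin m, ∏ _j ∈ Finset.Ioi i, (4 : ℝ)) ≠ 0 := by positivity
  field_simp

/-- A continuous function is bounded on the cube, and the ensemble is absolutely continuous with
respect to Lebesgue measure on the cube. -/
lemma memLp_ensemble (hm : 1 ≤ m) {G : (Fin m → ℝ) → ℝ} (hG : Continuous G) :
    MemLp G 2 (FermionicGaussian.ensemble m n p) := by
  have := isProbabilityMeasure_ensemble n p hm
  obtain ⟨C, hC⟩ := (isCompact_Icc (a := fun _ : Fin m => (-1 : ℝ))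
    (b := fun _ => (1 : ℝ))).exists_bound_of_continuousOn hG.continuousOn
  refine MemLp.of_bound hG.aestronglyMeasurable C ?_
  have h : ∀ᵐ x ∂(volume.restrict (Icc (fun _ : Fin m => (-1 : ℝ)) (fun _ => (1 : ℝ)))),
      ‖G x‖ ≤ C := (ae_restrict_iff' measurableSet_Icc).2 (Filter.Eventually.of_forall hC)
  exact Measure.ae_smul_measure (withDensity_absolutelyContinuous _ _ h) _

lemma continuous_entropy : Continuous (FermionicGaussian.entropy m) :=
  (continuous_finsetSum _ fun i _ => continuous_v.comp (continuous_apply i)).neg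

lemma variance_entropy (hm : 1 ≤ m) :
    variance (FermionicGaussian.entropy m) (FermionicGaussian.ensemble m n p) =
      detCov (jacobiFunctional (p - m : ℕ) (n - p : ℕ)) (mildJacobi (p - m : ℕ) (n - p : ℕ)) m
        mildEntropy mildEntropy := by
  have := isProbabilityMeasure_ensemble n p hm
  have : Nonempty (Fin m) := ⟨⟨0, hm⟩⟩
  rw [variance_eq_sub (memLp_ensemble n p hm continuous_entropy)]
  have e2 : ∀ x, (FermionicGaussian.entropy m ^ 2) x = (∑ k, FermionicGaussian.v (x k)) ^ 2 :=
    fun x => neg_sq _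
  have e1 : ∫ x, FermionicGaussian.entropy m x ∂(FermionicGaussian.ensemble m n p) =
      -∫ x : Fin m → ℝ, ∑ k, FermionicGaussian.v (x k) ∂(FermionicGaussian.ensemble m n p) :=
    integral_neg _
  rw [e1, neg_sq, integral_congr_ae (Filter.Eventually.of_forall e2), integral_ensemble n p,
    integral_ensemble n p]
  have hpos := integral_detSq_shiftedJacobi_pos (p - m) (n - p) hm
  generalize p - m = A at *
  generalize n - p = B at *
  have hφ := continuous_shiftedJacobi_mul A B
  have hw := continuous_pointWeight A B
  have h0 : ∀ i j : Fin m, IntegrableOn (fun t => shiftedJacobi A B i t * shiftedJacobi A B j t *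
    pointWeight A B t) (Icc (-1) 1) := fun i j => ((hφ i j).mul hw).integrableOn_Icc
  have h1 : ∀ i j : Fin m, IntegrableOn (fun t => shiftedJacobi A B i t * shiftedJacobi A B j t *
    (pointWeight A B t * FermionicGaussian.v t)) (Icc (-1) 1) := fun i j =>
    ((hφ i j).mul (hw.mul continuous_v)).integrableOn_Icc
  have h2 : ∀ i j : Fin m, IntegrableOn (fun t => shiftedJacobi A B i t * shiftedJacobi A B j t *
    (pointWeight A B t * (FermionicGaussian.v t * FermionicGaussian.v t))) (Icc (-1) 1) :=
    fun i j => ((hφ i j).mul (hw.mul (continuous_v.mul continuous_v))).integrableOn_Icc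
  have ho : ∀ i j : Fin m, i ≠ j → ∫ t in Icc (-1 : ℝ) 1,
      shiftedJacobi A B i t * shiftedJacobi A B j t * pointWeight A B t = 0 :=
    fun i j hij => integral_shiftedJacobi_mul_of_ne A B fun e => hij (Fin.ext e)
  have hn : ∀ i : Fin m, ∫ t in Icc (-1 : ℝ) 1,
      shiftedJacobi A B i t * shiftedJacobi A B i t * pointWeight A B t ≠ 0 :=
    fun i => (integral_shiftedJacobi_sq_pos A B i).ne'
  have E1 : ∀ i j : ℕ, ∫ t in Icc (-1 : ℝ) 1, shiftedJacobi A B i t * shiftedJacobi A B j t *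
      (pointWeight A B t * FermionicGaussian.v t) = 2 ^ (A + B + 1) *
        jacobiFunctional A B (mildEntropy * (mildJacobi A B i * mildJacobi A B j)) := fun i j => by
    simp only [v_eq_mildEntropy]
    exact setIntegral_shiftedJacobi_mul A B i j mildEntropy
  have E2 : ∀ i j : ℕ, ∫ t in Icc (-1 : ℝ) 1, shiftedJacobi A B i t * shiftedJacobi A B j t *
      (pointWeight A B t * (FermionicGaussian.v t * FermionicGaussian.v t)) = 2 ^ (A + B + 1) *
        jacobiFunctional A B (mildEntropy * mildEntropy * (mildJacobi A B i * mildJacobi A B j)) :=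
    fun i j => by
    simp only [v_eq_mildEntropy]
    exact setIntegral_shiftedJacobi_mul A B i j (mildEntropy * mildEntropy)
  rw [integral_detSq_mul_sum_sq h0 h1 h2 ho hn, integral_detSq_mul_sum h0 h1 ho hn,
    inv_mul_cancel_left₀ hpos.ne', inv_mul_cancel_left₀ hpos.ne']
  -- The Jacobian factor from rescaling `[-1, 1]` cancels in every quotient.
  have hK : (2 : ℝ) ^ (A + B + 1) ≠ 0 := by positivity
  have hN : ∀ i : ℕ, jacobiFunctional A B (mildJacobi A B i ^ 2) ≠ 0 := fun i => by
    have := integral_shiftedJacobi_sq_pos A B i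
    rw [integral_shiftedJacobi_mul, ← sq] at this
    exact (pos_of_mul_pos_right this (by positivity)).ne'
  simp only [E1, E2, integral_shiftedJacobi_mul]
  rw [detCov, Finset.sum_range, Finset.sum_range, add_sub_assoc]
  refine Eq.trans (congrArg₂ (· + ·) ?_ ?_) (sub_eq_add_neg _ _).symm
  · refine Finset.sum_congr rfl fun i _ => ?_
    rw [mul_div_mul_left _ _ hK, sq]
  -- The squared mean removes the product of diagonal elements from each 2 × 2 determinant, leaving
  -- minus the off-diagonal product.
  · rw [sq (Finset.sum _ _), Finset.sum_mul_sum, ← Finset.sum_sub_distrib,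
      ← Finset.sum_neg_distrib]
    refine Finset.sum_congr rfl fun i _ => ?_
    rw [Finset.sum_range, ← Finset.sum_sub_distrib, ← Finset.sum_neg_distrib]
    refine Finset.sum_congr rfl fun j _ => ?_
    have := hN i
    have := hN j
    rw [mul_comm (mildJacobi A B j) (mildJacobi A B i)]
    simp only [← sq (mildJacobi (A : ℝ) B _)]
    field_simp
    ring

end EnsembleVariance

open FermionicGaussian in
lemma poch_two {x : ℝ} (hx : 0 < x) : poch x 2 = x * (x + 1) := by
  have h := (Real.Gamma_pos_of_pos hx).ne'
  rw [poch, show x + ((2 : ℕ) : ℝ) = x + 1 + 1 by push_cast; ring,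
    Real.Gamma_add_one (by positivity), Real.Gamma_add_one hx.ne']
  field_simp

open FermionicGaussian in
lemma poch_three {x : ℝ} (hx : 0 < x) : poch x 3 = x * (x + 1) * (x + 2) := by
  have h := (Real.Gamma_pos_of_pos hx).ne'
  rw [poch, show x + ((3 : ℕ) : ℝ) = x + 1 + 1 + 1 by push_cast; ring,
    Real.Gamma_add_one (by positivity), Real.Gamma_add_one (by positivity),
    Real.Gamma_add_one hx.ne']
  field_simp
  ring

theorem proposition4 (m n p : ℕ) (hm : 1 ≤ m) (hmp : m ≤ p) (hpn : p ≤ n) :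
    IsProbabilityMeasure (FermionicGaussian.ensemble m n p) ∧
    MemLp (FermionicGaussian.entropy m) 2 (FermionicGaussian.ensemble m n p) ∧
    variance (FermionicGaussian.entropy m) (FermionicGaussian.ensemble m n p) =
      FermionicGaussian.c0 m n p * FermionicGaussian.psi1 ((m : ℝ) + n - p)
        - ((m : ℝ) + n) * FermionicGaussian.psi1 ((m : ℝ) + n)
        + (n : ℝ) * FermionicGaussian.psi1 (n : ℝ)
        + FermionicGaussian.c1 m n p * FermionicGaussian.psi1 (p : ℝ)
        + FermionicGaussian.c2 m n p *
            (FermionicGaussian.psi0 ((m : ℝ) + n - p) - FermionicGaussian.psi0 (p : ℝ)) ^ 2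
        + FermionicGaussian.c3 m n p *
            (FermionicGaussian.psi0 ((m : ℝ) + n - p) - FermionicGaussian.psi0 (p : ℝ))
        - FermionicGaussian.psi0 ((m : ℝ) + n)
        + FermionicGaussian.psi0 (n : ℝ)
        + FermionicGaussian.c4 m n := by
  refine ⟨isProbabilityMeasure_ensemble n p hm, memLp_ensemble n p hm continuous_entropy, ?_⟩
  obtain ⟨k, rfl⟩ : ∃ k, m = k + 1 := ⟨m - 1, by omega⟩
  have hA : (-1 / 2 : ℝ) < (p - (k + 1) : ℕ) := by
    have := Nat.cast_nonneg (α := ℝ) (p - (k + 1)); linarith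
  have hB : (-1 / 2 : ℝ) < (n - p : ℕ) := by
    have := Nat.cast_nonneg (α := ℝ) (n - p); linarith
  have ea : ((p - (k + 1) : ℕ) : ℝ) = p - ((k + 1 : ℕ) : ℝ) := Nat.cast_sub hmp
  have eb : ((n - p : ℕ) : ℝ) = n - p := Nat.cast_sub hpn
  have hx1 : (1 : ℝ) ≤ ((k + 1 : ℕ) : ℝ) := by exact_mod_cast hm
  have hn1 : (1 : ℝ) ≤ n := by exact_mod_cast hm.trans (hmp.trans hpn)
  -- With `x = m`, `a = p - m`, `b = n - p` and `y = m + n`, the four arguments are `x + a = p`, `x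
  -- + b = m + n - p`, `y - x = n` and `y = m + n`.
  have key := detCov_entropy hA hB k (x := ((k + 1 : ℕ) : ℝ)) (y := ((k + 1 : ℕ) : ℝ) + n)
    (by push_cast; ring) (by rw [ea, eb]; ring) (by linarith)
  rw [variance_entropy n p hm, key, ea, eb]
  generalize ((k + 1 : ℕ) : ℝ) = x at *
  rw [show x + ((n : ℝ) - p) = x + n - p by ring, show x + n - x = n by ring,
    show x + (p - x) = p by ring, FermionicGaussian.c0, FermionicGaussian.c1,
    FermionicGaussian.c2, FermionicGaussian.c3, FermionicGaussian.c4,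
    poch_two (by linarith), poch_three (by linarith)]
  have n1 : x + n ≠ 0 := by linarith
  have n2 : x + n - 1 ≠ 0 := by linarith
  have n3 : x + n + 1 ≠ 0 := by linarith
  rw [show x + (n : ℝ) - 1 + 1 = x + n by ring, show x + (n : ℝ) - 1 + 2 = x + n + 1 by ring]
  generalize FermionicGaussian.psi0 _ = s1
  generalize FermionicGaussian.psi0 _ = s2
  generalize FermionicGaussian.psi0 _ = s3
  generalize FermionicGaussian.psi0 _ = s4
  generalize FermionicGaussian.psi1 _ = t1
  generalize FermionicGaussian.psi1 _ = t2
  generalize FermionicGaussian.psi1 _ = t3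
  generalize FermionicGaussian.psi1 _ = t4
  clear key ea eb hA hB
  field_simp
  ring
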